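/- **Second variation formula.** Let $M$ be a smooth $n$-dimensional manifold (Hausdorff, second countable, without boundary), let $f:M\to\mathbb R^{n+p}$ be a smooth immersion with image the (immersed) submanifold $\Sigma$, and let $T\in\mathbb R^{n+p}$ be a fixed vector. Let $d\mu$ be the volume measure of the induced metric, $A(X,Y)=(\bar\nabla_XY)^\perp$ the second fundamental form ($\bar\nabla$ being the flat connection of $\mathbb R^{n+p}$), $H=\operatorname{tr}A$ the mean curvature vector, $\nabla^\perp$ the normal connection and $\Delta^\perp$ its Laplacian, and put $$F(\Sigma)=\int_\Sigma e^{\langle T,x\rangle}\,d\mu .$$ A compactly supported normal variation of $\Sigma$ is a smooth family of maps $f_s:M\to\mathbb R^{n+p}$, $|s|<\varepsilon$, with $f_0=f$ and $f_s=f$ outside a compact set $K\subset M$ (independent of $s$), whose variation field $V=\partial_s|_{s=0}f_s$ is normal along $\Sigma$; write $\Sigma_s$ for the (for small $|s|$ immersed) submanifold given by $f_s$. Since $F$ may be infinite, along such a variation $F(\Sigma_s)$ means the integral over a Borel set $B$ with $K\subseteq B\subseteq M$ and $\int_Be^{\langle T,x\rangle}d\mu<\infty$ (for example $B=K$, or $B=M$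 if $F(\Sigma)<\infty$). $\Sigma$ is a critical point of $F$ if $\partial_s|_{s=0}F(\Sigma_s)=0$, with $B=K$, for every compactly supported normal variation. Then $\Sigma$ is a critical point of $F$ if and only if $H=T^\perp$. If $\Sigma$ is a critical point of $F$, then for every compactly supported normal variation with variation field $V$, and every $B$ as above, $s\mapsto F(\Sigma_s)$ is differentiable near $s=0$ and twice differentiable at $s=0$, with $$\partial_{ss}\Big|_{s=0}F(\Sigma_s)=-\int_\Sigma\langle V,LV\rangle\,e^{\langle T,x\rangle}\,d\mu ,\qquad LV=\Delta^\perp V+\nabla^\perp_{T^T}V+\langle\langle A,V\rangle,A\rangle ,$$ where the integral converges, $T^T$ and $T^\perp$ are the tangential and normal parts of $T$, and $\langle\langle A,V\rangle,A\rangle=\sum_{i,j}\langle A(e_i,e_j),V\rangle A(e_i,e_j)$ for an orthonormal basis $(e_i)$ of the tangent space. -/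

import Mathlib

open scoped Manifold ContDiff

noncomputable section

namespace WeightedArea

variable {n : ℕ} {E : Type*} [NormedAddCommGroup E] [InnerProductSpace ℝ E]
  [FiniteDimensional ℝ E]
  {M : Type*} [TopologicalSpace M] [ChartedSpace (EuclideanSpace ℝ (Fin n)) M]

/-! ### First order geometry of an immersion `f : M → E`

Tangent vectors of the immersed submanifold at the point `p` are regarded as elements of the
ambient space `E`, namely of the image of the differential of `f` at `p`. -/

/-- The differential at `p` of an `E`-valued map on the manifold `M`. -/
def differential (u : M → E) (p : M) : TangentSpace (𝓡 n) p →L[ℝ] E :=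
  mfderiv (𝓡 n) 𝓘(ℝ, E) u p

/-- `f` is a smooth immersion. -/
def IsSmoothImmersion (f : M → E) : Prop :=
  ContMDiff (𝓡 n) 𝓘(ℝ, E) ∞ f ∧
    ∀ p : M, Function.Injective (differential (n := n) f p)

/-- The tangent space at `p` of the immersed submanifold, a subspace of `E`. -/
def tangentPlane (f : M → E) (p : M) : Submodule ℝ E :=
  LinearMap.range (differential (n := n) f p).toLinearMap

/-- `w ↦ wᵀ`, the orthogonal projection onto the tangent space at `p`. -/
def tanProj (f : M → E) (p : M) : E →L[ℝ] E :=
  (tangentPlane (n := n) f p).starProjection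

/-- `w ↦ w^⊥`, the orthogonal projection onto the normal space at `p`. -/
def norProj (f : M → E) (p : M) : E →L[ℝ] E :=
  (tangentPlane (n := n) f p)ᗮ.starProjection

/-- The vector `ξ ∈ T_p M` with `df_p ξ = wᵀ` (unique if `f` is an immersion). -/
def lift (f : M → E) (p : M) (w : E) : TangentSpace (𝓡 n) p :=
  Function.invFun (differential (n := n) f p) (tanProj (n := n) f p w)

/-- The derivative `D_w u` at `p` of a map `u : M → E` in the direction of the tangent vector
`w` of the immersed submanifold, i.e. the flat ambient connection `∇̄_w u`.
(For a general `w ∈ E` this is the derivative in the direction `wᵀ`.) -/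
def dirDeriv (f u : M → E) (p : M) (w : E) : E :=
  differential (n := n) u p (lift (n := n) f p w)

/-! ### Second order geometry -/

/-- An orthonormal basis of the tangent space at `p`. -/
def tangentBasis (f : M → E) (p : M) :
    OrthonormalBasis (Fin (Module.finrank ℝ (tangentPlane (n := n) f p))) ℝ
      (tangentPlane (n := n) f p) :=
  stdOrthonormalBasis ℝ (tangentPlane (n := n) f p)

/-- The second fundamental form `A(w, z) = (∇̄_w Z)^⊥` at `p`, for tangent vectors `w`, `z` at
`p`; here `Z = (q ↦ tanProj f q z)` is a tangent vector field with `Z(p) = z`. -/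
def secondFundamentalForm (f : M → E) (p : M) (w z : E) : E :=
  norProj (n := n) f p (dirDeriv (n := n) f (fun q => tanProj (n := n) f q z) p w)

/-- The mean curvature vector `H`, the trace of the second fundamental form. -/
def meanCurvature (f : M → E) (p : M) : E :=
  ∑ i, secondFundamentalForm (n := n) f p
    (tangentBasis (n := n) f p i : E) (tangentBasis (n := n) f p i : E)

/-- The Levi-Civita connection `∇_w Z = (∇̄_w Z)ᵀ` for a tangent vector field `Z : M → E`. -/
def leviCivita (f Z : M → E) (p : M) (w : E) : E :=
  tanProj (n := n) f p (dirDeriv (n := n) f Z p w)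

/-- The normal connection `∇^⊥_w V = (∇̄_w V)^⊥` for a normal vector field `V : M → E`. -/
def normalConnection (f V : M → E) (p : M) (w : E) : E :=
  norProj (n := n) f p (dirDeriv (n := n) f V p w)

/-- The second covariant derivative of a normal field `V` at `p`, for tangent vectors `w`, `z`:
`(∇^⊥)²_{w,z} V = ∇^⊥_w (∇^⊥_Z V) - ∇^⊥_{∇_w Z} V`, where `Z = (q ↦ tanProj f q z)` is a tangent
vector field with `Z(p) = z`. -/
def normalHessian (f V : M → E) (p : M) (w z : E) : E :=
  normalConnection (n := n) f
      (fun q => normalConnection (n := n) f V q (tanProj (n := n) f q z)) p w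
    - normalConnection (n := n) f V p
        (leviCivita (n := n) f (fun q => tanProj (n := n) f q z) p w)

/-- The normal Laplacian `Δ^⊥ V`, the trace of the second covariant derivative. -/
def normalLaplacian (f V : M → E) (p : M) : E :=
  ∑ i, normalHessian (n := n) f V p
    (tangentBasis (n := n) f p i : E) (tangentBasis (n := n) f p i : E)

/-- The term `⟨⟨A, V⟩, A⟩ = ∑_{i,j} ⟨A(e_i, e_j), V⟩ A(e_i, e_j)`, with `(e_i)` an orthonormal
basis of the tangent space. -/
def curvatureTerm (f V : M → E) (p : M) : E :=
  ∑ i, ∑ j,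
    inner ℝ (secondFundamentalForm (n := n) f p
        (tangentBasis (n := n) f p i : E) (tangentBasis (n := n) f p j : E)) (V p) •
      secondFundamentalForm (n := n) f p
        (tangentBasis (n := n) f p i : E) (tangentBasis (n := n) f p j : E)

/-- The operator `L V = Δ^⊥ V + ∇^⊥_{Tᵀ} V + ⟨⟨A, V⟩, A⟩`. -/
def stabilityOperator (T : E) (f V : M → E) (p : M) : E :=
  normalLaplacian (n := n) f V p
    + normalConnection (n := n) f V p (tanProj (n := n) f p T)
    + curvatureTerm (n := n) f V p

/-! ### Induced volume and the functional `F` -/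

/-- The volume density `√(det g_{ij})`, `g_{ij} = ⟨∂_i u, ∂_j u⟩`, of a parametrization
`u : ℝⁿ → E` at `y`. -/
def volumeDensity (u : EuclideanSpace ℝ (Fin n) → E) (y : EuclideanSpace ℝ (Fin n)) : ℝ :=
  Real.sqrt (Matrix.det
    (Matrix.gram ℝ fun i : Fin n => fderiv ℝ u y (EuclideanSpace.single i (1 : ℝ))))

/-- The part, in the domain of the chart `φ`, of the Riemannian volume of the metric induced
by `f`: the measure `√(det g) dy` on the target of `φ`, transported to `M`. -/
def chartVolume [MeasurableSpace M] (f : M → E)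
    (φ : OpenPartialHomeomorph M (EuclideanSpace ℝ (Fin n))) : MeasureTheory.Measure M :=
  MeasureTheory.Measure.map φ.symm
    ((MeasureTheory.volume.restrict φ.target).withDensity
      fun y => ENNReal.ofReal (volumeDensity (f ∘ φ.symm) y))

/-- The Riemannian volume measure `dμ` on `M` of the metric induced by `f`. The measures
`chartVolume f φ` agree on the overlaps of the charts, by the change of variables formula, so
that their least upper bound is the measure on `M` which restricts to each one of them. -/
def inducedVolume [MeasurableSpace M] (f : M → E) : MeasureTheory.Measure M :=
  ⨆ φ ∈ atlas (EuclideanSpace ℝ (Fin n)) M, chartVolume f φ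

/-- The part `∫_B e^{⟨T, x⟩} dμ` of the functional `F` which comes from the subset `B` of `M`;
`B = Set.univ` gives `F` itself. -/
def weightedArea [MeasurableSpace M] (T : E) (f : M → E) (B : Set M) : ℝ :=
  ∫ p in B, Real.exp (inner ℝ T (f p)) ∂(inducedVolume (n := n) f)

/-! ### Variations and critical points -/

/-- `X s`, `|s| < ε`, is a smooth variation of the immersion `f`, fixed outside of the compact
set `K`, whose variation field `V = ∂_s X |_{s = 0}` is normal. (For small `|s|` each `X s` is
then an immersion, by compactness of `K`.) -/
structure IsNormalVariation (f : M → E) (X : ℝ → M → E) (V : M → E) (K : Set M) (ε : ℝ) :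
    Prop where
  pos : 0 < ε
  smooth : ContMDiffOn ((𝓘(ℝ, ℝ)).prod (𝓡 n)) 𝓘(ℝ, E) ∞ (fun q : ℝ × M => X q.1 q.2)
    (Set.Ioo (-ε) ε ×ˢ Set.univ)
  initial : X 0 = f
  compact : IsCompact K
  fixed : ∀ s ∈ Set.Ioo (-ε) ε, ∀ p, p ∉ K → X s p = f p
  field : ∀ p, HasDerivAt (fun s => X s p) (V p) 0
  normal : ∀ p, V p ∈ (tangentPlane (n := n) f p)ᗮ

/-- `f` is a critical point of `F`: the first variation of `F` vanishes for all compactly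
supported normal variations. As `F` itself may be infinite, it is evaluated on the compact set
outside of which the variation is fixed. -/
def IsCriticalPoint [MeasurableSpace M] (T : E) (f : M → E) : Prop :=
  ∀ (X : ℝ → M → E) (V : M → E) (K : Set M) (ε : ℝ),
    IsNormalVariation (n := n) f X V K ε →
      HasDerivAt (fun s => weightedArea (n := n) T (X s) K) 0 0

end WeightedArea

end

/-! Everything is computed in charts. There the weighted area of a small piece of `X s` is the
integral of `exp⟨T, x⟩ √det(L†L)`, with `L` the spatial differential of the parametrization `x`.
Jacobi's formula gives this density the logarithmic time derivative `⟨T, ∂ₛx⟩ + tr(P ∂ₛL)`, where `P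
= (L†L)⁻¹L†`. At `s = 0` this is `⟨T, V⟩ + div V`, which for normal `V` equals `⟨T^⊥ - H, V⟩`
(`firstVariationDensity_eq`). So `H = T^⊥` implies criticality; conversely, a cut-off of `T^⊥ - H`
is itself an admissible variation field and forces the equation.

Let `W` be the acceleration of the variation. A second time derivative produces the square of the
first rate, the first-order expression `⟨T, W⟩ + div W`, and, from the derivative of `P`, the
quadratic term `∑ |∇^⊥_{e_i} V|² - ∑ ⟨D_{e_i} V, e_j⟩⟨D_{e_j} V, e_i⟩`. At a critical point the
square vanishes and the normal part of `W` drops out. The double sum is `⟨V, ⟨⟨A, V⟩, A⟩⟩`. With `Y`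
the gradient of `|V|²/2`, a Bochner identity reads `⟨V, Δ^⊥ V⟩ = div Y - ∑ |∇^⊥_{e_i} V|²`. Hence
the integrand is `-⟨V, LV⟩ exp⟨T, f⟩ + div(exp⟨T, f⟩ (Wᵀ + Y))` (`secondVariationDensity_eq`), and
the divergence theorem for tangent fields (`integral_divergence_eq_zero`) removes the last term.

On the analytic side, the induced volume restricts to the coordinate measure in every chart
(`inducedVolume_restrict`), so one may differentiate under the integral over coordinate balls.
Compactness of `K` glues the pieces (`IsNormalVariation.hasVariations`), and outside `K` nothing
moves, so a larger region `B` only adds a constant. -/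

noncomputable section

namespace WeightedArea

set_option linter.unusedSectionVars false

/-! ### Linear algebra of injective maps between Euclidean spaces -/

section LinearAlgebra

open ContinuousLinearMap

variable {G E : Type*} [NormedAddCommGroup G] [InnerProductSpace ℝ G] [FiniteDimensional ℝ G]
  [NormedAddCommGroup E] [InnerProductSpace ℝ E] [FiniteDimensional ℝ E]

/-- The trace, as a continuous linear functional. -/
def traceCLM (G : Type*) [NormedAddCommGroup G] [InnerProductSpace ℝ G] [FiniteDimensional ℝ G] :
    (G →L[ℝ] G) →L[ℝ] ℝ :=
  LinearMap.toContinuousLinearMap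
    ((LinearMap.trace ℝ G).comp (ContinuousLinearMap.coeLM ℝ))

lemma traceCLM_apply (A : G →L[ℝ] G) : traceCLM G A = LinearMap.trace ℝ G (A : G →ₗ[ℝ] G) := rfl

lemma traceCLM_eq_sum {ι : Type*} [Fintype ι] (b : OrthonormalBasis ι ℝ G) (A : G →L[ℝ] G) :
    traceCLM G A = ∑ i, inner ℝ (b i) (A (b i)) := by
  rw [traceCLM_apply, LinearMap.trace_eq_sum_inner _ b]; rfl

lemma traceCLM_comp_comm (A : E →L[ℝ] G) (B : G →L[ℝ] E) :
    traceCLM G (A ∘L B) = traceCLM E (B ∘L A) := by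
  rw [traceCLM_apply, traceCLM_apply]
  exact LinearMap.trace_comp_comm' (B : G →ₗ[ℝ] E) (A : E →ₗ[ℝ] G)

lemma traceCLM_adjoint (A : G →L[ℝ] G) : traceCLM G (adjoint A) = traceCLM G A := by
  rw [traceCLM_eq_sum (stdOrthonormalBasis ℝ G), traceCLM_eq_sum (stdOrthonormalBasis ℝ G)]
  refine Finset.sum_congr rfl fun i _ => ?_
  rw [adjoint_inner_right, real_inner_comm]

/-- Taking adjoints, as a continuous linear map over `ℝ`. -/
def adjointCLM (G E : Type*) [NormedAddCommGroup G] [InnerProductSpace ℝ G]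
    [FiniteDimensional ℝ G] [NormedAddCommGroup E] [InnerProductSpace ℝ E]
    [FiniteDimensional ℝ E] : (G →L[ℝ] E) →L[ℝ] (E →L[ℝ] G) :=
  LinearMap.toContinuousLinearMap
    { toFun := fun L => adjoint L
      map_add' := fun L L' => map_add adjoint L L'
      map_smul' := fun c L => by simp }

/-- By the Leibniz formula the determinant is a polynomial in the matrix entries. -/
lemma contDiff_det : ContDiff ℝ ∞ (fun A : G →L[ℝ] G => A.det) := by
  have h : (fun A : G →L[ℝ] G => A.det) = fun A : G →L[ℝ] G =>
      ∑ σ : Equiv.Perm (Fin (Module.finrank ℝ G)), (Equiv.Perm.sign σ : ℤ) •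
        ∏ i, inner ℝ (stdOrthonormalBasis ℝ G (σ i)) (A (stdOrthonormalBasis ℝ G i)) := by
    funext A
    rw [ContinuousLinearMap.det,
      ← LinearMap.det_toMatrix (stdOrthonormalBasis ℝ G).toBasis, Matrix.det_apply]
    simp only [LinearMap.toMatrix_apply, OrthonormalBasis.coe_toBasis, coe_coe,
      OrthonormalBasis.coe_toBasis_repr_apply, OrthonormalBasis.repr_apply_apply]
    rfl
  rw [h]
  refine ContDiff.sum fun σ _ => ?_
  simp only [zsmul_eq_mul]
  refine contDiff_const.mul (contDiff_prod fun i _ => ?_)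
  exact (contDiff_const).inner ℝ (contDiff_id.clm_apply contDiff_const)

/-- Differentiability is known from `contDiff_det`, so only the lines `1 + r B` remain to be tested.
There the determinant is `1 + r tr B` plus `r²` times a polynomial in `r`. -/
lemma hasFDerivAt_det_one :
    HasFDerivAt (fun A : G →L[ℝ] G => A.det) (traceCLM G) 1 := by
  have hd : HasFDerivAt (fun A : G →L[ℝ] G => A.det) (fderiv ℝ (fun A : G →L[ℝ] G => A.det) 1) 1 :=
    ((contDiff_det (G := G)).contDiffAt.differentiableAt (by simp)).hasFDerivAt
  have : fderiv ℝ (fun A : G →L[ℝ] G => A.det) 1 = traceCLM G := by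
    ext B
    have h1 : HasDerivAt (fun r : ℝ => ((1 : G →L[ℝ] G) + r • B).det)
        (fderiv ℝ (fun A : G →L[ℝ] G => A.det) 1 B) 0 := by
      have hl : HasDerivAt (fun r : ℝ => (1 : G →L[ℝ] G) + r • B) B 0 := by
        simpa using ((hasDerivAt_id (0 : ℝ)).smul_const B).const_add (1 : G →L[ℝ] G)
      have hd' : HasFDerivAt (fun A : G →L[ℝ] G => A.det)
          (fderiv ℝ (fun A : G →L[ℝ] G => A.det) 1) ((1 : G →L[ℝ] G) + (0 : ℝ) • B) := by
        simpa using hd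
      exact hd'.comp_hasDerivAt 0 hl
    have h2 : HasDerivAt (fun r : ℝ => ((1 : G →L[ℝ] G) + r • B).det) (traceCLM G B) 0 := by
      let b := (stdOrthonormalBasis ℝ G).toBasis
      let M := LinearMap.toMatrix b b (B : G →ₗ[ℝ] G)
      have hM : (fun r : ℝ => ((1 : G →L[ℝ] G) + r • B).det) = fun r : ℝ => 1 + M.trace * r +
          (Matrix.det (1 + (Polynomial.X : Polynomial ℝ) •
            M.map Polynomial.C)).divX.divX.eval r * r ^ 2 := by
        funext r
        rw [← Matrix.det_one_add_smul, ContinuousLinearMap.det, ← LinearMap.det_toMatrix b]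
        congr 1
        simp only [toLinearMap_add, toLinearMap_smul, map_add, map_smul, M]
        congr 1
        exact LinearMap.toMatrix_one b
      have ht : M.trace = traceCLM G B := by
        rw [traceCLM_apply, LinearMap.trace_eq_matrix_trace ℝ b]
      rw [hM, ← ht]
      have h3 := (((hasDerivAt_id (0 : ℝ)).const_mul M.trace).const_add 1).add
        ((Polynomial.hasDerivAt (Matrix.det (1 + (Polynomial.X : Polynomial ℝ) •
            M.map Polynomial.C)).divX.divX 0).mul (hasDerivAt_pow 2 (0 : ℝ)))
      refine h3.congr_deriv ?_
      simp
    exact h1.unique h2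
  rwa [this] at hd

/-- The Moore-Penrose inverse `(L† L)⁻¹ L†` of an injective map. -/
def pinv (L : G →L[ℝ] E) : E →L[ℝ] G :=
  Ring.inverse (adjoint L ∘L L) ∘L adjoint L

lemma isUnit_adjoint_comp_self {L : G →L[ℝ] E} (hL : Function.Injective L) :
    IsUnit (adjoint L ∘L L) := by
  have hinj : Function.Injective (adjoint L ∘L L) :=
    L.adjoint_comp_self_injective_iff.mpr hL
  let e : G ≃L[ℝ] G := (LinearEquiv.ofInjectiveEndo
    ((adjoint L ∘L L : G →L[ℝ] G) : G →ₗ[ℝ] G) hinj).toContinuousLinearEquiv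
  have he : (e : G →L[ℝ] G) = adjoint L ∘L L := by ext; rfl
  rw [← he]
  exact ⟨(ContinuousLinearEquiv.unitsEquiv ℝ G).symm e, rfl⟩

lemma pinv_comp_self {L : G →L[ℝ] E} (hL : Function.Injective L) :
    pinv L ∘L L = 1 := by
  have := Ring.inverse_mul_cancel _ (isUnit_adjoint_comp_self hL)
  rw [pinv, comp_assoc]
  exact this

lemma pinv_apply_self {L : G →L[ℝ] E} (hL : Function.Injective L) (ξ : G) :
    pinv L (L ξ) = ξ :=
  DFunLike.congr_fun (pinv_comp_self hL) ξ

lemma pinv_eq_zero_of_mem {L : G →L[ℝ] E} {w : E}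
    (hw : w ∈ (LinearMap.range L.toLinearMap)ᗮ) : pinv L w = 0 := by
  have : adjoint L w = 0 := by
    rw [Submodule.mem_orthogonal] at hw
    refine ext_inner_right ℝ fun ξ => ?_
    rw [adjoint_inner_left, inner_zero_left, real_inner_comm]
    exact hw _ ⟨ξ, rfl⟩
  simp [pinv, this]

/-- On the range `pinv L` inverts `L`, and on the orthogonal complement `L†` vanishes. -/
lemma comp_pinv_eq_starProjection {L : G →L[ℝ] E} (hL : Function.Injective L) :
    L ∘L pinv L = (LinearMap.range L.toLinearMap).starProjection := by
  ext w
  set U := LinearMap.range L.toLinearMap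
  have h1 : U.starProjection w ∈ U := Submodule.starProjection_apply_mem U w
  obtain ⟨ξ, hξ⟩ := h1
  have h2 : w - U.starProjection w ∈ Uᗮ := Submodule.sub_starProjection_mem_orthogonal w
  have h3 := pinv_eq_zero_of_mem h2
  have h4 : pinv L w = ξ := by
    have : L ξ = U.starProjection w := hξ
    rw [map_sub, sub_eq_zero] at h3
    rw [h3, ← this, pinv_apply_self hL]
  simpa [h4] using hξ

/-- Injectivity makes the Gram operator a unit, and inversion is smooth at units; at other operators
`Ring.inverse` takes its default value zero. -/
lemma contDiffAt_pinv {L : G →L[ℝ] E} (hL : Function.Injective L) :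
    ContDiffAt ℝ ∞ (pinv : (G →L[ℝ] E) → (E →L[ℝ] G)) L := by
  have hadj : ContDiffAt ℝ ∞ (fun L : G →L[ℝ] E => adjoint L) L :=
    (adjointCLM G E).contDiff.contDiffAt
  have hg : ContDiffAt ℝ ∞ (fun L : G →L[ℝ] E => adjoint L ∘L L) L :=
    hadj.clm_comp contDiffAt_id
  have hi : ContDiffAt ℝ ∞ (Ring.inverse : (G →L[ℝ] G) → _) (adjoint L ∘L L) := by
    obtain ⟨u, hu⟩ := isUnit_adjoint_comp_self hL
    rw [← hu]
    exact contDiffAt_ringInverse ℝ u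
  have hi' : ContDiffAt ℝ ∞ (fun L : G →L[ℝ] E => Ring.inverse (adjoint L ∘L L)) L :=
    ContDiffAt.comp (f := fun L : G →L[ℝ] E => adjoint L ∘L L) L hi hg
  exact ContDiffAt.clm_comp (g := fun L : G →L[ℝ] E => Ring.inverse (adjoint L ∘L L))
    (f := fun L : G →L[ℝ] E => adjoint L) hi' hadj

/-- The set of injective linear maps is open. -/
lemma eventually_injective {L : G →L[ℝ] E} (hL : Function.Injective L) :
    ∀ᶠ L' : G →L[ℝ] E in nhds L, Function.Injective L' :=
  ContinuousLinearMap.isOpen_injective.mem_nhds hL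

/-- The derivative of the pseudo-inverse along a curve of injective maps. -/
lemma hasDerivAt_pinv {L : ℝ → G →L[ℝ] E} {s : ℝ} {L' : G →L[ℝ] E}
    (hL : Function.Injective (L s)) (hd : HasDerivAt L L' s) :
    HasDerivAt (fun r => pinv (L r))
      (pinv (L s) ∘L adjoint (pinv (L s)) ∘L adjoint L' ∘L (1 - L s ∘L pinv (L s))
        - pinv (L s) ∘L L' ∘L pinv (L s)) s := by
  set P := pinv (L s) with hP
  have hev : ∀ᶠ r in nhds s, Function.Injective (L r) :=
    hd.continuousAt.eventually (eventually_injective hL)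
  have hp : HasDerivAt (fun r => pinv (L r)) (fderiv ℝ pinv (L s) L') s :=
    (((contDiffAt_pinv hL).differentiableAt (by simp)).hasFDerivAt).comp_hasDerivAt s hd
  set P' := fderiv ℝ pinv (L s) L'
  refine hp.congr_deriv ?_
  -- `P' L = - P L'`
  have h1 : P' ∘L L s + P ∘L L' = 0 := by
    have h := hp.clm_comp hd
    have h' : HasDerivAt (fun r => pinv (L r) ∘L L r) 0 s := by
      refine (hasDerivAt_const s (1 : G →L[ℝ] G)).congr_of_eventuallyEq ?_
      filter_upwards [hev] with r hr using pinv_comp_self hr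
    exact h.unique h'
  -- differentiate `L† L P = L†`
  have h2 : (adjoint L' ∘L L s + adjoint (L s) ∘L L') ∘L P + (adjoint (L s) ∘L L s) ∘L P'
      = adjoint L' := by
    have ha : HasDerivAt (fun r => adjoint (L r)) (adjoint L') s :=
      (adjointCLM G E).hasFDerivAt.comp_hasDerivAt s hd
    have h := (ha.clm_comp hd).clm_comp hp
    refine h.unique (ha.congr_of_eventuallyEq ?_)
    filter_upwards [hev] with r hr
    have : (adjoint (L r) ∘L L r) * Ring.inverse (adjoint (L r) ∘L L r) = 1 :=
      Ring.mul_inverse_cancel _ (isUnit_adjoint_comp_self hr)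
    show (adjoint (L r) ∘L L r) ∘L (Ring.inverse (adjoint (L r) ∘L L r) ∘L adjoint (L r)) = _
    rw [← comp_assoc]
    change ((adjoint (L r) ∘L L r) * Ring.inverse (adjoint (L r) ∘L L r)) ∘L adjoint (L r) = _
    rw [this]; rfl
  -- `P P†` inverts the Gram operator `L†L`, because `P†L† = (LP)†` and `LP` is an orthogonal
  -- projection.
  have hPP : P ∘L adjoint P ∘L (adjoint (L s) ∘L L s) = 1 := by
    have h3 : adjoint P ∘L adjoint (L s) = L s ∘L P := by
      rw [← adjoint_comp, comp_pinv_eq_starProjection hL]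
      exact (isSelfAdjoint_starProjection _).adjoint_eq
    calc P ∘L adjoint P ∘L (adjoint (L s) ∘L L s)
        = P ∘L (adjoint P ∘L adjoint (L s)) ∘L L s := by simp only [comp_assoc]
      _ = (P ∘L L s) ∘L (P ∘L L s) := by rw [h3]; simp only [comp_assoc]
      _ = 1 := by rw [pinv_comp_self hL]; rfl
  have hPa : P ∘L adjoint P ∘L adjoint (L s) = P := by
    have h3 : adjoint P ∘L adjoint (L s) = L s ∘L P := by
      rw [← adjoint_comp, comp_pinv_eq_starProjection hL]
      exact (isSelfAdjoint_starProjection _).adjoint_eq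
    rw [h3, ← comp_assoc, pinv_comp_self hL]; rfl
  -- Applying `P P†` to the differentiated equation `L†L P = L†` therefore isolates `P'`.
  have h4 : P' = P ∘L adjoint P ∘L ((adjoint (L s) ∘L L s) ∘L P') := by
    have := congrArg (fun A => A ∘L P') hPP
    simp only [comp_assoc] at this ⊢
    rw [this]; rfl
  rw [h4, eq_sub_of_add_eq' h2]
  simp only [comp_sub, comp_add, add_comp, comp_assoc]
  have h5 : P ∘L adjoint P ∘L adjoint (L s) ∘L L' ∘L P = P ∘L L' ∘L P := by
    have := congrArg (fun A => A ∘L L' ∘L P) hPa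
    simpa only [comp_assoc] using this
  rw [h5]
  have h6 : ∀ A : E →L[ℝ] G, A ∘L (1 : E →L[ℝ] E) = A := fun A => rfl
  simp only [h6]
  abel

/-! ### The volume factor `√det(L†L)` and its derivative. -/

lemma normDet_pos {L : G →L[ℝ] E} (hL : Function.Injective L) : 0 < L.toLinearMap.normDet := by
  have h : L.toLinearMap.normDet ≠ 0 :=
    ((LinearMap.normDet_ne_zero_tfae L.toLinearMap).out 4 0 rfl rfl).mp hL
  exact lt_of_le_of_ne (LinearMap.normDet_nonneg _) h.symm

lemma normDet_eq_sqrt (L : G →L[ℝ] E) : L.toLinearMap.normDet = √((adjoint L ∘L L).det) := by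
  have := L.normDet_sq
  simp only [RCLike.ofReal_real_eq_id, id_eq] at this
  rw [← this, Real.sqrt_sq (LinearMap.normDet_nonneg _)]

lemma contDiff_det_adjoint_comp_self :
    ContDiff ℝ ∞ (fun L : G →L[ℝ] E => (adjoint L ∘L L).det) :=
  contDiff_det.comp ((adjointCLM G E).contDiff.clm_comp contDiff_id)

lemma continuous_normDet : Continuous (fun L : G →L[ℝ] E => L.toLinearMap.normDet) := by
  simp_rw [normDet_eq_sqrt]
  exact contDiff_det_adjoint_comp_self.continuous.sqrt

/-- The square root is smooth away from zero, and the Gram determinant of an injective map is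
nonzero. -/
lemma contDiffAt_normDet {L : G →L[ℝ] E} (hL : Function.Injective L) :
    ContDiffAt ℝ ∞ (fun L : G →L[ℝ] E => L.toLinearMap.normDet) L := by
  simp_rw [normDet_eq_sqrt]
  refine contDiff_det_adjoint_comp_self.contDiffAt.sqrt ?_
  have h2 := L.normDet_sq
  simp only [RCLike.ofReal_real_eq_id, id_eq] at h2
  rw [← h2]
  exact pow_ne_zero 2 (normDet_pos hL).ne'

/-- Jacobi's formula. The square of the volume factor, a determinant, is differentiated in two ways,
and the positive factor `2 normDet` is cancelled at the end. -/
lemma hasDerivAt_normDet {L : ℝ → G →L[ℝ] E} {s : ℝ} {L' : G →L[ℝ] E}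
    (hL : Function.Injective (L s)) (hd : HasDerivAt L L' s) :
    HasDerivAt (fun r => (L r).toLinearMap.normDet)
      ((L s).toLinearMap.normDet * traceCLM G (pinv (L s) ∘L L')) s := by
  have h0 : HasDerivAt (fun r => (L r).toLinearMap.normDet)
      (fderiv ℝ (fun L : G →L[ℝ] E => L.toLinearMap.normDet) (L s) L') s :=
    (((contDiffAt_normDet hL).differentiableAt (by simp)).hasFDerivAt).comp_hasDerivAt s hd
  set J' := fderiv ℝ (fun L : G →L[ℝ] E => L.toLinearMap.normDet) (L s) L'
  have h1 := h0.pow 2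
  set S := Ring.inverse (adjoint (L s) ∘L L s) with hS
  have hSu : (adjoint (L s) ∘L L s) * S = 1 :=
    Ring.mul_inverse_cancel _ (isUnit_adjoint_comp_self hL)
  have hSu' : S * (adjoint (L s) ∘L L s) = 1 :=
    Ring.inverse_mul_cancel _ (isUnit_adjoint_comp_self hL)
  have hsq : ∀ r, (L r).toLinearMap.normDet ^ 2 = (adjoint (L r) ∘L L r).det := fun r => by
    simpa using (L r).normDet_sq
  have hdet : ∀ A B : G →L[ℝ] G, (A * B).det = A.det * B.det := fun A B => by
    simp only [ContinuousLinearMap.det, ContinuousLinearMap.toLinearMap_mul, map_mul]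
  have h2 : HasDerivAt (fun r => (L r).toLinearMap.normDet ^ 2)
      ((L s).toLinearMap.normDet ^ 2 *
        traceCLM G (S ∘L (adjoint L' ∘L L s + adjoint (L s) ∘L L'))) s := by
    have ha : HasDerivAt (fun r => adjoint (L r)) (adjoint L') s :=
      (adjointCLM G E).hasFDerivAt.comp_hasDerivAt s hd
    have hS' : HasDerivAt (fun r => S ∘L (adjoint (L r) ∘L L r))
        (S ∘L (adjoint L' ∘L L s + adjoint (L s) ∘L L')) s := by
      have := (hasDerivAt_const s S).clm_comp (ha.clm_comp hd)
      simpa using this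
    have hd1 : HasFDerivAt (fun A : G →L[ℝ] G => A.det) (traceCLM G)
        (S ∘L (adjoint (L s) ∘L L s)) := by
      have : S ∘L (adjoint (L s) ∘L L s) = 1 := hSu'
      rw [this]; exact hasFDerivAt_det_one
    have h3 := (hd1.comp_hasDerivAt s hS').const_mul ((L s).toLinearMap.normDet ^ 2)
    refine h3.congr_of_eventuallyEq (Filter.Eventually.of_forall fun r => ?_)
    -- Factoring out the Gram operator at time `s` moves the base point of the determinant to the
    -- identity, where its derivative is the trace.
    have h4 : adjoint (L r) ∘L L r = (adjoint (L s) ∘L L s) * (S * (adjoint (L r) ∘L L r)) := by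
      rw [← mul_assoc, hSu, one_mul]
    show (L r).toLinearMap.normDet ^ 2 = (L s).toLinearMap.normDet ^ 2 * _
    rw [hsq r, hsq s]
    conv_lhs => rw [h4, hdet]
    rfl
  have h3 := h1.unique h2
  have hP : S ∘L adjoint (L s) = pinv (L s) := rfl
  have hSa : adjoint S = S := by
    have e1 : adjoint S * (adjoint (L s) ∘L L s) = 1 := by
      have := congrArg adjoint hSu
      have e2 : adjoint ((adjoint (L s) ∘L L s) * S) = adjoint S * (adjoint (L s) ∘L L s) := by
        show adjoint ((adjoint (L s) ∘L L s) ∘L S) = _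
        rw [adjoint_comp, adjoint_comp, adjoint_adjoint]; rfl
      rw [e2] at this
      rw [this]; exact adjoint_one
    calc adjoint S = adjoint S * ((adjoint (L s) ∘L L s) * S) := by rw [hSu, mul_one]
      _ = S := by rw [← mul_assoc, e1, one_mul]
  -- The two product-rule terms are adjoint to each other up to a cyclic permutation, so their
  -- traces agree.
  have h4 : traceCLM G (S ∘L (adjoint L' ∘L L s + adjoint (L s) ∘L L')) =
      2 * traceCLM G (pinv (L s) ∘L L') := by
    rw [comp_add, map_add, ← comp_assoc S (adjoint (L s)), hP, two_mul]
    congr 1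
    rw [← traceCLM_adjoint (pinv (L s) ∘L L'), adjoint_comp, ← hP, adjoint_comp, adjoint_adjoint,
      hSa, traceCLM_comp_comm S, comp_assoc]
  rw [h4] at h3
  have hpos := normDet_pos hL
  refine h0.congr_deriv ?_
  have h5 : (2 * (L s).toLinearMap.normDet) * J' = (2 * (L s).toLinearMap.normDet) *
      ((L s).toLinearMap.normDet * traceCLM G (pinv (L s) ∘L L')) := by
    simp only [Nat.cast_ofNat, Nat.add_one_sub_one, pow_one] at h3
    linarith
  exact mul_left_cancel₀ (by positivity) h5

lemma sum_inner_smul_eq_starProjection {ι : Type*} [Fintype ι] {U : Submodule ℝ E}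
    (e : OrthonormalBasis ι ℝ U) (u : E) :
    ∑ i, inner ℝ u (e i : E) • (e i : E) = U.starProjection u := by
  have := congrArg (Subtype.val) (e.sum_repr (U.orthogonalProjectionOnto u))
  rw [Submodule.starProjection_apply, ← this]
  simp only [Submodule.coe_sum, Submodule.coe_smul]
  refine Finset.sum_congr rfl fun i _ => ?_
  rw [e.repr_apply_apply, real_inner_comm, Submodule.coe_inner, ← Submodule.starProjection_apply,
    ← Submodule.inner_starProjection_left_eq_right,
    Submodule.starProjection_eq_self_iff.mpr (e i).2]

/-- Traces computed in an orthonormal frame of the range of `L`. -/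
lemma sum_inner_pinv {ι : Type*} [Fintype ι] {L : G →L[ℝ] E} (hL : Function.Injective L)
    {U : Submodule ℝ E} (hU : U = LinearMap.range L.toLinearMap) (e : OrthonormalBasis ι ℝ U)
    (B : G →L[ℝ] E) :
    ∑ i, inner ℝ (B (pinv L (e i))) (e i : E) = traceCLM G (pinv L ∘L B) := by
  have hPi : U.starProjection = L ∘L pinv L := by
    subst hU; exact (comp_pinv_eq_starProjection hL).symm
  have h1 := sum_inner_smul_eq_starProjection e
  have h2 : pinv L ∘L B = pinv L ∘L (U.starProjection ∘L B) := by
    rw [hPi, ← comp_assoc, ← comp_assoc, pinv_comp_self hL]; rfl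
  -- The frame `e` lives in the range and the trace on `G`, so an auxiliary orthonormal basis of `G`
  -- is inserted and the two sums are exchanged.
  let b := stdOrthonormalBasis ℝ G
  have h3 : ∀ i, inner ℝ (B (pinv L (e i))) (e i : E) =
      ∑ k, inner ℝ (b k) (pinv L (e i)) * inner ℝ (B (b k)) (e i : E) := fun i => by
    conv_lhs => rw [← b.sum_repr (pinv L (e i))]
    rw [map_sum, sum_inner]
    refine Finset.sum_congr rfl fun k _ => ?_
    rw [map_smul, real_inner_smul_left, b.repr_apply_apply]
  simp_rw [h3]
  rw [Finset.sum_comm, h2, traceCLM_eq_sum b]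
  refine Finset.sum_congr rfl fun k _ => ?_
  show _ = inner ℝ (b k) (pinv L (U.starProjection (B (b k))))
  rw [← h1, map_sum, inner_sum]
  refine Finset.sum_congr rfl fun i _ => ?_
  rw [map_smul, inner_smul_right, mul_comm]

end LinearAlgebra

/-! ### The induced volume in a chart -/

section InducedVolume

open MeasureTheory Set

variable {n : ℕ} {E : Type*} [NormedAddCommGroup E] [InnerProductSpace ℝ E]
  [FiniteDimensional ℝ E]

/-- Passes from the Gram determinant in the standard basis to a basis-free quantity, for which the
chain rule and Jacobi's formula are available. -/
lemma volumeDensity_eq_normDet (u : EuclideanSpace ℝ (Fin n) → E) (y : EuclideanSpace ℝ (Fin n)) :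
    volumeDensity u y = (fderiv ℝ u y).toLinearMap.normDet := by
  have h := LinearMap.normDet_sq_eq_det_gram (fderiv ℝ u y).toLinearMap
    (EuclideanSpace.basisFun (Fin n) ℝ)
  simp only [EuclideanSpace.basisFun_apply, RCLike.ofReal_real_eq_id, id_eq] at h
  rw [volumeDensity, ← Real.sqrt_sq (LinearMap.normDet_nonneg (fderiv ℝ u y).toLinearMap), h]
  rfl

lemma volumeDensity_nonneg (u : EuclideanSpace ℝ (Fin n) → E) (y : EuclideanSpace ℝ (Fin n)) :
    0 ≤ volumeDensity u y := Real.sqrt_nonneg _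

lemma measurable_volumeDensity (u : EuclideanSpace ℝ (Fin n) → E) :
    Measurable (volumeDensity u) := by
  have h : volumeDensity u = fun y => (fderiv ℝ u y).toLinearMap.normDet :=
    funext (volumeDensity_eq_normDet u)
  rw [h]
  exact continuous_normDet.measurable.comp (measurable_fderiv ℝ u)

lemma volumeDensity_comp {u : EuclideanSpace ℝ (Fin n) → E}
    {ψ : EuclideanSpace ℝ (Fin n) → EuclideanSpace ℝ (Fin n)} {y : EuclideanSpace ℝ (Fin n)}
    (hu : DifferentiableAt ℝ u (ψ y)) (hψ : DifferentiableAt ℝ ψ y) :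
    volumeDensity (u ∘ ψ) y = |(fderiv ℝ ψ y).det| * volumeDensity u (ψ y) := by
  simp only [volumeDensity_eq_normDet]
  rw [fderiv_comp y hu hψ, ContinuousLinearMap.toLinearMap_comp,
    LinearMap.normDet_comp_of_finrank_eq _ _ rfl, LinearMap.normDet_eq_abs_det, mul_comm]

variable {M : Type*} [TopologicalSpace M] [ChartedSpace (EuclideanSpace ℝ (Fin n)) M]
  [IsManifold (𝓡 n) ∞ M]

lemma contMDiffAt_symm {φ : OpenPartialHomeomorph M (EuclideanSpace ℝ (Fin n))}
    (hφ : φ ∈ atlas (EuclideanSpace ℝ (Fin n)) M) {y : EuclideanSpace ℝ (Fin n)}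
    (hy : y ∈ φ.target) : ContMDiffAt (𝓡 n) (𝓡 n) ∞ φ.symm y :=
  (contMDiffOn_symm_of_mem_maximalAtlas (IsManifold.subset_maximalAtlas hφ)).contMDiffAt
    (φ.open_target.mem_nhds hy)

lemma contMDiffAt_chart {φ : OpenPartialHomeomorph M (EuclideanSpace ℝ (Fin n))}
    (hφ : φ ∈ atlas (EuclideanSpace ℝ (Fin n)) M) {q : M}
    (hq : q ∈ φ.source) : ContMDiffAt (𝓡 n) (𝓡 n) ∞ φ q :=
  (contMDiffOn_of_mem_maximalAtlas (IsManifold.subset_maximalAtlas hφ)).contMDiffAt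
    (φ.open_source.mem_nhds hq)

/-- The coordinate representation of a smooth map is smooth. -/
lemma contDiffAt_comp_symm {F : Type*} [NormedAddCommGroup F] [NormedSpace ℝ F] {k : WithTop ℕ∞}
    (hk : k ≤ ∞) {u : M → F} {φ : OpenPartialHomeomorph M (EuclideanSpace ℝ (Fin n))}
    (hφ : φ ∈ atlas (EuclideanSpace ℝ (Fin n)) M) {y : EuclideanSpace ℝ (Fin n)}
    (hy : y ∈ φ.target) (hu : ContMDiffAt (𝓡 n) 𝓘(ℝ, F) k u (φ.symm y)) :
    ContDiffAt ℝ k (u ∘ φ.symm) y :=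
  contMDiffAt_iff_contDiffAt.mp (hu.comp y ((contMDiffAt_symm hφ hy).of_le hk))

variable [MeasurableSpace M] [BorelSpace M]

/-- `φ.symm` is continuous only on `φ.target`, so the preimage is formed in the subtype and then
pushed forward. -/
lemma measurableSet_chart_image (φ : OpenPartialHomeomorph M (EuclideanSpace ℝ (Fin n)))
    {D : Set M} (hD : MeasurableSet D) : MeasurableSet (φ.target ∩ φ.symm ⁻¹' D) := by
  have h : Measurable (φ.target.domRestrict φ.symm) :=
    (continuousOn_iff_continuous_domRestrict.mp φ.continuousOn_symm).measurable
  have h2 := φ.open_target.measurableSet.subtype_image (h hD)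
  convert h2 using 1
  ext y
  simp [Set.domRestrict, and_comm]

lemma aemeasurable_chart_symm (φ : OpenPartialHomeomorph M (EuclideanSpace ℝ (Fin n)))
    (ρ : EuclideanSpace ℝ (Fin n) → ENNReal) :
    AEMeasurable φ.symm ((volume.restrict φ.target).withDensity ρ) :=
  (φ.continuousOn_symm.aemeasurable φ.open_target.measurableSet).mono_ac
    (withDensity_absolutelyContinuous _ _)

lemma chartVolume_restrict (u : M → E) (φ : OpenPartialHomeomorph M (EuclideanSpace ℝ (Fin n)))
    {D : Set M} (hD : MeasurableSet D) :
    (chartVolume u φ).restrict D = Measure.map φ.symm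
      ((volume.restrict (φ.target ∩ φ.symm ⁻¹' D)).withDensity
        fun y => ENNReal.ofReal (volumeDensity (u ∘ φ.symm) y)) := by
  rw [chartVolume, Measure.restrict_map_of_aemeasurable (aemeasurable_chart_symm φ _) hD,
    restrict_withDensity', Measure.restrict_restrict' φ.open_target.measurableSet, inter_comm]

lemma chartVolume_apply (u : M → E) (φ : OpenPartialHomeomorph M (EuclideanSpace ℝ (Fin n)))
    {D : Set M} (hD : MeasurableSet D) :
    chartVolume u φ D = ∫⁻ y in φ.target ∩ φ.symm ⁻¹' D,
      ENNReal.ofReal (volumeDensity (u ∘ φ.symm) y) := by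
  rw [chartVolume, Measure.map_apply_of_aemeasurable (aemeasurable_chart_symm φ _) hD,
    withDensity_apply', Measure.restrict_restrict' φ.open_target.measurableSet, inter_comm]

lemma chartVolume_le (u : M → E) {φ : OpenPartialHomeomorph M (EuclideanSpace ℝ (Fin n))}
    (hφ : φ ∈ atlas (EuclideanSpace ℝ (Fin n)) M) :
    chartVolume u φ ≤ inducedVolume (n := n) u :=
  le_iSup₂_of_le φ hφ le_rfl

/-- The transition map `ψ` carries one coordinate image of `D` onto the other, and its Jacobian in
the change of variables formula is the factor by which the two densities differ. Injectivity of the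
differential of `u` plays no role, so this covers every member of a variation. -/
lemma chartVolume_overlap {u : M → E} (hu : ContMDiff (𝓡 n) 𝓘(ℝ, E) 1 u)
    {φ φ' : OpenPartialHomeomorph M (EuclideanSpace ℝ (Fin n))}
    (hφ : φ ∈ atlas (EuclideanSpace ℝ (Fin n)) M) (hφ' : φ' ∈ atlas (EuclideanSpace ℝ (Fin n)) M)
    {D : Set M} (hD : MeasurableSet D) (hDφ : D ⊆ φ.source) (hDφ' : D ⊆ φ'.source) :
    chartVolume u φ' D = chartVolume u φ D := by
  rw [chartVolume_apply u φ hD, chartVolume_apply u φ' hD]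
  set A := φ.target ∩ φ.symm ⁻¹' D with hA
  set ψ := φ' ∘ φ.symm with hψ
  have himg : φ'.target ∩ φ'.symm ⁻¹' D = ψ '' A := by
    ext z
    constructor
    · rintro ⟨hz, hzD⟩
      refine ⟨φ (φ'.symm z), ⟨φ.map_source (hDφ hzD), ?_⟩, ?_⟩
      · simpa [φ.left_inv (hDφ hzD)] using hzD
      · simp [hψ, φ.left_inv (hDφ hzD), φ'.right_inv hz]
    · rintro ⟨y, ⟨hy, hyD⟩, rfl⟩
      exact ⟨φ'.map_source (hDφ' hyD), by simpa [hψ, φ'.left_inv (hDφ' hyD)] using hyD⟩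
  have hd : ∀ y ∈ A, DifferentiableAt ℝ ψ y := fun y hy => by
    have h1 : ContMDiffAt (𝓡 n) (𝓡 n) ∞ ψ y :=
      (contMDiffAt_chart hφ' (hDφ' hy.2)).comp y (contMDiffAt_symm hφ hy.1)
    exact (contMDiffAt_iff_contDiffAt.mp h1).differentiableAt (by simp)
  have hinj : InjOn ψ A := fun y hy y' hy' h => by
    have := φ'.injOn (hDφ' hy.2) (hDφ' hy'.2) h
    exact φ.symm.injOn hy.1 hy'.1 this
  rw [himg, lintegral_image_eq_lintegral_abs_det_fderiv_mul volume
    (measurableSet_chart_image φ hD) (fun y hy => (hd y hy).hasFDerivAt.hasFDerivWithinAt) hinj]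
  refine setLIntegral_congr_fun (measurableSet_chart_image φ hD) fun y hy => ?_
  have h2 : DifferentiableAt ℝ (u ∘ φ'.symm) (ψ y) := by
    refine ContDiffAt.differentiableAt (n := 1) (contDiffAt_comp_symm (by norm_cast) hφ'
      (φ'.map_source (hDφ' hy.2)) (hu _)) (by simp)
  have h3 : u ∘ φ.symm =ᶠ[nhds y] (u ∘ φ'.symm) ∘ ψ := by
    have : ∀ᶠ z in nhds y, φ.symm z ∈ φ'.source :=
      (φ.symm.continuousAt hy.1).eventually (φ'.open_source.mem_nhds (hDφ' hy.2))
    filter_upwards [this] with z hz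
    simp [hψ, φ'.left_inv hz]
  have h4 : volumeDensity (u ∘ φ.symm) y = volumeDensity ((u ∘ φ'.symm) ∘ ψ) y := by
    rw [volumeDensity_eq_normDet, volumeDensity_eq_normDet, h3.fderiv_eq]
  show _ = ENNReal.ofReal (volumeDensity (u ∘ φ.symm) y)
  rw [h4, volumeDensity_comp h2 (hd y hy), ENNReal.ofReal_mul (abs_nonneg _)]

lemma chartVolume_compl_source (u : M → E)
    (φ : OpenPartialHomeomorph M (EuclideanSpace ℝ (Fin n))) :
    chartVolume u φ φ.sourceᶜ = 0 := by
  rw [chartVolume_apply u φ φ.open_source.measurableSet.compl]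
  have : φ.target ∩ φ.symm ⁻¹' φ.sourceᶜ = ∅ := by
    ext y
    simp only [mem_inter_iff, mem_preimage, mem_compl_iff, mem_empty_iff_false, iff_false, not_and,
      not_not]
    exact fun hy => φ.map_target hy
  rw [this, Measure.restrict_empty, lintegral_zero_measure]

/-- The induced volume restricts to the chart volume on the domain of each chart. -/
lemma inducedVolume_restrict_source {u : M → E} (hu : ContMDiff (𝓡 n) 𝓘(ℝ, E) 1 u)
    {φ : OpenPartialHomeomorph M (EuclideanSpace ℝ (Fin n))}
    (hφ : φ ∈ atlas (EuclideanSpace ℝ (Fin n)) M) :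
    (inducedVolume (n := n) u).restrict φ.source = chartVolume u φ := by
  have hs := φ.open_source.measurableSet
  have hc : (chartVolume u φ).restrict φ.source = chartVolume u φ :=
    Measure.restrict_eq_self_of_ae_mem (by
      rw [ae_iff]; exact chartVolume_compl_source u φ)
  refine le_antisymm ?_ ?_
  -- A supremum of measures is controlled by exhibiting one upper bound. Each chart measure is at
  -- most `chartVolume u φ` inside the source of `φ`, by the overlap formula, and at most the full
  -- induced volume outside.
  · have hub : inducedVolume (n := n) u ≤
        chartVolume u φ + (inducedVolume (n := n) u).restrict φ.sourceᶜ := by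
      refine iSup₂_le fun φ' hφ' => Measure.le_iff.mpr fun S hS => ?_
      rw [← measure_inter_add_sdiff S hs, Measure.add_apply, Measure.restrict_apply hS]
      refine add_le_add ?_ (chartVolume_le u hφ' _)
      have hs' := φ'.open_source.measurableSet
      rw [← measure_inter_add_sdiff (S ∩ φ.source) hs']
      have h0 : chartVolume u φ' ((S ∩ φ.source) \ φ'.source) = 0 :=
        measure_mono_null (fun x hx => hx.2) (chartVolume_compl_source u φ')
      rw [h0, add_zero, chartVolume_overlap hu hφ hφ' ((hS.inter hs).inter hs')
        (fun x hx => hx.1.2) (fun x hx => hx.2)]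
      exact measure_mono fun x hx => hx.1.1
    refine (Measure.restrict_mono subset_rfl hub).trans ?_
    rw [Measure.restrict_add, Measure.restrict_restrict hs, inter_compl_self,
      Measure.restrict_empty, add_zero, hc]
  · conv_lhs => rw [← hc]
    exact Measure.restrict_mono subset_rfl (chartVolume_le u hφ)

lemma inducedVolume_restrict {u : M → E} (hu : ContMDiff (𝓡 n) 𝓘(ℝ, E) 1 u)
    {φ : OpenPartialHomeomorph M (EuclideanSpace ℝ (Fin n))}
    (hφ : φ ∈ atlas (EuclideanSpace ℝ (Fin n)) M) {D : Set M} (hD : MeasurableSet D)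
    (hDφ : D ⊆ φ.source) :
    (inducedVolume (n := n) u).restrict D = Measure.map φ.symm
      ((volume.restrict (φ.target ∩ φ.symm ⁻¹' D)).withDensity
        fun y => ENNReal.ofReal (volumeDensity (u ∘ φ.symm) y)) := by
  rw [← chartVolume_restrict u φ hD, ← inducedVolume_restrict_source hu hφ,
    Measure.restrict_restrict hD, inter_eq_self_of_subset_left hDφ]

lemma aemeasurable_symm_withDensity (φ : OpenPartialHomeomorph M (EuclideanSpace ℝ (Fin n)))
    (D : Set M) (ρ : EuclideanSpace ℝ (Fin n) → ENNReal) :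
    AEMeasurable φ.symm ((volume.restrict (φ.target ∩ φ.symm ⁻¹' D)).withDensity ρ) :=
  ((φ.continuousOn_symm.aemeasurable φ.open_target.measurableSet).mono_measure
    (Measure.restrict_mono inter_subset_left le_rfl)).mono_ac (withDensity_absolutelyContinuous _ _)

variable {u : M → E} {φ : OpenPartialHomeomorph M (EuclideanSpace ℝ (Fin n))} {D : Set M}
  {g : M → ℝ}

lemma integrableOn_chart (hu : ContMDiff (𝓡 n) 𝓘(ℝ, E) 1 u)
    (hφ : φ ∈ atlas (EuclideanSpace ℝ (Fin n)) M) (hD : MeasurableSet D) (hDφ : D ⊆ φ.source)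
    (hg : ContinuousOn g φ.source) :
    IntegrableOn g D (inducedVolume (n := n) u) ↔
      IntegrableOn (fun y => volumeDensity (u ∘ φ.symm) y * g (φ.symm y))
        (φ.target ∩ φ.symm ⁻¹' D) := by
  have hm := (hg.mono hDφ).aestronglyMeasurable (μ := inducedVolume (n := n) u) hD
  rw [inducedVolume_restrict hu hφ hD hDφ] at hm
  rw [IntegrableOn, inducedVolume_restrict hu hφ hD hDφ, integrable_map_measure hm
      (aemeasurable_symm_withDensity φ D _),
    integrable_withDensity_iff_integrable_smul' (measurable_volumeDensity _).ennreal_ofReal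
      (Filter.Eventually.of_forall fun _ => ENNReal.ofReal_lt_top)]
  simp only [ENNReal.toReal_ofReal (volumeDensity_nonneg _ _), smul_eq_mul]
  rfl

lemma setIntegral_chart (hu : ContMDiff (𝓡 n) 𝓘(ℝ, E) 1 u)
    (hφ : φ ∈ atlas (EuclideanSpace ℝ (Fin n)) M) (hD : MeasurableSet D) (hDφ : D ⊆ φ.source)
    (hg : ContinuousOn g φ.source) :
    ∫ x in D, g x ∂(inducedVolume (n := n) u) =
      ∫ y in φ.target ∩ φ.symm ⁻¹' D, volumeDensity (u ∘ φ.symm) y * g (φ.symm y) := by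
  have hm := (hg.mono hDφ).aestronglyMeasurable (μ := inducedVolume (n := n) u) hD
  rw [inducedVolume_restrict hu hφ hD hDφ] at hm
  rw [inducedVolume_restrict hu hφ hD hDφ, integral_map (aemeasurable_symm_withDensity φ D _) hm,
    integral_withDensity_eq_integral_toReal_smul (measurable_volumeDensity _).ennreal_ofReal
      (Filter.Eventually.of_forall fun _ => ENNReal.ofReal_lt_top)]
  simp only [ENNReal.toReal_ofReal (volumeDensity_nonneg _ _), smul_eq_mul]

end InducedVolume

/-! ### Parametrized submanifolds: derivatives of the tangential projection -/

section Parametrization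

open ContinuousLinearMap

variable {G E : Type*} [NormedAddCommGroup G] [InnerProductSpace ℝ G] [FiniteDimensional ℝ G]
  [NormedAddCommGroup E] [InnerProductSpace ℝ E] [FiniteDimensional ℝ E]

/-- The inverse, on the tangent spaces, of the differential of the parametrization `x`. -/
def coordPinv (x : G → E) (y : G) : E →L[ℝ] G := pinv (fderiv ℝ x y)

/-- The tangential projection along the parametrization `x`. -/
def coordProj (x : G → E) (y : G) : E →L[ℝ] E := fderiv ℝ x y ∘L coordPinv x y

variable {x : G → E} {y : G}

lemma contDiffAt_fderiv (hx : ContDiffAt ℝ ∞ x y) : ContDiffAt ℝ ∞ (fderiv ℝ x) y :=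
  hx.fderiv_right (by simp)

lemma eventually_injective_fderiv (hx : ContDiffAt ℝ ∞ x y)
    (hi : Function.Injective (fderiv ℝ x y)) :
    ∀ᶠ z in nhds y, Function.Injective (fderiv ℝ x z) :=
  (contDiffAt_fderiv hx).continuousAt.eventually (eventually_injective hi)

lemma contDiffAt_coordPinv (hx : ContDiffAt ℝ ∞ x y) (hi : Function.Injective (fderiv ℝ x y)) :
    ContDiffAt ℝ ∞ (coordPinv x) y :=
  (contDiffAt_pinv hi).comp y (contDiffAt_fderiv hx)

lemma contDiffAt_coordProj (hx : ContDiffAt ℝ ∞ x y) (hi : Function.Injective (fderiv ℝ x y)) :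
    ContDiffAt ℝ ∞ (coordProj x) y :=
  (contDiffAt_fderiv hx).clm_comp (contDiffAt_coordPinv hx hi)

lemma coordPinv_fderiv (hi : Function.Injective (fderiv ℝ x y)) (ξ : G) :
    coordPinv x y (fderiv ℝ x y ξ) = ξ := pinv_apply_self hi ξ

lemma coordProj_fderiv (hi : Function.Injective (fderiv ℝ x y)) (ξ : G) :
    coordProj x y (fderiv ℝ x y ξ) = fderiv ℝ x y ξ := by
  simp [coordProj, coordPinv_fderiv hi]

lemma coordPinv_coordProj (hi : Function.Injective (fderiv ℝ x y)) (w : E) :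
    coordPinv x y (coordProj x y w) = coordPinv x y w := by
  simp [coordProj, coordPinv_fderiv hi]

lemma coordProj_coordProj (hi : Function.Injective (fderiv ℝ x y)) (w : E) :
    coordProj x y (coordProj x y w) = coordProj x y w := by
  simp [coordProj, coordPinv_fderiv hi]

lemma coordProj_eq_starProjection (hi : Function.Injective (fderiv ℝ x y)) :
    coordProj x y = (LinearMap.range (fderiv ℝ x y).toLinearMap).starProjection :=
  comp_pinv_eq_starProjection hi

lemma inner_coordProj_left (hi : Function.Injective (fderiv ℝ x y)) (v w : E) :
    inner ℝ (coordProj x y v) w = inner ℝ v (coordProj x y w) := by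
  rw [coordProj_eq_starProjection hi, Submodule.inner_starProjection_left_eq_right]

lemma hasFDerivAt_coordProj (hx : ContDiffAt ℝ ∞ x y) (hi : Function.Injective (fderiv ℝ x y)) :
    HasFDerivAt (coordProj x) (fderiv ℝ (coordProj x) y) y :=
  ((contDiffAt_coordProj hx hi).differentiableAt (by simp)).hasFDerivAt

/-- The derivative of the tangential projection on tangent vectors is the normal part of the
second derivative of the parametrization. -/
lemma fderiv_coordProj_fderiv (hx : ContDiffAt ℝ ∞ x y) (hi : Function.Injective (fderiv ℝ x y))
    (ξ η : G) :
    fderiv ℝ (coordProj x) y ξ (fderiv ℝ x y η) =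
      fderiv ℝ (fderiv ℝ x) y ξ η - coordProj x y (fderiv ℝ (fderiv ℝ x) y ξ η) := by
  have hF : HasFDerivAt (fun z => fderiv ℝ x z η)
      ((ContinuousLinearMap.apply ℝ E η).comp (fderiv ℝ (fderiv ℝ x) y)) y :=
    (ContinuousLinearMap.apply ℝ E η).hasFDerivAt.comp y
      ((contDiffAt_fderiv hx).differentiableAt (by simp)).hasFDerivAt
  have h := (hasFDerivAt_coordProj hx hi).clm_apply hF
  -- The projection fixes the tangent field `Dx η` near `y`; differentiating this identity leaves
  -- the normal part of `D²x(ξ, η)`.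
  have h2 : (fun z => coordProj x z (fderiv ℝ x z η)) =ᶠ[nhds y] fun z => fderiv ℝ x z η := by
    filter_upwards [eventually_injective_fderiv hx hi] with z hz using coordProj_fderiv hz η
  have h3 := DFunLike.congr_fun ((h.congr_of_eventuallyEq h2.symm).unique hF) ξ
  simp only [add_apply, coe_comp, Function.comp_apply, flip_apply, apply_apply] at h3
  rw [eq_sub_iff_add_eq', h3]

lemma isSymmetric_fderiv_fderiv (hx : ContDiffAt ℝ ∞ x y) (ξ η : G) :
    fderiv ℝ (fderiv ℝ x) y ξ η = fderiv ℝ (fderiv ℝ x) y η ξ :=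
  (hx.isSymmSndFDerivAt (by simp; norm_cast)) ξ η

/-- The derivative of a family of projections maps the range into the kernel. This makes the
extension `q ↦ tanProj f q z` of a tangent vector parallel at the base point. -/
lemma coordProj_fderiv_coordProj_coordProj (hx : ContDiffAt ℝ ∞ x y)
    (hi : Function.Injective (fderiv ℝ x y)) (ξ : G) (w : E) :
    coordProj x y (fderiv ℝ (coordProj x) y ξ (coordProj x y w)) = 0 := by
  have h := fderiv_coordProj_fderiv hx hi ξ (coordPinv x y w)
  have h2 : fderiv ℝ x y (coordPinv x y w) = coordProj x y w := rfl
  rw [h2] at h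
  rw [h, map_sub, coordProj_coordProj hi, sub_self]

/-- The projections are self-adjoint in a whole neighbourhood, and differentiation preserves this.
-/
lemma inner_fderiv_coordProj_left (hx : ContDiffAt ℝ ∞ x y)
    (hi : Function.Injective (fderiv ℝ x y)) (ξ : G) (v w : E) :
    inner ℝ (fderiv ℝ (coordProj x) y ξ v) w = inner ℝ v (fderiv ℝ (coordProj x) y ξ w) := by
  have h0 : ∀ v, HasFDerivAt (fun z => coordProj x z v)
      ((ContinuousLinearMap.apply ℝ E v).comp (fderiv ℝ (coordProj x) y)) y := fun v =>
    (ContinuousLinearMap.apply ℝ E v).hasFDerivAt.comp y (hasFDerivAt_coordProj hx hi)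
  have h1 := (h0 v).inner ℝ (hasFDerivAt_const w y)
  have h2 := (hasFDerivAt_const v y).inner ℝ (h0 w)
  have h3 : (fun z => inner ℝ (coordProj x z v) w) =ᶠ[nhds y]
      fun z => inner ℝ v (coordProj x z w) := by
    filter_upwards [eventually_injective_fderiv hx hi] with z hz
    exact inner_coordProj_left hz v w
  have h4 := DFunLike.congr_fun (h1.unique (h2.congr_of_eventuallyEq h3)) ξ
  simpa [fderivInnerCLM_apply] using h4

end Parametrization

/-! ### Geometry of an immersion in a chart -/

section Chart

open ContinuousLinearMap

variable {n : ℕ} {E : Type*} [NormedAddCommGroup E] [InnerProductSpace ℝ E]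
  [FiniteDimensional ℝ E]
  {M : Type*} [TopologicalSpace M] [ChartedSpace (EuclideanSpace ℝ (Fin n)) M]
  [IsManifold (𝓡 n) ∞ M]

/-- The divergence `∑ i, ⟨∇̄_{e_i} Z, e_i⟩` along the immersion `f` of an ambient vector field. -/
def divergence (f Z : M → E) (p : M) : ℝ :=
  ∑ i, inner ℝ (dirDeriv (n := n) f Z p (tangentBasis (n := n) f p i : E))
    (tangentBasis (n := n) f p i : E)

variable {φ : OpenPartialHomeomorph M (EuclideanSpace ℝ (Fin n))} {y : EuclideanSpace ℝ (Fin n)}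

lemma eventuallyEq_comp_symm_comp {F : Type*} (u : M → F) (hy : y ∈ φ.target) :
    u =ᶠ[nhds (φ.symm y)] (u ∘ φ.symm) ∘ φ := by
  filter_upwards [φ.open_source.mem_nhds (φ.map_target hy)] with q hq
  simp [φ.left_inv hq]

lemma mdifferentiableAt_chart (hφ : φ ∈ atlas (EuclideanSpace ℝ (Fin n)) M) (hy : y ∈ φ.target) :
    MDifferentiableAt (𝓡 n) (𝓡 n) φ (φ.symm y) :=
  (contMDiffAt_chart hφ (φ.map_target hy)).mdifferentiableAt (by simp)

lemma surjective_mfderiv_chart (hφ : φ ∈ atlas (EuclideanSpace ℝ (Fin n)) M)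
    (hy : y ∈ φ.target) : Function.Surjective (mfderiv (𝓡 n) (𝓡 n) φ (φ.symm y)) := by
  have : IsManifold (𝓡 n) 1 M := IsManifold.of_le (n := ∞) (by norm_cast)
  exact (mdifferentiable_of_mem_atlas hφ).mfderiv_surjective (φ.map_target hy)

lemma hasMFDerivAt_of_chart {F : Type*} [NormedAddCommGroup F] [NormedSpace ℝ F]
    (hφ : φ ∈ atlas (EuclideanSpace ℝ (Fin n)) M) (hy : y ∈ φ.target)
    {u : M → F} (hu : DifferentiableAt ℝ (u ∘ φ.symm) y) :
    HasMFDerivAt (𝓡 n) 𝓘(ℝ, F) u (φ.symm y)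
      ((fderiv ℝ (u ∘ φ.symm) y).comp (mfderiv (𝓡 n) (𝓡 n) φ (φ.symm y))) := by
  have h1 : HasMFDerivAt (𝓡 n) 𝓘(ℝ, F) (u ∘ φ.symm) (φ (φ.symm y)) (fderiv ℝ (u ∘ φ.symm) y) := by
    rw [φ.right_inv hy]
    exact hu.hasFDerivAt.hasMFDerivAt
  exact (h1.comp (φ.symm y) (mdifferentiableAt_chart hφ hy).hasMFDerivAt).congr_of_eventuallyEq
    (eventuallyEq_comp_symm_comp u hy)

lemma differential_eq_chart (hφ : φ ∈ atlas (EuclideanSpace ℝ (Fin n)) M) (hy : y ∈ φ.target)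
    {u : M → E} (hu : DifferentiableAt ℝ (u ∘ φ.symm) y)
    (v : TangentSpace (𝓡 n) (φ.symm y)) :
    differential (n := n) u (φ.symm y) v =
      fderiv ℝ (u ∘ φ.symm) y (mfderiv (𝓡 n) (𝓡 n) φ (φ.symm y) v) := by
  rw [differential, (hasMFDerivAt_of_chart hφ hy hu).mfderiv]; rfl

variable {f : M → E} (hf : IsSmoothImmersion (n := n) f)
include hf

lemma contDiffAt_immersion (hφ : φ ∈ atlas (EuclideanSpace ℝ (Fin n)) M) (hy : y ∈ φ.target) :
    ContDiffAt ℝ ∞ (f ∘ φ.symm) y :=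
  contDiffAt_comp_symm le_rfl hφ hy (hf.1 _)

lemma differentiableAt_immersion (hφ : φ ∈ atlas (EuclideanSpace ℝ (Fin n)) M)
    (hy : y ∈ φ.target) : DifferentiableAt ℝ (f ∘ φ.symm) y :=
  (contDiffAt_immersion hf hφ hy).differentiableAt (by simp)

lemma injective_fderiv_immersion (hφ : φ ∈ atlas (EuclideanSpace ℝ (Fin n)) M)
    (hy : y ∈ φ.target) : Function.Injective (fderiv ℝ (f ∘ φ.symm) y) := by
  intro ξ η h
  obtain ⟨v, rfl⟩ := surjective_mfderiv_chart hφ hy ξ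
  obtain ⟨w, rfl⟩ := surjective_mfderiv_chart hφ hy η
  have h1 := differential_eq_chart hφ hy (differentiableAt_immersion hf hφ hy)
  have h2 : differential (n := n) f (φ.symm y) v = differential (n := n) f (φ.symm y) w := by
    rw [h1, h1]; exact h
  rw [hf.2 _ h2]

lemma tangentPlane_eq_chart (hφ : φ ∈ atlas (EuclideanSpace ℝ (Fin n)) M) (hy : y ∈ φ.target) :
    tangentPlane (n := n) f (φ.symm y) =
      LinearMap.range (fderiv ℝ (f ∘ φ.symm) y).toLinearMap := by
  have h1 := differential_eq_chart hφ hy (differentiableAt_immersion hf hφ hy)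
  ext w
  constructor
  · rintro ⟨v, rfl⟩
    exact ⟨_, (h1 v).symm⟩
  · rintro ⟨ξ, rfl⟩
    obtain ⟨v, rfl⟩ := surjective_mfderiv_chart hφ hy ξ
    exact ⟨v, h1 v⟩

lemma tanProj_eq_chart (hφ : φ ∈ atlas (EuclideanSpace ℝ (Fin n)) M) (hy : y ∈ φ.target) :
    tanProj (n := n) f (φ.symm y) = coordProj (f ∘ φ.symm) y := by
  rw [coordProj_eq_starProjection (injective_fderiv_immersion hf hφ hy), tanProj]
  simp_rw [tangentPlane_eq_chart hf hφ hy]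

lemma norProj_eq_chart (hφ : φ ∈ atlas (EuclideanSpace ℝ (Fin n)) M) (hy : y ∈ φ.target) (w : E) :
    norProj (n := n) f (φ.symm y) w = w - coordProj (f ∘ φ.symm) y w := by
  rw [← tanProj_eq_chart hf hφ hy, norProj, tanProj, Submodule.starProjection_orthogonal_val]

/-- `lift` chooses a preimage abstractly. Since the differential of `f` in the chart is injective,
it suffices to compare images under it, and both are the tangential part of `w`. -/
lemma dirDeriv_eq_chart (hφ : φ ∈ atlas (EuclideanSpace ℝ (Fin n)) M) (hy : y ∈ φ.target)
    {u : M → E} (hu : DifferentiableAt ℝ (u ∘ φ.symm) y) (w : E) :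
    dirDeriv (n := n) f u (φ.symm y) w =
      fderiv ℝ (u ∘ φ.symm) y (coordPinv (f ∘ φ.symm) y w) := by
  have hi := injective_fderiv_immersion hf hφ hy
  rw [dirDeriv, differential_eq_chart hφ hy hu]
  congr 1
  apply hi
  rw [← differential_eq_chart hφ hy (differentiableAt_immersion hf hφ hy)]
  have h2 : differential (n := n) f (φ.symm y) (lift (n := n) f (φ.symm y) w) =
      tanProj (n := n) f (φ.symm y) w := by
    apply Function.invFun_eq
    have : tanProj (n := n) f (φ.symm y) w ∈ tangentPlane (n := n) f (φ.symm y) :=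
      Submodule.starProjection_apply_mem _ _
    obtain ⟨v, hv⟩ := this
    exact ⟨v, hv⟩
  rw [h2, tanProj_eq_chart hf hφ hy]
  rfl

lemma tanProj_tangentBasis (p : M) (i) :
    tanProj (n := n) f p (tangentBasis (n := n) f p i : E) = (tangentBasis (n := n) f p i : E) :=
  Submodule.starProjection_eq_self_iff.mpr (tangentBasis (n := n) f p i).2

lemma coordProj_tangentBasis (hφ : φ ∈ atlas (EuclideanSpace ℝ (Fin n)) M) (hy : y ∈ φ.target)
    (i) : coordProj (f ∘ φ.symm) y (tangentBasis (n := n) f (φ.symm y) i : E) =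
      (tangentBasis (n := n) f (φ.symm y) i : E) := by
  rw [← tanProj_eq_chart hf hφ hy]
  exact tanProj_tangentBasis hf _ i

lemma divergence_eq_chart (hφ : φ ∈ atlas (EuclideanSpace ℝ (Fin n)) M) (hy : y ∈ φ.target)
    {Z : M → E} (hZ : DifferentiableAt ℝ (Z ∘ φ.symm) y) :
    divergence (n := n) f Z (φ.symm y) =
      traceCLM _ (coordPinv (f ∘ φ.symm) y ∘L fderiv ℝ (Z ∘ φ.symm) y) := by
  simp only [divergence, dirDeriv_eq_chart hf hφ hy hZ]
  exact sum_inner_pinv (injective_fderiv_immersion hf hφ hy) (tangentPlane_eq_chart hf hφ hy)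
    (tangentBasis (n := n) f (φ.symm y)) _

lemma eventually_tanProj_comp_symm (hφ : φ ∈ atlas (EuclideanSpace ℝ (Fin n)) M)
    (hy : y ∈ φ.target) (z : E) :
    (fun q => tanProj (n := n) f q z) ∘ φ.symm =ᶠ[nhds y] fun y' => coordProj (f ∘ φ.symm) y' z := by
  filter_upwards [φ.open_target.mem_nhds hy] with y' hy'
  simp [tanProj_eq_chart hf hφ hy']

lemma hasFDerivAt_tanProj (hφ : φ ∈ atlas (EuclideanSpace ℝ (Fin n)) M) (hy : y ∈ φ.target)
    (z : E) : HasFDerivAt ((fun q => tanProj (n := n) f q z) ∘ φ.symm)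
      ((ContinuousLinearMap.apply ℝ E z).comp (fderiv ℝ (coordProj (f ∘ φ.symm)) y)) y :=
  ((ContinuousLinearMap.apply ℝ E z).hasFDerivAt.comp y
    (hasFDerivAt_coordProj (contDiffAt_immersion hf hφ hy)
      (injective_fderiv_immersion hf hφ hy))).congr_of_eventuallyEq
    (eventually_tanProj_comp_symm hf hφ hy z)

lemma dirDeriv_tanProj_eq_chart (hφ : φ ∈ atlas (EuclideanSpace ℝ (Fin n)) M) (hy : y ∈ φ.target)
    (w z : E) :
    dirDeriv (n := n) f (fun q => tanProj (n := n) f q z) (φ.symm y) w =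
      fderiv ℝ (coordProj (f ∘ φ.symm)) y (coordPinv (f ∘ φ.symm) y w) z := by
  have h := hasFDerivAt_tanProj hf hφ hy z
  rw [dirDeriv_eq_chart hf hφ hy h.differentiableAt, h.fderiv]
  rfl

/-- On a tangent vector `z` the derivative of the tangential projection is already normal, so the
outer normal projection has no effect. -/
lemma secondFundamentalForm_eq_chart (hφ : φ ∈ atlas (EuclideanSpace ℝ (Fin n)) M)
    (hy : y ∈ φ.target) (w : E) {z : E} (hz : coordProj (f ∘ φ.symm) y z = z) :
    secondFundamentalForm (n := n) f (φ.symm y) w z =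
      fderiv ℝ (coordProj (f ∘ φ.symm)) y (coordPinv (f ∘ φ.symm) y w) z := by
  rw [secondFundamentalForm, dirDeriv_tanProj_eq_chart hf hφ hy, norProj_eq_chart hf hφ hy]
  have := coordProj_fderiv_coordProj_coordProj (contDiffAt_immersion hf hφ hy)
    (injective_fderiv_immersion hf hφ hy) (coordPinv (f ∘ φ.symm) y w) z
  rw [hz] at this
  rw [this, sub_zero]

/-- If `w = Dx ξ` and `z = Dx η`, both sides are the normal part of the symmetric second derivative
`D²x(ξ, η)`. -/
lemma secondFundamentalForm_comm (hφ : φ ∈ atlas (EuclideanSpace ℝ (Fin n)) M)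
    (hy : y ∈ φ.target) {w z : E} (hw : coordProj (f ∘ φ.symm) y w = w)
    (hz : coordProj (f ∘ φ.symm) y z = z) :
    secondFundamentalForm (n := n) f (φ.symm y) w z =
      secondFundamentalForm (n := n) f (φ.symm y) z w := by
  have hx := contDiffAt_immersion hf hφ hy
  have hi := injective_fderiv_immersion hf hφ hy
  rw [secondFundamentalForm_eq_chart hf hφ hy w hz, secondFundamentalForm_eq_chart hf hφ hy z hw]
  have h1 : ∀ v : E, fderiv ℝ (f ∘ φ.symm) y (coordPinv (f ∘ φ.symm) y v) =
    coordProj (f ∘ φ.symm) y v := fun _ => rfl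
  conv_lhs => rw [← hz, ← h1]
  conv_rhs => rw [← hw, ← h1]
  rw [fderiv_coordProj_fderiv hx hi, fderiv_coordProj_fderiv hx hi, isSymmetric_fderiv_fderiv hx]

end Chart

/-! ### Pointwise identities for the first and second variation -/

section Pointwise

open ContinuousLinearMap

variable {n : ℕ} {E : Type*} [NormedAddCommGroup E] [InnerProductSpace ℝ E]
  [FiniteDimensional ℝ E]
  {M : Type*} [TopologicalSpace M] [ChartedSpace (EuclideanSpace ℝ (Fin n)) M]
  [IsManifold (𝓡 n) ∞ M]
  {φ : OpenPartialHomeomorph M (EuclideanSpace ℝ (Fin n))} {y : EuclideanSpace ℝ (Fin n)}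
  {f : M → E} (hf : IsSmoothImmersion (n := n) f)

/-- The gradient of `|V|² / 2` along the immersion `f`. -/
def halfGradientNormSq (f V : M → E) (q : M) : E :=
  ∑ k, inner ℝ (V q) (dirDeriv (n := n) f V q (stdOrthonormalBasis ℝ E k)) •
    stdOrthonormalBasis ℝ E k

/-- The integrand of the first variation of the weighted area. -/
def firstVariationDensity (T : E) (f V : M → E) (p : M) : ℝ :=
  Real.exp (inner ℝ T (f p)) * (inner ℝ T (V p) + divergence (n := n) f V p)

/-- The integrand of the second variation of the weighted area, for a variation with velocity `V`
and acceleration `W`. -/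
def secondVariationDensity (T : E) (f V W : M → E) (p : M) : ℝ :=
  Real.exp (inner ℝ T (f p)) * ((inner ℝ T (V p) + divergence (n := n) f V p) ^ 2
    + (inner ℝ T (W p) + divergence (n := n) f W p)
    + (∑ i, ‖normalConnection (n := n) f V p (tangentBasis (n := n) f p i : E)‖ ^ 2
      - ∑ i, ∑ j,
        inner ℝ (dirDeriv (n := n) f V p (tangentBasis (n := n) f p i : E))
          (tangentBasis (n := n) f p j : E) *
        inner ℝ (dirDeriv (n := n) f V p (tangentBasis (n := n) f p j : E))
          (tangentBasis (n := n) f p i : E)))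

include hf

lemma inner_tangentBasis_sum (p : M) (u v : E) :
    ∑ i, inner ℝ u (tangentBasis (n := n) f p i : E) * inner ℝ v (tangentBasis (n := n) f p i : E)
      = inner ℝ v (tanProj (n := n) f p u) := by
  rw [tanProj, ← sum_inner_smul_eq_starProjection (tangentBasis (n := n) f p), inner_sum]
  simp only [real_inner_smul_right]

lemma exists_chart (p : M) : ∃ φ ∈ atlas (EuclideanSpace ℝ (Fin n)) M,
    ∃ y ∈ φ.target, φ.symm y = p :=
  ⟨chartAt _ p, chart_mem_atlas _ p, chartAt _ p p, mem_chart_target _ p,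
    (chartAt _ p).left_inv (mem_chart_source _ p)⟩

lemma hasFDerivAt_tanProj_apply (hφ : φ ∈ atlas (EuclideanSpace ℝ (Fin n)) M) (hy : y ∈ φ.target)
    {W : M → E} (hW : DifferentiableAt ℝ (W ∘ φ.symm) y) :
    HasFDerivAt ((fun q => tanProj (n := n) f q (W q)) ∘ φ.symm)
      ((coordProj (f ∘ φ.symm) y).comp (fderiv ℝ (W ∘ φ.symm) y) +
        (fderiv ℝ (coordProj (f ∘ φ.symm)) y).flip (W (φ.symm y))) y := by
  refine ((hasFDerivAt_coordProj (contDiffAt_immersion hf hφ hy)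
    (injective_fderiv_immersion hf hφ hy)).clm_apply hW.hasFDerivAt).congr_of_eventuallyEq ?_
  filter_upwards [φ.open_target.mem_nhds hy] with y' hy'
  simp [tanProj_eq_chart hf hφ hy']

/-- The divergence of the normal part of a field is minus its product with the mean curvature. -/
lemma divergence_eq_tanProj (hφ : φ ∈ atlas (EuclideanSpace ℝ (Fin n)) M) (hy : y ∈ φ.target)
    {W : M → E} (hW : DifferentiableAt ℝ (W ∘ φ.symm) y) :
    divergence (n := n) f W (φ.symm y) =
      divergence (n := n) f (fun q => tanProj (n := n) f q (W q)) (φ.symm y)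
        - inner ℝ (meanCurvature (n := n) f (φ.symm y)) (W (φ.symm y)) := by
  have hx := contDiffAt_immersion hf hφ hy
  have hi := injective_fderiv_immersion hf hφ hy
  have h := hasFDerivAt_tanProj_apply hf hφ hy hW
  rw [divergence, divergence, meanCurvature, sum_inner, ← Finset.sum_sub_distrib]
  refine Finset.sum_congr rfl fun i _ => ?_
  have he := coordProj_tangentBasis hf hφ hy i
  rw [dirDeriv_eq_chart hf hφ hy hW, dirDeriv_eq_chart hf hφ hy h.differentiableAt, h.fderiv,
    secondFundamentalForm_eq_chart hf hφ hy _ he]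
  simp only [add_apply, comp_apply, flip_apply]
  -- With `Π` the tangential projection, the product rule for `Π W` gives `Π DW + (DΠ) W`.
  -- Self-adjointness of `DΠ` turns the second term, tested against `e_i`, into `⟨A(e_i, e_i), W⟩`.
  rw [inner_add_left, inner_coordProj_left hi, he, inner_fderiv_coordProj_left hx hi,
    real_inner_comm (W (φ.symm y))]
  ring

lemma tanProj_eq_zero {p : M} {v : E} (hv : v ∈ (tangentPlane (n := n) f p)ᗮ) :
    tanProj (n := n) f p v = 0 :=
  (Submodule.starProjection_apply_eq_zero_iff _).mpr hv

lemma norProj_eq_sub (p : M) (w : E) : norProj (n := n) f p w = w - tanProj (n := n) f p w :=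
  Submodule.starProjection_orthogonal_val _

lemma inner_tanProj_left (p : M) (u v : E) :
    inner ℝ (tanProj (n := n) f p u) v = inner ℝ u (tanProj (n := n) f p v) :=
  Submodule.inner_starProjection_left_eq_right _ _ _

lemma tanProj_tanProj (p : M) (u : E) :
    tanProj (n := n) f p (tanProj (n := n) f p u) = tanProj (n := n) f p u :=
  Submodule.starProjection_eq_self_iff.mpr (Submodule.starProjection_apply_mem _ _)

lemma divergence_normal (hφ : φ ∈ atlas (EuclideanSpace ℝ (Fin n)) M) (hy : y ∈ φ.target)
    {V : M → E} (hV : DifferentiableAt ℝ (V ∘ φ.symm) y)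
    (hn : ∀ p, V p ∈ (tangentPlane (n := n) f p)ᗮ) :
    divergence (n := n) f V (φ.symm y) =
      - inner ℝ (meanCurvature (n := n) f (φ.symm y)) (V (φ.symm y)) := by
  rw [divergence_eq_tanProj hf hφ hy hV]
  have h0 : (fun q => tanProj (n := n) f q (V q)) = fun _ => 0 :=
    funext fun q => tanProj_eq_zero hf (hn q)
  have h1 : DifferentiableAt ℝ ((fun _ : M => (0 : E)) ∘ φ.symm) y := differentiableAt_const _
  have h2 : fderiv ℝ ((fun _ : M => (0 : E)) ∘ φ.symm) y = 0 :=
    (hasFDerivAt_const (0 : E) y).fderiv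
  rw [h0, divergence_eq_chart hf hφ hy h1, h2]
  simp

/-- The tangential derivative of a normal field is given by the second fundamental form. -/
lemma inner_dirDeriv_normal (hφ : φ ∈ atlas (EuclideanSpace ℝ (Fin n)) M) (hy : y ∈ φ.target)
    {V : M → E} (hV : DifferentiableAt ℝ (V ∘ φ.symm) y)
    (hn : ∀ p, V p ∈ (tangentPlane (n := n) f p)ᗮ) (w : E) {z : E}
    (hz : coordProj (f ∘ φ.symm) y z = z) :
    inner ℝ (dirDeriv (n := n) f V (φ.symm y) w) z =
      - inner ℝ (secondFundamentalForm (n := n) f (φ.symm y) w z) (V (φ.symm y)) := by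
  have hx := contDiffAt_immersion hf hφ hy
  have hi := injective_fderiv_immersion hf hφ hy
  have h := hasFDerivAt_tanProj_apply hf hφ hy hV
  -- Normality says that the tangential projection annihilates `V` everywhere; the claim is the
  -- derivative of this identity.
  have h0 : (fun q => tanProj (n := n) f q (V q)) ∘ φ.symm = fun _ => 0 :=
    funext fun q => tanProj_eq_zero hf (hn _)
  rw [h0] at h
  have h1 := DFunLike.congr_fun (h.unique (hasFDerivAt_const (0 : E) y))
    (coordPinv (f ∘ φ.symm) y w)
  simp only [add_apply, comp_apply, flip_apply, zero_apply] at h1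
  rw [dirDeriv_eq_chart hf hφ hy hV, secondFundamentalForm_eq_chart hf hφ hy w hz]
  conv_lhs => rw [← hz]
  rw [← inner_coordProj_left hi, eq_neg_of_add_eq_zero_left h1, inner_neg_left,
    inner_fderiv_coordProj_left hx hi, real_inner_comm]

/-- Each `⟨D_{e_i} V, e_j⟩` is `-⟨A(e_i, e_j), V⟩`. The signs cancel in the products, and the
symmetry of `A` absorbs the exchange of indices. -/
lemma inner_curvatureTerm (hφ : φ ∈ atlas (EuclideanSpace ℝ (Fin n)) M) (hy : y ∈ φ.target)
    {V : M → E} (hV : DifferentiableAt ℝ (V ∘ φ.symm) y)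
    (hn : ∀ p, V p ∈ (tangentPlane (n := n) f p)ᗮ) :
    inner ℝ (V (φ.symm y)) (curvatureTerm (n := n) f V (φ.symm y)) =
      ∑ i, ∑ j,
        inner ℝ (dirDeriv (n := n) f V (φ.symm y) (tangentBasis (n := n) f (φ.symm y) i : E))
          (tangentBasis (n := n) f (φ.symm y) j : E) *
        inner ℝ (dirDeriv (n := n) f V (φ.symm y) (tangentBasis (n := n) f (φ.symm y) j : E))
          (tangentBasis (n := n) f (φ.symm y) i : E) := by
  rw [curvatureTerm, inner_sum]
  refine Finset.sum_congr rfl fun i _ => ?_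
  rw [inner_sum]
  refine Finset.sum_congr rfl fun j _ => ?_
  have hei := coordProj_tangentBasis hf hφ hy i
  have hej := coordProj_tangentBasis hf hφ hy j
  rw [inner_dirDeriv_normal hf hφ hy hV hn _ hei, inner_dirDeriv_normal hf hφ hy hV hn _ hej,
    secondFundamentalForm_comm hf hφ hy hej hei, real_inner_smul_right,
    real_inner_comm (secondFundamentalForm (n := n) f _ _ _)]
  ring

/-- The derivative of the weight along `e_i` is the weight times `⟨T, e_i⟩`; summed against the
components of the tangent vector `Z` this gives the whole of `⟨T, Z⟩`. -/
lemma divergence_exp_smul (hφ : φ ∈ atlas (EuclideanSpace ℝ (Fin n)) M) (hy : y ∈ φ.target)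
    (T : E) {Z : M → E} (hZ : DifferentiableAt ℝ (Z ∘ φ.symm) y)
    (ht : tanProj (n := n) f (φ.symm y) (Z (φ.symm y)) = Z (φ.symm y)) :
    divergence (n := n) f (fun q => Real.exp (inner ℝ T (f q)) • Z q) (φ.symm y) =
      Real.exp (inner ℝ T (f (φ.symm y))) * (divergence (n := n) f Z (φ.symm y)
        + inner ℝ T (Z (φ.symm y))) := by
  have hfd := (differentiableAt_immersion hf hφ hy).hasFDerivAt
  have he : HasFDerivAt (fun z => Real.exp (inner ℝ T ((f ∘ φ.symm) z))) _ y :=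
    ((hasFDerivAt_const T y).inner ℝ hfd).exp
  have h : HasFDerivAt ((fun q => Real.exp (inner ℝ T (f q)) • Z q) ∘ φ.symm) _ y :=
    he.smul hZ.hasFDerivAt
  rw [divergence, divergence]
  have h1 : inner ℝ T (Z (φ.symm y)) = ∑ i, inner ℝ (Z (φ.symm y))
      (tangentBasis (n := n) f (φ.symm y) i : E) *
      inner ℝ T (tangentBasis (n := n) f (φ.symm y) i : E) := by
    rw [inner_tangentBasis_sum hf, ht]
  rw [h1, ← Finset.sum_add_distrib, Finset.mul_sum]
  refine Finset.sum_congr rfl fun i _ => ?_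
  have hei := coordProj_tangentBasis hf hφ hy i
  rw [dirDeriv_eq_chart hf hφ hy h.differentiableAt, h.fderiv, dirDeriv_eq_chart hf hφ hy hZ]
  have h2 : fderiv ℝ (f ∘ φ.symm) y (coordPinv (f ∘ φ.symm) y
      (tangentBasis (n := n) f (φ.symm y) i : E)) = tangentBasis (n := n) f (φ.symm y) i := hei
  simp only [add_apply, smul_apply, smulRight_apply, comp_apply, fderivInnerCLM_apply, prod_apply,
    zero_apply, inner_zero_left, add_zero, Function.comp_apply, h2, smul_eq_mul, inner_add_left,
    real_inner_smul_left]
  ring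

/-! ### Second-order identities for a smooth normal field: Bochner formula and stability operator.
-/

section SecondOrder

variable {V : M → E} (hV : ContMDiff (𝓡 n) 𝓘(ℝ, E) ∞ V)
  (hn : ∀ p, V p ∈ (tangentPlane (n := n) f p)ᗮ)
include hV

lemma differentiableAt_chart (hφ : φ ∈ atlas (EuclideanSpace ℝ (Fin n)) M) (hy : y ∈ φ.target) :
    DifferentiableAt ℝ (V ∘ φ.symm) y :=
  (contDiffAt_comp_symm le_rfl hφ hy (hV _)).differentiableAt (by simp)

lemma halfGradientNormSq_eq_chart (hφ : φ ∈ atlas (EuclideanSpace ℝ (Fin n)) M)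
    (hy : y ∈ φ.target) :
    halfGradientNormSq (n := n) f V (φ.symm y) = ∑ k, inner ℝ ((V ∘ φ.symm) y)
      (fderiv ℝ (V ∘ φ.symm) y (coordPinv (f ∘ φ.symm) y (stdOrthonormalBasis ℝ E k))) •
        stdOrthonormalBasis ℝ E k := by
  simp only [halfGradientNormSq,
    dirDeriv_eq_chart hf hφ hy (differentiableAt_chart hf hV hφ hy), Function.comp_apply]

lemma inner_halfGradientNormSq (hφ : φ ∈ atlas (EuclideanSpace ℝ (Fin n)) M)
    (hy : y ∈ φ.target) (z : E) :
    inner ℝ (halfGradientNormSq (n := n) f V (φ.symm y)) z =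
      inner ℝ (V (φ.symm y)) (dirDeriv (n := n) f V (φ.symm y) z) := by
  rw [dirDeriv_eq_chart hf hφ hy (differentiableAt_chart hf hV hφ hy),
    halfGradientNormSq_eq_chart hf hV hφ hy]
  conv_rhs => rw [← (stdOrthonormalBasis ℝ E).sum_repr z]
  simp only [sum_inner, real_inner_smul_left, map_sum, map_smul, inner_sum, real_inner_smul_right,
    (stdOrthonormalBasis ℝ E).repr_apply_apply, Function.comp_apply]
  exact Finset.sum_congr rfl fun k _ => mul_comm _ _

/-- The gradient is expanded in a fixed ambient basis for this purpose: the frames `tangentBasis`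
are chosen point by point and need not vary continuously. -/
lemma contDiffAt_halfGradientNormSq (hφ : φ ∈ atlas (EuclideanSpace ℝ (Fin n)) M)
    (hy : y ∈ φ.target) : ContDiffAt ℝ ∞ (halfGradientNormSq (n := n) f V ∘ φ.symm) y := by
  have h1 : halfGradientNormSq (n := n) f V ∘ φ.symm =ᶠ[nhds y] fun y' =>
      ∑ k, inner ℝ ((V ∘ φ.symm) y')
        (fderiv ℝ (V ∘ φ.symm) y' (coordPinv (f ∘ φ.symm) y' (stdOrthonormalBasis ℝ E k))) •
          stdOrthonormalBasis ℝ E k := by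
    filter_upwards [φ.open_target.mem_nhds hy] with y' hy'
    exact halfGradientNormSq_eq_chart hf hV hφ hy'
  refine ContDiffAt.congr_of_eventuallyEq ?_ h1
  have hVc : ContDiffAt ℝ ∞ (V ∘ φ.symm) y := contDiffAt_comp_symm le_rfl hφ hy (hV _)
  have hP := contDiffAt_coordPinv (contDiffAt_immersion hf hφ hy)
    (injective_fderiv_immersion hf hφ hy)
  refine ContDiffAt.sum fun k _ => ContDiffAt.smul (ContDiffAt.inner ℝ hVc ?_) contDiffAt_const
  exact (contDiffAt_fderiv hVc).clm_apply (hP.clm_apply contDiffAt_const)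

/-- By duality: `dirDeriv` sees only the tangential part of its direction. -/
lemma tanProj_halfGradientNormSq (p : M) :
    tanProj (n := n) f p (halfGradientNormSq (n := n) f V p) =
      halfGradientNormSq (n := n) f V p := by
  obtain ⟨φ, hφ, y, hy, rfl⟩ := exists_chart hf p
  refine ext_inner_right ℝ fun z => ?_
  rw [inner_tanProj_left hf, inner_halfGradientNormSq hf hV hφ hy,
    inner_halfGradientNormSq hf hV hφ hy,
    dirDeriv_eq_chart hf hφ hy (differentiableAt_chart hf hV hφ hy),
    dirDeriv_eq_chart hf hφ hy (differentiableAt_chart hf hV hφ hy),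
    tanProj_eq_chart hf hφ hy, coordPinv_coordProj (injective_fderiv_immersion hf hφ hy)]

include hn

/-- The extension of `z` by projection is parallel at the point, so the Hessian is `∇^⊥_w R` with
`R` the normal derivative of `V` along that extension. Let `Y` be the gradient of `|V|²/2`. Since
`V` is normal, `⟨V, R⟩ = ⟨Y, z⟩` near the point, and the claim is the product rule for this
identity. -/
lemma normalHessian_eq_chart (hφ : φ ∈ atlas (EuclideanSpace ℝ (Fin n)) M)
    (hy : y ∈ φ.target) (w : E) {z : E} (hz : coordProj (f ∘ φ.symm) y z = z) :
    inner ℝ (V (φ.symm y)) (normalHessian (n := n) f V (φ.symm y) w z) =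
      inner ℝ (dirDeriv (n := n) f (halfGradientNormSq (n := n) f V) (φ.symm y) w) z -
        inner ℝ (dirDeriv (n := n) f V (φ.symm y) w)
          (normalConnection (n := n) f V (φ.symm y) z) := by
  have hx := contDiffAt_immersion hf hφ hy
  have hi := injective_fderiv_immersion hf hφ hy
  have hVc : ContDiffAt ℝ ∞ (V ∘ φ.symm) y := contDiffAt_comp_symm le_rfl hφ hy (hV _)
  have hVd := hVc.differentiableAt (by simp)
  have hYd : DifferentiableAt ℝ (halfGradientNormSq (n := n) f V ∘ φ.symm) y :=
    (contDiffAt_halfGradientNormSq hf hV hφ hy).differentiableAt (by simp)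
  have hVN : ∀ (p : M) (u : E), inner ℝ (V p) (norProj (n := n) f p u) = inner ℝ (V p) u :=
    fun p u => by
      rw [norProj_eq_sub hf, inner_sub_right, ← inner_tanProj_left hf, tanProj_eq_zero hf (hn p),
        inner_zero_left, sub_zero]
  set R : M → E := fun q => normalConnection (n := n) f V q (tanProj (n := n) f q z) with hR
  have hRc : R ∘ φ.symm =ᶠ[nhds y] fun y' =>
      fderiv ℝ (V ∘ φ.symm) y' (coordPinv (f ∘ φ.symm) y' z) -
        coordProj (f ∘ φ.symm) y' (fderiv ℝ (V ∘ φ.symm) y' (coordPinv (f ∘ φ.symm) y' z)) := by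
    filter_upwards [φ.open_target.mem_nhds hy] with y' hy'
    simp only [hR, Function.comp_apply, normalConnection]
    rw [norProj_eq_chart hf hφ hy',
      dirDeriv_eq_chart hf hφ hy' (differentiableAt_chart hf hV hφ hy'),
      tanProj_eq_chart hf hφ hy', coordPinv_coordProj (injective_fderiv_immersion hf hφ hy')]
  have hRd : DifferentiableAt ℝ (R ∘ φ.symm) y := by
    have h1 : ContDiffAt ℝ ∞ (fun y' =>
        fderiv ℝ (V ∘ φ.symm) y' (coordPinv (f ∘ φ.symm) y' z)) y :=
      (contDiffAt_fderiv hVc).clm_apply ((contDiffAt_coordPinv hx hi).clm_apply contDiffAt_const)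
    exact ((h1.sub ((contDiffAt_coordProj hx hi).clm_apply h1)).congr_of_eventuallyEq
      hRc).differentiableAt (by simp)
  -- the Levi-Civita term vanishes
  have hLC : leviCivita (n := n) f (fun q => tanProj (n := n) f q z) (φ.symm y) w = 0 := by
    rw [leviCivita, dirDeriv_tanProj_eq_chart hf hφ hy, tanProj_eq_chart hf hφ hy]
    have := coordProj_fderiv_coordProj_coordProj hx hi (coordPinv (f ∘ φ.symm) y w) z
    rwa [hz] at this
  have hz0 : normalConnection (n := n) f V (φ.symm y) 0 = 0 := by
    rw [normalConnection, dirDeriv_eq_chart hf hφ hy hVd]; simp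
  rw [normalHessian, hLC, hz0, sub_zero]
  rw [show (fun q => normalConnection (n := n) f V q (tanProj (n := n) f q z)) = R from rfl]
  rw [normalConnection, hVN]
  -- differentiate `⟨V, R⟩ = ⟨Y, z⟩`
  have hprod : (fun y' => inner ℝ ((V ∘ φ.symm) y') ((R ∘ φ.symm) y')) =ᶠ[nhds y] fun y' =>
      inner ℝ ((halfGradientNormSq (n := n) f V ∘ φ.symm) y') z := by
    filter_upwards [φ.open_target.mem_nhds hy] with y' hy'
    simp only [hR, Function.comp_apply, normalConnection]
    rw [hVN, inner_halfGradientNormSq hf hV hφ hy',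
      dirDeriv_eq_chart hf hφ hy' (differentiableAt_chart hf hV hφ hy'),
      dirDeriv_eq_chart hf hφ hy' (differentiableAt_chart hf hV hφ hy'),
      tanProj_eq_chart hf hφ hy', coordPinv_coordProj (injective_fderiv_immersion hf hφ hy')]
  have h1 := hVd.hasFDerivAt.inner ℝ hRd.hasFDerivAt
  have h2 := hYd.hasFDerivAt.inner ℝ (hasFDerivAt_const z y)
  have h3 := DFunLike.congr_fun (h1.unique (h2.congr_of_eventuallyEq hprod))
    (coordPinv (f ∘ φ.symm) y w)
  simp only [fderivInnerCLM_apply, comp_apply, prod_apply, zero_apply, inner_zero_right,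
    zero_add, Function.comp_apply] at h3
  have hRy : R (φ.symm y) = normalConnection (n := n) f V (φ.symm y) z := by
    simp only [hR]; rw [tanProj_eq_chart hf hφ hy, hz]
  rw [dirDeriv_eq_chart hf hφ hy hRd, dirDeriv_eq_chart hf hφ hy hYd,
    dirDeriv_eq_chart hf hφ hy hVd, ← hRy]
  linarith

/-- The Bochner identity: the trace of the product rule for the Laplacian of `|V|²/2`. -/
lemma inner_normalLaplacian (p : M) :
    inner ℝ (V p) (normalLaplacian (n := n) f V p) =
      divergence (n := n) f (halfGradientNormSq (n := n) f V) p -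
        ∑ i, ‖normalConnection (n := n) f V p (tangentBasis (n := n) f p i : E)‖ ^ 2 := by
  obtain ⟨φ, hφ, y, hy, rfl⟩ := exists_chart hf p
  rw [normalLaplacian, inner_sum, divergence, ← Finset.sum_sub_distrib]
  refine Finset.sum_congr rfl fun i _ => ?_
  rw [normalHessian_eq_chart hf hV hn hφ hy _ (coordProj_tangentBasis hf hφ hy i)]
  congr 1
  rw [normalConnection, norProj_eq_sub hf, ← real_inner_self_eq_norm_sq]
  simp only [inner_sub_left, inner_sub_right]
  rw [inner_tanProj_left hf, inner_tanProj_left hf, tanProj_tanProj hf]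
  ring

/-- The drift `∇^⊥_{Tᵀ} V`, paired with `V`, gives `⟨T, Y⟩` for the gradient `Y` of `|V|²/2`. Added
to the `div Y` of the Bochner identity it completes the weighted divergence of `Y`. -/
lemma inner_stabilityOperator (T : E) (p : M) :
    inner ℝ (V p) (stabilityOperator (n := n) T f V p) =
      divergence (n := n) f (halfGradientNormSq (n := n) f V) p
        + inner ℝ T (halfGradientNormSq (n := n) f V p)
        - (∑ i, ‖normalConnection (n := n) f V p (tangentBasis (n := n) f p i : E)‖ ^ 2
          - ∑ i, ∑ j,
            inner ℝ (dirDeriv (n := n) f V p (tangentBasis (n := n) f p i : E))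
              (tangentBasis (n := n) f p j : E) *
            inner ℝ (dirDeriv (n := n) f V p (tangentBasis (n := n) f p j : E))
              (tangentBasis (n := n) f p i : E)) := by
  have hT : inner ℝ (V p) (normalConnection (n := n) f V p (tanProj (n := n) f p T)) =
      inner ℝ T (halfGradientNormSq (n := n) f V p) := by
    rw [normalConnection, norProj_eq_sub hf, inner_sub_right, ← inner_tanProj_left hf,
      tanProj_eq_zero hf (hn p), inner_zero_left, sub_zero]
    rw [← tanProj_halfGradientNormSq hf hV p, ← inner_tanProj_left hf,
      real_inner_comm (halfGradientNormSq (n := n) f V p)]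
    obtain ⟨φ, hφ, y, hy, rfl⟩ := exists_chart hf p
    rw [inner_halfGradientNormSq hf hV hφ hy]
  rw [stabilityOperator, inner_add_right, inner_add_right, inner_normalLaplacian hf hV hn, hT]
  obtain ⟨φ, hφ, y, hy, rfl⟩ := exists_chart hf p
  rw [inner_curvatureTerm hf hφ hy (differentiableAt_chart hf hV hφ hy) hn]
  ring

lemma firstVariationDensity_eq (T : E) (p : M) :
    firstVariationDensity (n := n) T f V p = Real.exp (inner ℝ T (f p)) *
      inner ℝ (norProj (n := n) f p T - meanCurvature (n := n) f p) (V p) := by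
  obtain ⟨φ, hφ, y, hy, rfl⟩ := exists_chart hf p
  rw [firstVariationDensity, divergence_normal hf hφ hy (differentiableAt_chart hf hV hφ hy) hn,
    inner_sub_left, norProj_eq_sub hf, inner_sub_left, inner_tanProj_left hf,
    tanProj_eq_zero hf (hn _), inner_zero_right, sub_zero, sub_eq_add_neg]

/-- At a solution of `H = T^⊥`, the second variation density differs from the density of the
stability operator by a divergence. -/
lemma secondVariationDensity_eq (T : E) {W : M → E} (hW : ContMDiff (𝓡 n) 𝓘(ℝ, E) ∞ W) {p : M}
    (hH : meanCurvature (n := n) f p = norProj (n := n) f p T) :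
    secondVariationDensity (n := n) T f V W p =
      -inner ℝ (V p) (stabilityOperator (n := n) T f V p) * Real.exp (inner ℝ T (f p)) +
        divergence (n := n) f (fun q => Real.exp (inner ℝ T (f q)) •
          (tanProj (n := n) f q (W q) + halfGradientNormSq (n := n) f V q)) p := by
  -- At a solution the first variation density is zero and the exponential is positive, so the
  -- squared term drops out.
  have h1 := firstVariationDensity_eq hf hV hn T p
  rw [hH, sub_self, inner_zero_left, mul_zero, firstVariationDensity] at h1
  have h2 := (mul_eq_zero.mp h1).resolve_left (Real.exp_pos _).ne'
  rw [secondVariationDensity, h2, inner_stabilityOperator hf hV hn]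
  have h4 : tanProj (n := n) f p (tanProj (n := n) f p (W p) + halfGradientNormSq (n := n) f V p) =
      tanProj (n := n) f p (W p) + halfGradientNormSq (n := n) f V p := by
    rw [map_add, tanProj_tanProj hf, tanProj_halfGradientNormSq hf hV]
  obtain ⟨φ, hφ, y, hy, rfl⟩ := exists_chart hf p
  have hWd := differentiableAt_chart hf hW hφ hy
  have hWT := (hasFDerivAt_tanProj_apply hf hφ hy hWd).differentiableAt
  have hYd : DifferentiableAt ℝ (halfGradientNormSq (n := n) f V ∘ φ.symm) y :=
    (contDiffAt_halfGradientNormSq hf hV hφ hy).differentiableAt (by simp)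
  have hs : DifferentiableAt ℝ ((fun q => tanProj (n := n) f q (W q) +
      halfGradientNormSq (n := n) f V q) ∘ φ.symm) y := hWT.add hYd
  have hadd : divergence (n := n) f (fun q => tanProj (n := n) f q (W q) +
      halfGradientNormSq (n := n) f V q) (φ.symm y) =
      divergence (n := n) f (fun q => tanProj (n := n) f q (W q)) (φ.symm y) +
      divergence (n := n) f (halfGradientNormSq (n := n) f V) (φ.symm y) := by
    rw [divergence_eq_chart hf hφ hy hs, divergence_eq_chart hf hφ hy hWT,
      divergence_eq_chart hf hφ hy hYd, ← map_add, ← comp_add]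
    congr 2
    exact fderiv_add hWT hYd
  -- The normal part of the acceleration contributes `⟨T^⊥ - H, W⟩ = 0`; only `Wᵀ` survives, inside
  -- the divergence.
  rw [divergence_exp_smul hf hφ hy T hs h4, hadd,
    divergence_eq_tanProj hf hφ hy hWd, hH, norProj_eq_sub hf, inner_sub_left, inner_add_right,
    inner_tanProj_left hf]
  ring

end SecondOrder

end Pointwise

/-! ### The divergence theorem -/

section DivergenceTheorem

open ContinuousLinearMap MeasureTheory

/-- Each diagonal entry is a directional derivative of a compactly supported function, integrated by
parts against the constant `1`. -/
lemma integral_traceCLM_fderiv_eq_zero {G : Type*} [NormedAddCommGroup G] [InnerProductSpace ℝ G]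
    [FiniteDimensional ℝ G] [MeasurableSpace G] [BorelSpace G] (μ : Measure G)
    [μ.IsAddHaarMeasure] {η : G → G} (hη : ContDiff ℝ 1 η) (hc : HasCompactSupport η) :
    ∫ y, traceCLM G (fderiv ℝ η y) ∂μ = 0 := by
  set b := stdOrthonormalBasis ℝ G
  have hcont : Continuous (fderiv ℝ η) := hη.continuous_fderiv (by simp)
  have hsupp : HasCompactSupport (fderiv ℝ η) := hc.fderiv ℝ
  have hcoord : ∀ i, ∀ y, fderiv ℝ (fun z => inner ℝ (b i) (η z)) y (b i) =
      inner ℝ (b i) (fderiv ℝ η y (b i)) := fun i y => by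
    have h := ((hasFDerivAt_const (b i) y).inner ℝ
      ((hη.differentiable (by simp)) y).hasFDerivAt).fderiv
    rw [h]
    simp [fderivInnerCLM_apply]
  have hint : ∀ i, Integrable (fun y => inner ℝ (b i) (fderiv ℝ η y (b i))) μ := fun i => by
    refine Continuous.integrable_of_hasCompactSupport
      (continuous_const.inner (hcont.clm_apply continuous_const)) ?_
    exact hsupp.comp_left (g := fun A : G →L[ℝ] G => inner ℝ (b i) (A (b i))) (by simp)
  simp_rw [traceCLM_eq_sum b]
  rw [integral_finsetSum _ fun i _ => hint i]
  refine Finset.sum_eq_zero fun i _ => ?_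
  have hg : Integrable (fun y => inner ℝ (b i) (η y)) μ :=
    Continuous.integrable_of_hasCompactSupport (continuous_const.inner hη.continuous)
      (hc.comp_left (g := fun v : G => inner ℝ (b i) v) (by simp))
  have h := integral_mul_fderiv_eq_neg_fderiv_mul_of_integrable (μ := μ) (f := fun _ : G => (1 : ℝ))
    (g := fun z => inner ℝ (b i) (η z)) (v := b i) (by simp)
    (by simpa [hcoord] using hint i) (by simpa using hg) (fun _ _ => differentiableAt_const _)
    (fun y _ => (differentiableAt_const _).inner ℝ (hη.differentiable (by simp) y))
  simpa [hcoord] using h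

variable {n : ℕ} {E : Type*} [NormedAddCommGroup E] [InnerProductSpace ℝ E]
  [FiniteDimensional ℝ E]
  {M : Type*} [TopologicalSpace M] [ChartedSpace (EuclideanSpace ℝ (Fin n)) M]
  [IsManifold (𝓡 n) ∞ M]
  {φ : OpenPartialHomeomorph M (EuclideanSpace ℝ (Fin n))} {y : EuclideanSpace ℝ (Fin n)}

lemma continuousOn_source_of_comp_symm {F : Type*} [TopologicalSpace F] {g : M → F}
    (h : ContinuousOn (g ∘ φ.symm) φ.target) : ContinuousOn g φ.source :=
  (h.comp φ.continuousOn fun _ hq => φ.map_source hq).congr fun q hq => by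
    simp [φ.left_inv hq]

lemma contMDiff_of_chart {F : Type*} [NormedAddCommGroup F] [NormedSpace ℝ F] {u : M → F}
    (h : ∀ φ ∈ atlas (EuclideanSpace ℝ (Fin n)) M, ∀ y ∈ φ.target,
      ContDiffAt ℝ ∞ (u ∘ φ.symm) y) : ContMDiff (𝓡 n) 𝓘(ℝ, F) ∞ u := by
  intro p
  have hφ := chart_mem_atlas (EuclideanSpace ℝ (Fin n)) p
  have hp := mem_chart_source (EuclideanSpace ℝ (Fin n)) p
  set φ := chartAt (EuclideanSpace ℝ (Fin n)) p
  have h1 := (contMDiffAt_iff_contDiffAt.mpr (h φ hφ (φ p) (φ.map_source hp))).comp p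
    (contMDiffAt_chart hφ hp)
  refine h1.congr_of_eventuallyEq ?_
  filter_upwards [φ.open_source.mem_nhds hp] with q hq
  simp [φ.left_inv hq]

variable {f : M → E} (hf : IsSmoothImmersion (n := n) f)
include hf

lemma contDiffAt_volumeDensity (hφ : φ ∈ atlas (EuclideanSpace ℝ (Fin n)) M) (hy : y ∈ φ.target) :
    ContDiffAt ℝ ∞ (volumeDensity (f ∘ φ.symm)) y := by
  have h : volumeDensity (f ∘ φ.symm) =
      fun z => (fderiv ℝ (f ∘ φ.symm) z).toLinearMap.normDet :=
    funext (volumeDensity_eq_normDet _)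
  rw [h]
  exact (contDiffAt_normDet (injective_fderiv_immersion hf hφ hy)).comp y
    (contDiffAt_fderiv (contDiffAt_immersion hf hφ hy))

lemma volumeDensity_pos (hφ : φ ∈ atlas (EuclideanSpace ℝ (Fin n)) M) (hy : y ∈ φ.target) :
    0 < volumeDensity (f ∘ φ.symm) y := by
  rw [volumeDensity_eq_normDet]
  exact normDet_pos (injective_fderiv_immersion hf hφ hy)

/-- In coordinates, `√g div Z = ∂_i (√g Z^i)` for a tangent vector field `Z`. -/
lemma volumeDensity_mul_divergence (hφ : φ ∈ atlas (EuclideanSpace ℝ (Fin n)) M)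
    (hy : y ∈ φ.target) {Z : M → E} (hZ : DifferentiableAt ℝ (Z ∘ φ.symm) y)
    (ht : ∀ q, tanProj (n := n) f q (Z q) = Z q) :
    volumeDensity (f ∘ φ.symm) y * divergence (n := n) f Z (φ.symm y) =
      traceCLM _ (fderiv ℝ (fun z => volumeDensity (f ∘ φ.symm) z •
        coordPinv (f ∘ φ.symm) z (Z (φ.symm z))) y) := by
  set x := f ∘ φ.symm with hxdef
  have hx : ContDiffAt ℝ ∞ x y := contDiffAt_immersion hf hφ hy
  have hi : Function.Injective (fderiv ℝ x y) := injective_fderiv_immersion hf hφ hy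
  set ζ : EuclideanSpace ℝ (Fin n) → EuclideanSpace ℝ (Fin n) :=
    fun z => coordPinv x z (Z (φ.symm z)) with hζ
  have hζd : DifferentiableAt ℝ ζ y :=
    ((contDiffAt_coordPinv hx hi).differentiableAt (by simp)).clm_apply hZ
  have hFd := ((contDiffAt_fderiv hx).differentiableAt (by simp)).hasFDerivAt
  -- `ζ` is the coordinate vector of the tangent field, so `Z = Dx ζ` and its derivative is `Dx Dζ +
  -- D²x(·, ζ)`.
  have hZζ : Z ∘ φ.symm =ᶠ[nhds y] fun z => fderiv ℝ x z (ζ z) := by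
    filter_upwards [φ.open_target.mem_nhds hy] with z hz
    have := ht (φ.symm z)
    rw [tanProj_eq_chart hf hφ hz] at this
    exact this.symm
  have hZ' := (hFd.clm_apply hζd.hasFDerivAt).congr_of_eventuallyEq hZζ
  have hv := (contDiffAt_volumeDensity hf hφ hy).differentiableAt (by simp)
  have hprod : HasFDerivAt (fun z => volumeDensity x z • coordPinv x z (Z (φ.symm z))) _ y :=
    hv.hasFDerivAt.smul hζd.hasFDerivAt
  -- Jacobi's formula is stated for curves, so the density is restricted to the line through `y` in
  -- the direction `ζ y`.
  have hdv : fderiv ℝ (volumeDensity x) y (ζ y) = volumeDensity x y *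
      traceCLM _ (coordPinv x y ∘L fderiv ℝ (fderiv ℝ x) y (ζ y)) := by
    have hl : HasDerivAt (fun s : ℝ => y + s • ζ y) (ζ y) 0 := by
      simpa using ((hasDerivAt_id (0 : ℝ)).smul_const (ζ y)).const_add y
    have hFl : HasDerivAt (fun s : ℝ => fderiv ℝ x (y + s • ζ y))
        (fderiv ℝ (fderiv ℝ x) y (ζ y)) 0 :=
      HasFDerivAt.comp_hasDerivAt_of_eq 0 hFd hl (by simp)
    have h1 := hasDerivAt_normDet (L := fun s : ℝ => fderiv ℝ x (y + s • ζ y)) (s := 0)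
      (by simpa using hi) hFl
    have h2 : HasDerivAt (fun s : ℝ => volumeDensity x (y + s • ζ y))
        (fderiv ℝ (volumeDensity x) y (ζ y)) 0 :=
      HasFDerivAt.comp_hasDerivAt_of_eq 0 hv.hasFDerivAt hl (by simp)
    simp_rw [volumeDensity_eq_normDet] at h2
    have h3 := h2.unique h1
    rw [zero_smul, add_zero] at h3
    rw [volumeDensity_eq_normDet]
    exact h3
  rw [divergence_eq_chart hf hφ hy hZ, hprod.fderiv, hZ'.fderiv]
  -- Symmetry of `D²x` turns `D²x(·, ζ)` into `D²x(ζ, ·)`, whose trace against `coordPinv x y` is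
  -- the logarithmic derivative of the density along `ζ`.
  have e1 : coordPinv x y ∘L (fderiv ℝ x y ∘L fderiv ℝ ζ y +
      (fderiv ℝ (fderiv ℝ x) y).flip (ζ y)) =
      fderiv ℝ ζ y + coordPinv x y ∘L fderiv ℝ (fderiv ℝ x) y (ζ y) := by
    ext1 ξ
    simp only [comp_apply, add_apply, flip_apply, map_add, coordPinv_fderiv hi,
      isSymmetric_fderiv_fderiv hx ξ]
  have e2 : traceCLM _ ((fderiv ℝ (volumeDensity x) y).smulRight (ζ y)) =
      fderiv ℝ (volumeDensity x) y (ζ y) := by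
    rw [traceCLM_apply]
    exact LinearMap.trace_smulRight (fderiv ℝ (volumeDensity x) y).toLinearMap (ζ y)
  rw [e1, map_add, map_add, map_smul, e2, hdv, mul_add, smul_eq_mul]

lemma contMDiff_divergence {Z : M → E} (hZ : ContMDiff (𝓡 n) 𝓘(ℝ, E) ∞ Z) :
    ContMDiff (𝓡 n) 𝓘(ℝ, ℝ) ∞ (divergence (n := n) f Z) := by
  refine contMDiff_of_chart fun φ hφ y hy => ?_
  have h : divergence (n := n) f Z ∘ φ.symm =ᶠ[nhds y] fun z =>
      traceCLM _ (coordPinv (f ∘ φ.symm) z ∘L fderiv ℝ (Z ∘ φ.symm) z) := by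
    filter_upwards [φ.open_target.mem_nhds hy] with z hz
    exact divergence_eq_chart hf hφ hz (differentiableAt_chart hf hZ hφ hz)
  refine ContDiffAt.congr_of_eventuallyEq ?_ h
  have hP := contDiffAt_coordPinv (contDiffAt_immersion hf hφ hy)
    (injective_fderiv_immersion hf hφ hy)
  have hD := contDiffAt_fderiv (contDiffAt_comp_symm le_rfl hφ hy (hZ _))
  exact (traceCLM _).contDiff.contDiffAt.comp y (hP.clm_comp hD)

lemma continuous_divergence {Z : M → E} (hZ : ContMDiff (𝓡 n) 𝓘(ℝ, E) ∞ Z) :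
    Continuous (divergence (n := n) f Z) :=
  (contMDiff_divergence hf hZ).continuous

lemma divergence_congr {Z Z' : M → E} {p : M} (h : Z =ᶠ[nhds p] Z') :
    divergence (n := n) f Z p = divergence (n := n) f Z' p := by
  simp only [divergence, dirDeriv, differential, h.mfderiv_eq]

lemma divergence_zero (p : M) : divergence (n := n) f (fun _ => (0 : E)) p = 0 := by
  obtain ⟨φ, hφ, y, hy, rfl⟩ := exists_chart hf p
  have h1 : DifferentiableAt ℝ ((fun _ : M => (0 : E)) ∘ φ.symm) y := differentiableAt_const _
  have h2 : fderiv ℝ ((fun _ : M => (0 : E)) ∘ φ.symm) y = 0 :=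
    (hasFDerivAt_const (0 : E) y).fderiv
  rw [divergence_eq_chart hf hφ hy h1, h2]
  simp

lemma divergence_eq_zero_of_notMem_tsupport {Z : M → E} {p : M} (hp : p ∉ tsupport Z) :
    divergence (n := n) f Z p = 0 := by
  rw [divergence_congr hf (notMem_tsupport_iff_eventuallyEq.mp hp)]
  exact divergence_zero hf p

lemma divergence_sum {ι : Type*} (s : Finset ι) {Z : ι → M → E}
    (hZ : ∀ i ∈ s, ContMDiff (𝓡 n) 𝓘(ℝ, E) ∞ (Z i)) (p : M) :
    divergence (n := n) f (fun q => ∑ i ∈ s, Z i q) p = ∑ i ∈ s, divergence (n := n) f (Z i) p := by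
  obtain ⟨φ, hφ, y, hy, rfl⟩ := exists_chart hf p
  have hd : ∀ i ∈ s, DifferentiableAt ℝ (Z i ∘ φ.symm) y := fun i hi =>
    differentiableAt_chart hf (hZ i hi) hφ hy
  have hs : DifferentiableAt ℝ ((fun q => ∑ i ∈ s, Z i q) ∘ φ.symm) y :=
    DifferentiableAt.fun_sum hd
  have hsum : fderiv ℝ ((fun q => ∑ i ∈ s, Z i q) ∘ φ.symm) y =
      ∑ i ∈ s, fderiv ℝ (Z i ∘ φ.symm) y := fderiv_fun_sum hd
  simp only [divergence]
  rw [Finset.sum_comm]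
  refine Finset.sum_congr rfl fun j _ => ?_
  rw [dirDeriv_eq_chart hf hφ hy hs, hsum, sum_apply, sum_inner]
  exact Finset.sum_congr rfl fun i hi => by rw [dirDeriv_eq_chart hf hφ hy (hd i hi)]

variable [MeasurableSpace M] [BorelSpace M]

/-- The density is continuous, hence integrable, on a closed coordinate ball. This later makes
compactly supported continuous functions integrable. -/
lemma isLocallyFiniteMeasure_inducedVolume :
    IsLocallyFiniteMeasure (inducedVolume (n := n) f) := by
  refine ⟨fun p => ?_⟩
  obtain ⟨φ, hφ, y, hy, rfl⟩ := exists_chart hf p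
  obtain ⟨r, hr, hball⟩ := Metric.nhds_basis_closedBall.mem_iff.mp (φ.open_target.mem_nhds hy)
  have hD : IsOpen (φ.source ∩ φ ⁻¹' Metric.ball y r) :=
    φ.isOpen_inter_preimage Metric.isOpen_ball
  refine ⟨φ.source ∩ φ ⁻¹' Metric.ball y r, hD.mem_nhds
    ⟨φ.map_target hy, by simp [φ.right_inv hy, hr]⟩, ?_⟩
  have h1 : IntegrableOn (fun _ : M => (1 : ℝ)) (φ.source ∩ φ ⁻¹' Metric.ball y r)
      (inducedVolume (n := n) f) := by
    rw [integrableOn_chart (hf.1.of_le (by norm_cast)) hφ hD.measurableSet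
      Set.inter_subset_left continuousOn_const]
    have hcomp : IntegrableOn (fun z => volumeDensity (f ∘ φ.symm) z * 1)
        (Metric.closedBall y r) volume := by
      refine ContinuousOn.integrableOn_compact (isCompact_closedBall y r) fun z hz => ?_
      exact ((contDiffAt_volumeDensity hf hφ (hball hz)).continuousAt.mul
        continuousAt_const).continuousWithinAt
    refine hcomp.mono_set ?_
    rintro z ⟨hz, hz2⟩
    have := hz2.2
    simp only [Set.mem_preimage, φ.right_inv hz] at this
    exact Metric.ball_subset_closedBall this
  simpa using (integrableOn_const_iff (by simp)).mp h1

/-- In the chart the integrand is the Euclidean divergence of `√g Z^i`. Extended by zero, this is a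
compactly supported `C¹` field on all of `ℝⁿ`. -/
lemma integral_divergence_chart (hφ : φ ∈ atlas (EuclideanSpace ℝ (Fin n)) M) {Z : M → E}
    (hZ : ContMDiff (𝓡 n) 𝓘(ℝ, E) ∞ Z) (hc : HasCompactSupport Z) (hs : tsupport Z ⊆ φ.source)
    (ht : ∀ q, tanProj (n := n) f q (Z q) = Z q) :
    ∫ p, divergence (n := n) f Z p ∂(inducedVolume (n := n) f) = 0 := by
  have h0 : ∀ p ∉ φ.source, divergence (n := n) f Z p = 0 := fun p hp =>
    divergence_eq_zero_of_notMem_tsupport hf fun h => hp (hs h)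
  rw [← setIntegral_eq_integral_of_forall_compl_eq_zero h0,
    setIntegral_chart (hf.1.of_le (by norm_cast)) hφ φ.open_source.measurableSet subset_rfl
      (continuous_divergence hf hZ).continuousOn]
  have htar : φ.target ∩ φ.symm ⁻¹' φ.source = φ.target :=
    Set.inter_eq_left.mpr fun y hy => φ.map_target hy
  rw [htar]
  set η₀ : EuclideanSpace ℝ (Fin n) → EuclideanSpace ℝ (Fin n) := fun z =>
    volumeDensity (f ∘ φ.symm) z • coordPinv (f ∘ φ.symm) z (Z (φ.symm z)) with hη₀
  set η := φ.target.indicator η₀ with hη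
  set K := φ '' tsupport Z with hK
  have hKc : IsCompact K := hc.isCompact.image_of_continuousOn (φ.continuousOn.mono hs)
  have hzero : ∀ z ∉ K, η z = 0 := fun z hz => by
    by_cases hzt : z ∈ φ.target
    · rw [hη, Set.indicator_of_mem hzt]
      have : Z (φ.symm z) = 0 := image_eq_zero_of_notMem_tsupport fun h =>
        hz ⟨_, h, φ.right_inv hzt⟩
      simp [hη₀, this]
    · exact Set.indicator_of_notMem hzt _
  have heq : ∀ y ∈ φ.target, η =ᶠ[nhds y] η₀ := fun y hy => by
    filter_upwards [φ.open_target.mem_nhds hy] with z hz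
    exact Set.indicator_of_mem hz _
  have hηc : HasCompactSupport η := HasCompactSupport.intro hKc hzero
  have hηd : ContDiff ℝ 1 η := contDiff_iff_contDiffAt.mpr fun y => by
    by_cases hy : y ∈ φ.target
    · refine ContDiffAt.congr_of_eventuallyEq ?_ (heq y hy)
      have hx := contDiffAt_immersion hf hφ hy
      have hi := injective_fderiv_immersion hf hφ hy
      exact ((contDiffAt_volumeDensity hf hφ hy).smul ((contDiffAt_coordPinv hx hi).clm_apply
        (contDiffAt_comp_symm le_rfl hφ hy (hZ _)))).of_le (by norm_cast)
    -- The coordinate image `K` of the support is compact, hence closed, so the extension vanishes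
    -- near every point outside the chart target.
    · have hyK : y ∉ K := fun ⟨q, hq, h⟩ => hy (h ▸ φ.map_source (hs hq))
      have : η =ᶠ[nhds y] fun _ => 0 := by
        filter_upwards [hKc.isClosed.isOpen_compl.mem_nhds hyK] with z hz using hzero z hz
      exact contDiffAt_const.congr_of_eventuallyEq this
  have h1 : ∀ y ∉ φ.target, traceCLM _ (fderiv ℝ η y) = 0 := fun y hy => by
    have hyK : y ∉ K := fun ⟨q, hq, h⟩ => hy (h ▸ φ.map_source (hs hq))
    have : η =ᶠ[nhds y] fun _ => 0 := by
      filter_upwards [hKc.isClosed.isOpen_compl.mem_nhds hyK] with z hz using hzero z hz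
    rw [this.fderiv_eq, fderiv_fun_const]
    simp
  rw [← integral_traceCLM_fderiv_eq_zero volume hηd hηc,
    ← setIntegral_eq_integral_of_forall_compl_eq_zero h1]
  refine setIntegral_congr_fun φ.open_target.measurableSet fun y hy => ?_
  beta_reduce
  rw [(heq y hy).fderiv_eq]
  exact volumeDensity_mul_divergence hf hφ hy (differentiableAt_chart hf hZ hφ hy) ht

lemma integrable_divergence {Z : M → E} (hZ : ContMDiff (𝓡 n) 𝓘(ℝ, E) ∞ Z)
    (hc : HasCompactSupport Z) :
    Integrable (divergence (n := n) f Z) (inducedVolume (n := n) f) := by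
  have := isLocallyFiniteMeasure_inducedVolume hf
  have : IsFiniteMeasureOnCompacts (inducedVolume (n := n) f) :=
    isFiniteMeasureOnCompacts_of_isLocallyFiniteMeasure
  refine (continuous_divergence hf hZ).integrable_of_hasCompactSupport ?_
  refine hc.mono' fun p hp => ?_
  by_contra h
  exact hp (divergence_eq_zero_of_notMem_tsupport hf h)

/-- The divergence theorem for compactly supported tangent vector fields of an immersion. -/
theorem integral_divergence_eq_zero [T2Space M] [SecondCountableTopology M] {Z : M → E}
    (hZ : ContMDiff (𝓡 n) 𝓘(ℝ, E) ∞ Z) (hc : HasCompactSupport Z)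
    (ht : ∀ q, tanProj (n := n) f q (Z q) = Z q) :
    ∫ p, divergence (n := n) f Z p ∂(inducedVolume (n := n) f) = 0 := by
  have : LocallyCompactSpace M := ChartedSpace.locallyCompactSpace (EuclideanSpace ℝ (Fin n)) M
  obtain ⟨ρ, hρ⟩ := SmoothPartitionOfUnity.exists_isSubordinate (𝓡 n) (s := (Set.univ : Set M))
    isClosed_univ (fun x : M => (chartAt (EuclideanSpace ℝ (Fin n)) x).source)
    (fun x => (chartAt (EuclideanSpace ℝ (Fin n)) x).open_source)
    (fun x _ => Set.mem_iUnion.mpr ⟨x, mem_chart_source _ x⟩)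
  -- Local finiteness leaves only finitely many cut-offs meeting the compact support, so `Z` is a
  -- finite sum of fields each supported in one chart.
  have hfin := ρ.locallyFinite.finite_nonempty_inter_compact hc.isCompact
  set s := hfin.toFinset
  have hsum : Z = fun q => ∑ i ∈ s, ρ i q • Z q := by
    funext q
    by_cases hq : q ∈ tsupport Z
    · rw [← Finset.sum_smul]
      have h1 : ∑ i ∈ s, ρ i q = 1 := by
        rw [← ρ.sum_eq_one (Set.mem_univ q)]
        refine (finsum_eq_sum_of_support_subset _ fun i hi => ?_).symm
        simp only [s, Set.Finite.coe_toFinset, Set.mem_ofPred_eq]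
        exact ⟨q, hi, hq⟩
      rw [h1, one_smul]
    · simp [image_eq_zero_of_notMem_tsupport hq]
  have hρZ : ∀ i, ContMDiff (𝓡 n) 𝓘(ℝ, E) ∞ (fun q => ρ i q • Z q) := fun i =>
    (ρ i).contMDiff.smul hZ
  have hρc : ∀ i, HasCompactSupport (fun q => ρ i q • Z q) := fun i =>
    hc.mono fun q hq => by
      contrapose! hq
      simp only [Function.mem_support, ne_eq, not_not] at hq ⊢
      rw [hq, smul_zero]
  have hdiv : divergence (n := n) f Z =
      fun p => ∑ i ∈ s, divergence (n := n) f (fun q => ρ i q • Z q) p := by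
    funext p
    conv_lhs => rw [hsum]
    exact divergence_sum hf s (fun i _ => hρZ i) p
  rw [hdiv, integral_finsetSum _ fun i _ => integrable_divergence hf (hρZ i) (hρc i)]
  refine Finset.sum_eq_zero fun i _ => ?_
  refine integral_divergence_chart hf (chart_mem_atlas _ i) (hρZ i) (hρc i)
    ((tsupport_smul_subset_left (ρ i) Z).trans (hρ i)) fun q => ?_
  rw [map_smul, ht]

end DivergenceTheorem

/-! ### The area density along a variation -/

section AreaDensity

open ContinuousLinearMap MeasureTheory

/-! ### Time and space derivatives of a family, and differentiation under the integral sign. -/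

section Derivatives

variable {G F : Type*} [NormedAddCommGroup G] [NormedSpace ℝ G]
  [NormedAddCommGroup F] [NormedSpace ℝ F]

/-- The derivative in the first variable. -/
def timeDeriv (g : ℝ × G → F) (z : ℝ × G) : F := fderiv ℝ g z (1, 0)

/-- The differential in the second variable. -/
def spaceDeriv (g : ℝ × G → F) (z : ℝ × G) : G →L[ℝ] F := fderiv ℝ g z ∘L inr ℝ ℝ G

variable {g : ℝ × G → F} {s : ℝ} {y : G}

lemma contDiffAt_timeDeriv {z : ℝ × G} (hg : ContDiffAt ℝ ∞ g z) :
    ContDiffAt ℝ ∞ (timeDeriv g) z :=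
  (hg.fderiv_right (by simp)).clm_apply contDiffAt_const

lemma contDiffAt_spaceDeriv {z : ℝ × G} (hg : ContDiffAt ℝ ∞ g z) :
    ContDiffAt ℝ ∞ (spaceDeriv g) z :=
  (hg.fderiv_right (by simp)).clm_comp contDiffAt_const

lemma hasDerivAt_timeDeriv (hg : DifferentiableAt ℝ g (s, y)) :
    HasDerivAt (fun r => g (r, y)) (timeDeriv g (s, y)) s :=
  hg.hasFDerivAt.comp_hasDerivAt s ((hasDerivAt_id s).prodMk (hasDerivAt_const s y))

lemma hasFDerivAt_spaceDeriv (hg : DifferentiableAt ℝ g (s, y)) :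
    HasFDerivAt (fun z => g (s, z)) (spaceDeriv g (s, y)) y :=
  hg.hasFDerivAt.comp y (hasFDerivAt_prodMk_right s y)

/-- Time and space derivatives commute. -/
lemma hasDerivAt_spaceDeriv (hg : ContDiffAt ℝ ∞ g (s, y)) :
    HasDerivAt (fun r => spaceDeriv g (r, y)) (spaceDeriv (timeDeriv g) (s, y)) s := by
  have hd : HasFDerivAt (fderiv ℝ g) (fderiv ℝ (fderiv ℝ g) (s, y)) (s, y) :=
    ((hg.fderiv_right (m := ∞) (by simp)).differentiableAt (by simp)).hasFDerivAt
  have h1 : HasDerivAt (fun r => fderiv ℝ g (r, y)) (fderiv ℝ (fderiv ℝ g) (s, y) (1, 0)) s :=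
    hd.comp_hasDerivAt s ((hasDerivAt_id s).prodMk (hasDerivAt_const s y))
  have h2 := h1.clm_comp (hasDerivAt_const s (inr ℝ ℝ G))
  refine h2.congr_deriv ?_
  have h3 : HasFDerivAt (timeDeriv g)
      ((ContinuousLinearMap.apply ℝ F ((1, 0) : ℝ × G)).comp (fderiv ℝ (fderiv ℝ g) (s, y)))
      (s, y) := (ContinuousLinearMap.apply ℝ F ((1, 0) : ℝ × G)).hasFDerivAt.comp _ hd
  ext1 η
  simp only [spaceDeriv, h3.fderiv, comp_apply, comp_zero, add_zero, apply_apply]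
  exact (hg.isSymmSndFDerivAt (by simp; norm_cast)) _ _

variable [MeasurableSpace G] [BorelSpace G] {μ : Measure G} [IsFiniteMeasureOnCompacts μ]

/-- Differentiation under the integral sign over a subset of a compact set. -/
lemma hasDerivAt_setIntegral {g : ℝ × G → ℝ} {C A : Set G} (hC : IsCompact C) (hAC : A ⊆ C)
    (hA : MeasurableSet A) {δ : ℝ}
    (hg : ∀ s ∈ Set.Icc (-δ) δ, ∀ y ∈ C, ContDiffAt ℝ 1 g (s, y)) (hs : s ∈ Set.Ioo (-δ) δ) :
    HasDerivAt (fun r => ∫ y in A, g (r, y) ∂μ) (∫ y in A, timeDeriv g (s, y) ∂μ) s := by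
  have hcont : ∀ r ∈ Set.Icc (-δ) δ, ContinuousOn (fun y => g (r, y)) C := fun r hr y hy =>
    ((hg r hr y hy).continuousAt.comp
      (Continuous.prodMk_right r).continuousAt).continuousWithinAt
  have hcont' : ContinuousOn (timeDeriv g) (Set.Icc (-δ) δ ×ˢ C) := fun z hz =>
    (((hg z.1 hz.1 z.2 hz.2).fderiv_right (m := 0) (by norm_num)).continuousAt.clm_apply
      continuousAt_const).continuousWithinAt
  -- The closed time interval makes the product compact, so a constant bounds the time derivative;
  -- it is an admissible majorant because `A` has finite measure.
  obtain ⟨b, hb⟩ := (isCompact_Icc.prod hC).exists_bound_of_continuousOn hcont'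
  have hAfin : μ A < ⊤ := (measure_mono hAC).trans_lt hC.measure_lt_top
  have hint : ∀ r ∈ Set.Icc (-δ) δ, IntegrableOn (fun y => g (r, y)) A μ := fun r hr =>
    ((hcont r hr).integrableOn_compact hC).mono_set hAC
  have hint' : IntegrableOn (fun y => timeDeriv g (s, y)) A μ := by
    refine (ContinuousOn.integrableOn_compact hC ?_).mono_set hAC
    exact hcont'.comp (Continuous.prodMk_right s).continuousOn
      fun y hy => ⟨Set.Ioo_subset_Icc_self hs, hy⟩
  have hnhds : Set.Ioo (-δ) δ ∈ nhds s := isOpen_Ioo.mem_nhds hs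
  refine (hasDerivAt_integral_of_dominated_loc_of_deriv_le (μ := μ.restrict A)
    (F := fun r y => g (r, y)) (F' := fun r y => timeDeriv g (r, y)) (bound := fun _ => b)
    hnhds ?_ (hint s (Set.Ioo_subset_Icc_self hs)) hint'.aestronglyMeasurable ?_ ?_ ?_).2
  · filter_upwards [hnhds] with r hr
    exact (hint r (Set.Ioo_subset_Icc_self hr)).aestronglyMeasurable
  · refine (ae_restrict_iff' hA).mpr (Filter.Eventually.of_forall fun y hy r hr => ?_)
    exact hb (r, y) ⟨Set.Ioo_subset_Icc_self hr, hAC hy⟩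
  · exact (integrableOn_const_iff (by simp)).mpr (Or.inr hAfin)
  · refine (ae_restrict_iff' hA).mpr (Filter.Eventually.of_forall fun y hy r hr => ?_)
    exact hasDerivAt_timeDeriv
      ((hg r (Set.Ioo_subset_Icc_self hr) y (hAC hy)).differentiableAt (by simp))

end Derivatives

variable {G E : Type*} [NormedAddCommGroup G] [InnerProductSpace ℝ G] [FiniteDimensional ℝ G]
  [NormedAddCommGroup E] [InnerProductSpace ℝ E] [FiniteDimensional ℝ E]

/-- The weighted area density of a family of parametrizations `x`. -/
def areaDensity (T : E) (x : ℝ × G → E) (z : ℝ × G) : ℝ :=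
  Real.exp (inner ℝ T (x z)) * (spaceDeriv x z).toLinearMap.normDet

/-- The logarithmic time derivative of the area density. -/
def areaRate (T : E) (x : ℝ × G → E) (z : ℝ × G) : ℝ :=
  inner ℝ T (timeDeriv x z) + traceCLM G (pinv (spaceDeriv x z) ∘L spaceDeriv (timeDeriv x) z)

variable {T : E} {x : ℝ × G → E} {s : ℝ} {y : G}

lemma contDiffAt_areaDensity {z : ℝ × G} (hx : ContDiffAt ℝ ∞ x z)
    (hi : Function.Injective (spaceDeriv x z)) : ContDiffAt ℝ ∞ (areaDensity T x) z :=
  (ContDiffAt.inner ℝ contDiffAt_const hx).exp.mul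
    ((contDiffAt_normDet hi).comp z (contDiffAt_spaceDeriv hx))

lemma timeDeriv_areaDensity (hx : ContDiffAt ℝ ∞ x (s, y))
    (hi : Function.Injective (spaceDeriv x (s, y))) :
    timeDeriv (areaDensity T x) (s, y) = areaDensity T x (s, y) * areaRate T x (s, y) := by
  have h1 := hasDerivAt_timeDeriv ((contDiffAt_areaDensity (T := T) hx hi).differentiableAt
    (by simp))
  have h2 := (((hasDerivAt_const s T).inner ℝ
    (hasDerivAt_timeDeriv (hx.differentiableAt (by simp)))).exp).mul
    (hasDerivAt_normDet (L := fun r => spaceDeriv x (r, y)) hi (hasDerivAt_spaceDeriv hx))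
  rw [h1.unique h2, areaDensity, areaRate]
  simp only [inner_zero_left, add_zero]
  ring

/-- The second time derivative of the area density. -/
lemma timeDeriv_timeDeriv_areaDensity (hx : ∀ᶠ z in nhds (s, y), ContDiffAt ℝ ∞ x z)
    (hi : Function.Injective (spaceDeriv x (s, y))) :
    timeDeriv (timeDeriv (areaDensity T x)) (s, y) = areaDensity T x (s, y) *
      (areaRate T x (s, y) ^ 2 + (inner ℝ T (timeDeriv (timeDeriv x) (s, y)) +
        traceCLM G (pinv (spaceDeriv x (s, y)) ∘L spaceDeriv (timeDeriv (timeDeriv x)) (s, y))) +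
        traceCLM G ((pinv (spaceDeriv x (s, y)) ∘L adjoint (pinv (spaceDeriv x (s, y))) ∘L
          adjoint (spaceDeriv (timeDeriv x) (s, y)) ∘L
            (1 - spaceDeriv x (s, y) ∘L pinv (spaceDeriv x (s, y)))
          - pinv (spaceDeriv x (s, y)) ∘L spaceDeriv (timeDeriv x) (s, y) ∘L
            pinv (spaceDeriv x (s, y))) ∘L spaceDeriv (timeDeriv x) (s, y))) := by
  have hx0 := hx.self_of_nhds
  have hcurve : Filter.Tendsto (fun r : ℝ => (r, y)) (nhds s) (nhds (s, y)) :=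
    (Continuous.prodMk_left y).continuousAt
  have hinj : ∀ᶠ z in nhds (s, y), Function.Injective (spaceDeriv x z) :=
    (contDiffAt_spaceDeriv hx0).continuousAt.eventually (eventually_injective hi)
  have h1 := hasDerivAt_timeDeriv ((contDiffAt_timeDeriv
    (contDiffAt_areaDensity (T := T) hx0 hi)).differentiableAt (by simp))
  -- Injectivity is an open condition, so the first-derivative formula holds for all nearby times
  -- and can be differentiated again: the result is the density times `rate² + rate'`.
  have h2 : (fun r => timeDeriv (areaDensity T x) (r, y)) =ᶠ[nhds s]
      fun r => areaDensity T x (r, y) * areaRate T x (r, y) := by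
    filter_upwards [hcurve.eventually hx, hcurve.eventually hinj] with r hr hr'
    exact timeDeriv_areaDensity hr hr'
  have h3 := hasDerivAt_timeDeriv ((contDiffAt_areaDensity (T := T) hx0 hi).differentiableAt
    (by simp))
  have hv := contDiffAt_timeDeriv hx0
  have hcomp := (hasDerivAt_pinv (L := fun r => spaceDeriv x (r, y)) hi
    (hasDerivAt_spaceDeriv hx0)).clm_comp (hasDerivAt_spaceDeriv hv)
  have h4 : HasDerivAt (fun r => areaRate T x (r, y)) _ s :=
    ((hasDerivAt_const s T).inner ℝ (hasDerivAt_timeDeriv (hv.differentiableAt (by simp)))).add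
      ((traceCLM G).hasFDerivAt.comp_hasDerivAt s hcomp)
  rw [h1.unique ((h3.mul h4).congr_of_eventuallyEq h2), timeDeriv_areaDensity hx0 hi, map_add]
  simp only [inner_zero_left, add_zero]
  ring

end AreaDensity

/-! ### Variations of an immersion -/

section Variations

open ContinuousLinearMap MeasureTheory

variable {n : ℕ} {E : Type*} [NormedAddCommGroup E] [InnerProductSpace ℝ E]
  [FiniteDimensional ℝ E]
  {M : Type*} [TopologicalSpace M] [ChartedSpace (EuclideanSpace ℝ (Fin n)) M]
  [IsManifold (𝓡 n) ∞ M]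
  {φ : OpenPartialHomeomorph M (EuclideanSpace ℝ (Fin n))} {y : EuclideanSpace ℝ (Fin n)}

/-- A family of maps in the coordinates of a chart. -/
def chartFamily (X : ℝ → M → E) (φ : OpenPartialHomeomorph M (EuclideanSpace ℝ (Fin n)))
    (z : ℝ × EuclideanSpace ℝ (Fin n)) : E := X z.1 (φ.symm z.2)

/-- The acceleration `∂_s ∂_s X` at `s = 0` of a family of maps. -/
def acceleration (X : ℝ → M → E) (p : M) : E := deriv (fun s => deriv (fun r => X r p) s) 0

/-- The trace computing the quadratic part of the second variation. -/
lemma traceCLM_deriv_pinv {f : M → E} (hf : IsSmoothImmersion (n := n) f)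
    (hφ : φ ∈ atlas (EuclideanSpace ℝ (Fin n)) M)
    (hy : y ∈ φ.target) {V : M → E} (hV : DifferentiableAt ℝ (V ∘ φ.symm) y) :
    traceCLM _ ((coordPinv (f ∘ φ.symm) y ∘L adjoint (coordPinv (f ∘ φ.symm) y) ∘L
        adjoint (fderiv ℝ (V ∘ φ.symm) y) ∘L (1 - coordProj (f ∘ φ.symm) y)
        - coordPinv (f ∘ φ.symm) y ∘L fderiv ℝ (V ∘ φ.symm) y ∘L coordPinv (f ∘ φ.symm) y) ∘L
        fderiv ℝ (V ∘ φ.symm) y) =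
      ∑ i, ‖normalConnection (n := n) f V (φ.symm y)
          (tangentBasis (n := n) f (φ.symm y) i : E)‖ ^ 2
      - ∑ i, ∑ j,
        inner ℝ (dirDeriv (n := n) f V (φ.symm y) (tangentBasis (n := n) f (φ.symm y) i : E))
          (tangentBasis (n := n) f (φ.symm y) j : E) *
        inner ℝ (dirDeriv (n := n) f V (φ.symm y) (tangentBasis (n := n) f (φ.symm y) j : E))
          (tangentBasis (n := n) f (φ.symm y) i : E) := by
  have hi := injective_fderiv_immersion hf hφ hy
  have hU := tangentPlane_eq_chart hf hφ hy
  set P := coordPinv (f ∘ φ.symm) y with hP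
  set DV := fderiv ℝ (V ∘ φ.symm) y with hDV
  set e := tangentBasis (n := n) f (φ.symm y)
  have hdir : ∀ w, dirDeriv (n := n) f V (φ.symm y) w = DV (P w) :=
    dirDeriv_eq_chart hf hφ hy hV
  rw [sub_comp, map_sub]
  congr 1
  -- Moving the adjoints across, each summand becomes the squared norm of the normal part of `DV (P
  -- e_i)`, as `1 - Π` is a projection.
  · have h1 := sum_inner_pinv hi hU e
      (adjoint P ∘L adjoint DV ∘L (1 - coordProj (f ∘ φ.symm) y) ∘L DV)
    simp only [← comp_assoc] at h1 ⊢
    rw [show pinv (fderiv ℝ (f ∘ φ.symm) y) = P from rfl] at h1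
    rw [← h1]
    refine Finset.sum_congr rfl fun i _ => ?_
    simp only [comp_apply]
    rw [adjoint_inner_left, adjoint_inner_left, normalConnection, hdir, norProj_eq_chart hf hφ hy,
      ← real_inner_self_eq_norm_sq]
    have hone : (1 : E →L[ℝ] E) (DV (P (e i))) = DV (P (e i)) := rfl
    simp only [sub_apply, hone, inner_sub_left, inner_sub_right]
    rw [inner_coordProj_left hi, inner_coordProj_left hi, coordProj_coordProj hi]
    ring
  -- `P` sees only the tangential part of `DV (P e_i)`; expanding that part in the frame produces
  -- the double sum.
  · have h1 := sum_inner_pinv hi hU e (DV ∘L P ∘L DV)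
    simp only [← comp_assoc] at h1 ⊢
    rw [show pinv (fderiv ℝ (f ∘ φ.symm) y) = P from rfl] at h1
    rw [← h1]
    refine Finset.sum_congr rfl fun i _ => ?_
    simp only [comp_apply, hdir]
    have h2 : P (DV (P (e i))) = ∑ j, inner ℝ (DV (P (e i))) (e j : E) • P (e j) := by
      rw [hP, ← coordPinv_coordProj hi, ← tanProj_eq_chart hf hφ hy, tanProj,
        ← sum_inner_smul_eq_starProjection e, map_sum]
      simp only [map_smul]
    rw [h2, map_sum, sum_inner]
    simp only [map_smul, real_inner_smul_left]

namespace IsNormalVariation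

variable {f : M → E} {X : ℝ → M → E} {V : M → E} {K : Set M} {ε : ℝ}
  (h : IsNormalVariation (n := n) f X V K ε)
include h

lemma zero_mem : (0 : ℝ) ∈ Set.Ioo (-ε) ε := ⟨by linarith [h.pos], h.pos⟩

lemma contMDiffAt {s : ℝ} (hs : s ∈ Set.Ioo (-ε) ε) (p : M) :
    ContMDiffAt ((𝓘(ℝ, ℝ)).prod (𝓡 n)) 𝓘(ℝ, E) ∞ (fun q : ℝ × M => X q.1 q.2) (s, p) :=
  h.smooth.contMDiffAt (prod_mem_nhds (isOpen_Ioo.mem_nhds hs) Filter.univ_mem)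

lemma contMDiff {s : ℝ} (hs : s ∈ Set.Ioo (-ε) ε) : ContMDiff (𝓡 n) 𝓘(ℝ, E) ∞ (X s) := fun p =>
  (h.contMDiffAt hs p).comp p (contMDiffAt_const.prodMk contMDiffAt_id)

lemma contDiffAt_chartFamily (hφ : φ ∈ atlas (EuclideanSpace ℝ (Fin n)) M) {s : ℝ}
    (hs : s ∈ Set.Ioo (-ε) ε) (hy : y ∈ φ.target) :
    ContDiffAt ℝ ∞ (chartFamily X φ) (s, y) := by
  rw [← contMDiffAt_iff_contDiffAt]
  have h1 : ContMDiffAt 𝓘(ℝ, ℝ × EuclideanSpace ℝ (Fin n)) 𝓘(ℝ, ℝ) ∞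
      (fun z : ℝ × EuclideanSpace ℝ (Fin n) => z.1) (s, y) := contDiffAt_fst.contMDiffAt
  have h2 : ContMDiffAt 𝓘(ℝ, ℝ × EuclideanSpace ℝ (Fin n)) (𝓡 n) ∞
      (fun z : ℝ × EuclideanSpace ℝ (Fin n) => φ.symm z.2) (s, y) :=
    ContMDiffAt.comp (s, y) (contMDiffAt_symm hφ hy) contDiffAt_snd.contMDiffAt
  exact ContMDiffAt.comp (s, y) (h.contMDiffAt hs (φ.symm y)) (h1.prodMk h2)

lemma eventually_contDiffAt_chartFamily (hφ : φ ∈ atlas (EuclideanSpace ℝ (Fin n)) M)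
    (hy : y ∈ φ.target) :
    ∀ᶠ z in nhds ((0 : ℝ), y), ContDiffAt ℝ ∞ (chartFamily X φ) z := by
  filter_upwards [prod_mem_nhds (isOpen_Ioo.mem_nhds h.zero_mem) (φ.open_target.mem_nhds hy)]
    with z hz
  exact h.contDiffAt_chartFamily hφ hz.1 hz.2

lemma spaceDeriv_chartFamily (hφ : φ ∈ atlas (EuclideanSpace ℝ (Fin n)) M) {s : ℝ}
    (hs : s ∈ Set.Ioo (-ε) ε) (hy : y ∈ φ.target) :
    spaceDeriv (chartFamily X φ) (s, y) = fderiv ℝ (X s ∘ φ.symm) y :=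
  (hasFDerivAt_spaceDeriv ((h.contDiffAt_chartFamily hφ hs hy).differentiableAt
    (by simp))).fderiv.symm

lemma areaDensity_chartFamily (hφ : φ ∈ atlas (EuclideanSpace ℝ (Fin n)) M) {s : ℝ}
    (hs : s ∈ Set.Ioo (-ε) ε) (hy : y ∈ φ.target) (T : E) :
    areaDensity T (chartFamily X φ) (s, y) =
      volumeDensity (X s ∘ φ.symm) y * Real.exp (inner ℝ T (X s (φ.symm y))) := by
  rw [areaDensity, h.spaceDeriv_chartFamily hφ hs hy, volumeDensity_eq_normDet, mul_comm]
  rfl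

lemma timeDeriv_chartFamily (hφ : φ ∈ atlas (EuclideanSpace ℝ (Fin n)) M) (hy : y ∈ φ.target) :
    timeDeriv (chartFamily X φ) (0, y) = V (φ.symm y) :=
  (hasDerivAt_timeDeriv ((h.contDiffAt_chartFamily hφ h.zero_mem hy).differentiableAt
    (by simp))).unique (h.field (φ.symm y))

lemma timeDeriv_timeDeriv_chartFamily (hφ : φ ∈ atlas (EuclideanSpace ℝ (Fin n)) M)
    (hy : y ∈ φ.target) :
    timeDeriv (timeDeriv (chartFamily X φ)) (0, y) = acceleration X (φ.symm y) := by
  have h1 := hasDerivAt_timeDeriv ((contDiffAt_timeDeriv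
    (h.contDiffAt_chartFamily hφ h.zero_mem hy)).differentiableAt (by simp))
  rw [acceleration, ← h1.deriv]
  refine Filter.EventuallyEq.deriv_eq ?_
  filter_upwards [isOpen_Ioo.mem_nhds h.zero_mem] with s hs
  exact (hasDerivAt_timeDeriv ((h.contDiffAt_chartFamily hφ hs hy).differentiableAt
    (by simp))).deriv.symm

/-- `IsNormalVariation` prescribes `V` only as a pointwise derivative; smoothness comes from the
joint smoothness of the family. -/
lemma contMDiff_field : ContMDiff (𝓡 n) 𝓘(ℝ, E) ∞ V := by
  refine contMDiff_of_chart fun φ hφ y hy => ?_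
  have h1 : ContDiffAt ℝ ∞ (fun z => timeDeriv (chartFamily X φ) (0, z)) y :=
    (contDiffAt_timeDeriv (h.contDiffAt_chartFamily hφ h.zero_mem hy)).comp y
      (contDiffAt_const.prodMk contDiffAt_id)
  refine h1.congr_of_eventuallyEq ?_
  filter_upwards [φ.open_target.mem_nhds hy] with z hz
  exact (h.timeDeriv_chartFamily hφ hz).symm

lemma contMDiff_acceleration : ContMDiff (𝓡 n) 𝓘(ℝ, E) ∞ (acceleration X) := by
  refine contMDiff_of_chart fun φ hφ y hy => ?_
  have h1 : ContDiffAt ℝ ∞ (fun z => timeDeriv (timeDeriv (chartFamily X φ)) (0, z)) y :=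
    (contDiffAt_timeDeriv (contDiffAt_timeDeriv
      (h.contDiffAt_chartFamily hφ h.zero_mem hy))).comp y (contDiffAt_const.prodMk contDiffAt_id)
  refine h1.congr_of_eventuallyEq ?_
  filter_upwards [φ.open_target.mem_nhds hy] with z hz
  exact (h.timeDeriv_timeDeriv_chartFamily hφ hz).symm

lemma spaceDeriv_timeDeriv_chartFamily (hφ : φ ∈ atlas (EuclideanSpace ℝ (Fin n)) M)
    (hy : y ∈ φ.target) :
    spaceDeriv (timeDeriv (chartFamily X φ)) (0, y) = fderiv ℝ (V ∘ φ.symm) y := by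
  have h1 := hasFDerivAt_spaceDeriv ((contDiffAt_timeDeriv
    (h.contDiffAt_chartFamily hφ h.zero_mem hy)).differentiableAt (by simp))
  rw [← h1.fderiv]
  refine Filter.EventuallyEq.fderiv_eq ?_
  filter_upwards [φ.open_target.mem_nhds hy] with z hz using h.timeDeriv_chartFamily hφ hz

lemma spaceDeriv_timeDeriv_timeDeriv_chartFamily (hφ : φ ∈ atlas (EuclideanSpace ℝ (Fin n)) M)
    (hy : y ∈ φ.target) :
    spaceDeriv (timeDeriv (timeDeriv (chartFamily X φ))) (0, y) =
      fderiv ℝ (acceleration X ∘ φ.symm) y := by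
  have h1 := hasFDerivAt_spaceDeriv ((contDiffAt_timeDeriv (contDiffAt_timeDeriv
    (h.contDiffAt_chartFamily hφ h.zero_mem hy))).differentiableAt (by simp))
  rw [← h1.fderiv]
  refine Filter.EventuallyEq.fderiv_eq ?_
  filter_upwards [φ.open_target.mem_nhds hy] with z hz
  exact h.timeDeriv_timeDeriv_chartFamily hφ hz

lemma eventually_eq_of_notMem {p : M} (hp : p ∉ K) :
    (fun s => X s p) =ᶠ[nhds 0] fun _ => f p := by
  filter_upwards [isOpen_Ioo.mem_nhds h.zero_mem] with s hs using h.fixed s hs p hp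

lemma field_eq_zero {p : M} (hp : p ∉ K) : V p = 0 :=
  (h.field p).unique ((hasDerivAt_const 0 (f p)).congr_of_eventuallyEq
    (h.eventually_eq_of_notMem hp))

lemma acceleration_eq_zero {p : M} (hp : p ∉ K) : acceleration X p = 0 := by
  have h1 : (fun s => deriv (fun r => X r p) s) =ᶠ[nhds 0] fun _ => 0 := by
    filter_upwards [(h.eventually_eq_of_notMem hp).eventuallyEq_nhds] with s hs
    rw [hs.deriv_eq, deriv_const]
  rw [acceleration, h1.deriv_eq, deriv_const]

variable (hf : IsSmoothImmersion (n := n) f)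
include hf

lemma injective_spaceDeriv (hφ : φ ∈ atlas (EuclideanSpace ℝ (Fin n)) M) (hy : y ∈ φ.target) :
    Function.Injective (spaceDeriv (chartFamily X φ) (0, y)) := by
  rw [h.spaceDeriv_chartFamily hφ h.zero_mem hy, h.initial]
  exact injective_fderiv_immersion hf hφ hy

lemma areaDensity_zero (hφ : φ ∈ atlas (EuclideanSpace ℝ (Fin n)) M) (hy : y ∈ φ.target)
    (T : E) : areaDensity T (chartFamily X φ) (0, y) =
      volumeDensity (f ∘ φ.symm) y * Real.exp (inner ℝ T (f (φ.symm y))) := by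
  rw [h.areaDensity_chartFamily hφ h.zero_mem hy, h.initial]

lemma areaRate_zero (hφ : φ ∈ atlas (EuclideanSpace ℝ (Fin n)) M) (hy : y ∈ φ.target)
    (T : E) : areaRate T (chartFamily X φ) (0, y) =
      inner ℝ T (V (φ.symm y)) + divergence (n := n) f V (φ.symm y) := by
  rw [areaRate, h.timeDeriv_chartFamily hφ hy, h.spaceDeriv_timeDeriv_chartFamily hφ hy,
    h.spaceDeriv_chartFamily hφ h.zero_mem hy, h.initial,
    divergence_eq_chart hf hφ hy (differentiableAt_chart hf h.contMDiff_field hφ hy)]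
  rfl

lemma timeDeriv_areaDensity_zero (hφ : φ ∈ atlas (EuclideanSpace ℝ (Fin n)) M)
    (hy : y ∈ φ.target) (T : E) :
    timeDeriv (areaDensity T (chartFamily X φ)) (0, y) =
      volumeDensity (f ∘ φ.symm) y * firstVariationDensity (n := n) T f V (φ.symm y) := by
  rw [timeDeriv_areaDensity (h.contDiffAt_chartFamily hφ h.zero_mem hy)
    (h.injective_spaceDeriv hf hφ hy), h.areaDensity_zero hf hφ hy, h.areaRate_zero hf hφ hy,
    firstVariationDensity, mul_assoc]

lemma timeDeriv_timeDeriv_areaDensity_zero (hφ : φ ∈ atlas (EuclideanSpace ℝ (Fin n)) M)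
    (hy : y ∈ φ.target) (T : E) :
    timeDeriv (timeDeriv (areaDensity T (chartFamily X φ))) (0, y) =
      volumeDensity (f ∘ φ.symm) y *
        secondVariationDensity (n := n) T f V (acceleration X) (φ.symm y) := by
  rw [timeDeriv_timeDeriv_areaDensity (h.eventually_contDiffAt_chartFamily hφ hy)
    (h.injective_spaceDeriv hf hφ hy), h.areaDensity_zero hf hφ hy, h.areaRate_zero hf hφ hy,
    h.timeDeriv_timeDeriv_chartFamily hφ hy, h.spaceDeriv_timeDeriv_chartFamily hφ hy,
    h.spaceDeriv_timeDeriv_timeDeriv_chartFamily hφ hy,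
    h.spaceDeriv_chartFamily hφ h.zero_mem hy, h.initial, secondVariationDensity,
    divergence_eq_chart hf hφ hy (Z := acceleration X)
      (differentiableAt_chart hf h.contMDiff_acceleration hφ hy),
    ← traceCLM_deriv_pinv hf hφ hy (differentiableAt_chart hf h.contMDiff_field hφ hy), mul_assoc]
  rfl

end IsNormalVariation

/-! ### Differentiating the weighted area -/

section Differentiation

variable [MeasurableSpace M] [BorelSpace M]

/-- On `D`, the weighted area of the variation is twice differentiable at `s = 0`, with the
expected derivatives. -/
structure HasVariations (T : E) (f : M → E) (X : ℝ → M → E) (V : M → E) (D : Set M) : Prop where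
  integrable : ∀ᶠ s in nhds (0 : ℝ), IntegrableOn (fun x => Real.exp (inner ℝ T (X s x))) D
    (inducedVolume (n := n) (X s))
  integrable_first : IntegrableOn (firstVariationDensity (n := n) T f V) D
    (inducedVolume (n := n) f)
  integrable_second : IntegrableOn (secondVariationDensity (n := n) T f V (acceleration X)) D
    (inducedVolume (n := n) f)
  differentiable : ∀ᶠ s in nhds (0 : ℝ),
    DifferentiableAt ℝ (fun r => weightedArea (n := n) T (X r) D) s
  first : HasDerivAt (fun r => weightedArea (n := n) T (X r) D)
    (∫ x in D, firstVariationDensity (n := n) T f V x ∂(inducedVolume (n := n) f)) 0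
  second : HasDerivAt (deriv fun r => weightedArea (n := n) T (X r) D)
    (∫ x in D, secondVariationDensity (n := n) T f V (acceleration X) x
      ∂(inducedVolume (n := n) f)) 0

variable {T : E} {f : M → E} {X : ℝ → M → E} {V : M → E} {K D D' : Set M} {ε : ℝ}

omit [IsManifold (𝓡 n) ∞ M] [BorelSpace M] in
lemma hasVariations_empty : HasVariations (n := n) T f X V ∅ where
  integrable := by simp
  integrable_first := by simp
  integrable_second := by simp
  differentiable := by simp [weightedArea]
  first := by simpa [weightedArea] using hasDerivAt_const (0 : ℝ) (0 : ℝ)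
  second := by simpa [weightedArea] using hasDerivAt_const (0 : ℝ) (0 : ℝ)

-- Integrability at nearby times belongs to the structure because the integral of a non-integrable
-- function is zero by convention, and additivity over the domain could otherwise fail.
omit [IsManifold (𝓡 n) ∞ M] [BorelSpace M] in
lemma HasVariations.union (h : HasVariations (n := n) T f X V D)
    (h' : HasVariations (n := n) T f X V D') (hdisj : Disjoint D D') (hD' : MeasurableSet D') :
    HasVariations (n := n) T f X V (D ∪ D') := by
  have heq : (fun r => weightedArea (n := n) T (X r) (D ∪ D')) =ᶠ[nhds 0]
      fun r => weightedArea (n := n) T (X r) D + weightedArea (n := n) T (X r) D' := by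
    filter_upwards [h.integrable, h'.integrable] with s hs hs'
    exact setIntegral_union hdisj hD' hs hs'
  refine ⟨?_, h.integrable_first.union h'.integrable_first,
    h.integrable_second.union h'.integrable_second, ?_, ?_, ?_⟩
  · filter_upwards [h.integrable, h'.integrable] with s hs hs' using hs.union hs'
  · filter_upwards [h.differentiable, h'.differentiable, heq.eventuallyEq_nhds] with s hs hs' he
    exact (hs.add hs').congr_of_eventuallyEq he
  · rw [setIntegral_union hdisj hD' h.integrable_first h'.integrable_first]
    exact (h.first.add h'.first).congr_of_eventuallyEq heq
  · rw [setIntegral_union hdisj hD' h.integrable_second h'.integrable_second]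
    refine (h.second.add h'.second).congr_of_eventuallyEq ?_
    filter_upwards [h.differentiable, h'.differentiable, heq.eventuallyEq_nhds] with s hs hs' he
    rw [he.deriv_eq]
    exact deriv_fun_add hs hs'

lemma IsNormalVariation.continuous_firstVariationDensity
    (h : IsNormalVariation (n := n) f X V K ε) (hf : IsSmoothImmersion (n := n) f) :
    Continuous (firstVariationDensity (n := n) T f V) := by
  have h1 : Continuous (fun p => inner ℝ T (f p)) := continuous_const.inner hf.1.continuous
  have h2 : Continuous (fun p => inner ℝ T (V p)) :=
    continuous_const.inner h.contMDiff_field.continuous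
  exact (Real.continuous_exp.comp h1).mul
    (h2.add (continuous_divergence hf h.contMDiff_field))

/-- The frames in the definition hide continuity. In a chart the density is the second time
derivative of the area density, a smooth function, divided by the positive volume density. -/
lemma IsNormalVariation.continuousOn_secondVariationDensity
    (h : IsNormalVariation (n := n) f X V K ε) (hf : IsSmoothImmersion (n := n) f)
    (hφ : φ ∈ atlas (EuclideanSpace ℝ (Fin n)) M) :
    ContinuousOn (secondVariationDensity (n := n) T f V (acceleration X)) φ.source := by
  refine continuousOn_source_of_comp_symm fun y hy => ContinuousAt.continuousWithinAt ?_
  have h1 : ContinuousAt (fun z => timeDeriv (timeDeriv (areaDensity T (chartFamily X φ))) (0, z) /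
      volumeDensity (f ∘ φ.symm) z) y := by
    refine ContinuousAt.div ?_ (contDiffAt_volumeDensity hf hφ hy).continuousAt
      (volumeDensity_pos hf hφ hy).ne'
    have := (contDiffAt_timeDeriv (contDiffAt_timeDeriv (contDiffAt_areaDensity (T := T)
      (h.contDiffAt_chartFamily hφ h.zero_mem hy) (h.injective_spaceDeriv hf hφ hy)))).continuousAt
    exact this.comp (Continuous.prodMk_right (0 : ℝ)).continuousAt
  refine h1.congr ?_
  filter_upwards [φ.open_target.mem_nhds hy] with z hz
  rw [h.timeDeriv_timeDeriv_areaDensity_zero hf hφ hz, Function.comp_apply,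
    mul_div_cancel_left₀ _ (volumeDensity_pos hf hφ hz).ne']

/-- The weighted area is twice differentiable on small subsets. -/
lemma IsNormalVariation.hasVariations_local (h : IsNormalVariation (n := n) f X V K ε)
    (hf : IsSmoothImmersion (n := n) f) (T : E) (p : M) :
    ∃ S ∈ nhds p, MeasurableSet S ∧ ∀ D ⊆ S, MeasurableSet D →
      HasVariations (n := n) T f X V D := by
  obtain ⟨φ, hφ, y₀, hy₀, rfl⟩ := exists_chart hf p
  set a := areaDensity T (chartFamily X φ) with ha
  have hev : ∀ᶠ z in nhds ((0 : ℝ), y₀), z.1 ∈ Set.Ioo (-ε) ε ∧ z.2 ∈ φ.target ∧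
      ContDiffAt ℝ ∞ a z := by
    have h1 : ∀ᶠ z in nhds ((0 : ℝ), y₀),
        Function.Injective (spaceDeriv (chartFamily X φ) z) :=
      (contDiffAt_spaceDeriv (h.contDiffAt_chartFamily hφ h.zero_mem hy₀)).continuousAt.eventually
        (eventually_injective (h.injective_spaceDeriv hf hφ hy₀))
    filter_upwards [prod_mem_nhds (isOpen_Ioo.mem_nhds h.zero_mem) (φ.open_target.mem_nhds hy₀),
      h1] with z hz hz1
    exact ⟨hz.1, hz.2, contDiffAt_areaDensity (h.contDiffAt_chartFamily hφ hz.1 hz.2) hz1⟩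
  -- One `δ` serves both as the time bound and as the coordinate radius; subsets of the open ball
  -- then have coordinate images inside a compact ball on which the area density is smooth.
  obtain ⟨δ, hδ, hball⟩ := Metric.nhds_basis_closedBall.mem_iff.mp hev
  have hsub : ∀ s ∈ Set.Icc (-δ) δ, ∀ y ∈ Metric.closedBall y₀ δ,
      s ∈ Set.Ioo (-ε) ε ∧ y ∈ φ.target ∧ ContDiffAt ℝ ∞ a (s, y) := fun s hs y hy => by
    have : (s, y) ∈ Metric.closedBall ((0 : ℝ), y₀) δ := by
      rw [← closedBall_prod_same]
      refine ⟨?_, hy⟩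
      rw [Real.closedBall_eq_Icc]
      simpa using hs
    exact hball this
  have h0 : (0 : ℝ) ∈ Set.Icc (-δ) δ := ⟨by linarith, hδ.le⟩
  have h0' : (0 : ℝ) ∈ Set.Ioo (-δ) δ := ⟨by linarith, hδ⟩
  have hS : IsOpen (φ.source ∩ φ ⁻¹' Metric.ball y₀ δ) :=
    φ.isOpen_inter_preimage Metric.isOpen_ball
  refine ⟨φ.source ∩ φ ⁻¹' Metric.ball y₀ δ, hS.mem_nhds
    ⟨φ.map_target hy₀, by simp [φ.right_inv hy₀, hδ]⟩, hS.measurableSet, fun D hD hDm => ?_⟩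
  have hDφ : D ⊆ φ.source := hD.trans Set.inter_subset_left
  set A := φ.target ∩ φ.symm ⁻¹' D with hA
  have hAm : MeasurableSet A := measurableSet_chart_image φ hDm
  have hAball : A ⊆ Metric.closedBall y₀ δ := fun z hz => by
    have := (hD hz.2).2
    simp only [Set.mem_preimage, φ.right_inv hz.1] at this
    exact Metric.ball_subset_closedBall this
  have hC := isCompact_closedBall y₀ δ
  have hcts : ∀ {g : ℝ × EuclideanSpace ℝ (Fin n) → ℝ}, (∀ s ∈ Set.Icc (-δ) δ,
      ∀ y ∈ Metric.closedBall y₀ δ, ContDiffAt ℝ ∞ g (s, y)) → ∀ s ∈ Set.Icc (-δ) δ,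
      IntegrableOn (fun y => g (s, y)) A := fun hg s hs => by
    refine (ContinuousOn.integrableOn_compact hC fun y hy => ?_).mono_set hAball
    exact ((hg s hs y hy).continuousAt.comp
      (Continuous.prodMk_right s).continuousAt).continuousWithinAt
  have ha0 : ∀ s ∈ Set.Icc (-δ) δ, ∀ y ∈ Metric.closedBall y₀ δ, ContDiffAt ℝ ∞ a (s, y) :=
    fun s hs y hy => (hsub s hs y hy).2.2
  have ha1 : ∀ s ∈ Set.Icc (-δ) δ, ∀ y ∈ Metric.closedBall y₀ δ,
      ContDiffAt ℝ ∞ (timeDeriv a) (s, y) := fun s hs y hy => contDiffAt_timeDeriv (ha0 s hs y hy)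
  have ha2 : ∀ s ∈ Set.Icc (-δ) δ, ∀ y ∈ Metric.closedBall y₀ δ,
      ContDiffAt ℝ ∞ (timeDeriv (timeDeriv a)) (s, y) :=
    fun s hs y hy => contDiffAt_timeDeriv (ha1 s hs y hy)
  have hfu : ContMDiff (𝓡 n) 𝓘(ℝ, E) 1 f := hf.1.of_le (by norm_cast)
  have hXu : ∀ s ∈ Set.Icc (-δ) δ, ContMDiff (𝓡 n) 𝓘(ℝ, E) 1 (X s) := fun s hs =>
    (h.contMDiff (hsub s hs y₀ (Metric.mem_closedBall_self hδ.le)).1).of_le (by norm_cast)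
  have hexp : ∀ s ∈ Set.Icc (-δ) δ,
      ContinuousOn (fun x => Real.exp (inner ℝ T (X s x))) φ.source := fun s hs =>
    (Real.continuous_exp.comp (continuous_const.inner (hXu s hs).continuous)).continuousOn
  have hdens : ∀ s ∈ Set.Icc (-δ) δ, ∀ y ∈ A, a (s, y) =
      volumeDensity (X s ∘ φ.symm) y * Real.exp (inner ℝ T (X s (φ.symm y))) := fun s hs y hy =>
    h.areaDensity_chartFamily hφ (hsub s hs y (hAball hy)).1 hy.1 T
  have harea : ∀ s ∈ Set.Icc (-δ) δ, weightedArea (n := n) T (X s) D = ∫ y in A, a (s, y) :=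
    fun s hs => by
      rw [weightedArea, setIntegral_chart (hXu s hs) hφ hDm hDφ (hexp s hs)]
      exact setIntegral_congr_fun hAm fun y hy => (hdens s hs y hy).symm
  have hd : ∀ s ∈ Set.Ioo (-δ) δ, HasDerivAt (fun r => weightedArea (n := n) T (X r) D)
      (∫ y in A, timeDeriv a (s, y)) s := fun s hs => by
    refine (hasDerivAt_setIntegral hC hAball hAm
      (fun s hs y hy => (ha0 s hs y hy).of_le (by norm_cast)) hs).congr_of_eventuallyEq ?_
    filter_upwards [isOpen_Ioo.mem_nhds hs] with r hr using harea r (Set.Ioo_subset_Icc_self hr)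
  have hd2 : HasDerivAt (deriv fun r => weightedArea (n := n) T (X r) D)
      (∫ y in A, timeDeriv (timeDeriv a) (0, y)) 0 := by
    refine (hasDerivAt_setIntegral hC hAball hAm
      (fun s hs y hy => (ha1 s hs y hy).of_le (by norm_cast)) h0').congr_of_eventuallyEq ?_
    filter_upwards [isOpen_Ioo.mem_nhds h0'] with r hr using (hd r hr).deriv
  have hc1 := (h.continuous_firstVariationDensity (T := T) hf).continuousOn (s := φ.source)
  have hc2 := h.continuousOn_secondVariationDensity (T := T) hf hφ
  refine ⟨?_, ?_, ?_, ?_, ?_, ?_⟩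
  · filter_upwards [isOpen_Ioo.mem_nhds h0'] with s hs
    have hs' := Set.Ioo_subset_Icc_self hs
    rw [integrableOn_chart (hXu s hs') hφ hDm hDφ (hexp s hs')]
    exact (integrableOn_congr_fun (hdens s hs') hAm).mp (hcts ha0 s hs')
  · rw [integrableOn_chart hfu hφ hDm hDφ hc1]
    exact (integrableOn_congr_fun (fun y hy => h.timeDeriv_areaDensity_zero hf hφ hy.1 T) hAm).mp
      (hcts ha1 0 h0)
  · rw [integrableOn_chart hfu hφ hDm hDφ hc2]
    exact (integrableOn_congr_fun
      (fun y hy => h.timeDeriv_timeDeriv_areaDensity_zero hf hφ hy.1 T) hAm).mp (hcts ha2 0 h0)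
  · filter_upwards [isOpen_Ioo.mem_nhds h0'] with s hs using (hd s hs).differentiableAt
  · rw [setIntegral_chart hfu hφ hDm hDφ hc1]
    refine (hd 0 h0').congr_deriv (setIntegral_congr_fun hAm fun y hy => ?_)
    exact h.timeDeriv_areaDensity_zero hf hφ hy.1 T
  · rw [setIntegral_chart hfu hφ hDm hDφ hc2]
    refine hd2.congr_deriv (setIntegral_congr_fun hAm fun y hy => ?_)
    exact h.timeDeriv_timeDeriv_areaDensity_zero hf hφ hy.1 T

/-- Compactness reduces the claim to finitely many small pieces. The induction carries all
measurable subsets of a piece, so that overlapping pieces can be made disjoint by removing one from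
the other. -/
lemma IsNormalVariation.hasVariations [T2Space M] (h : IsNormalVariation (n := n) f X V K ε)
    (hf : IsSmoothImmersion (n := n) f) (T : E) : HasVariations (n := n) T f X V K := by
  have key : ∃ S, K ⊆ S ∧ MeasurableSet S ∧ ∀ D ⊆ S, MeasurableSet D →
      HasVariations (n := n) T f X V D := by
    refine h.compact.induction_on (p := fun B => ∃ S, B ⊆ S ∧ MeasurableSet S ∧ ∀ D ⊆ S,
      MeasurableSet D → HasVariations (n := n) T f X V D) ?_ ?_ ?_ ?_
    · refine ⟨∅, subset_rfl, MeasurableSet.empty, fun D hD _ => ?_⟩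
      rw [Set.subset_empty_iff.mp hD]
      exact hasVariations_empty
    · rintro B B' hBB' ⟨S, hS, hS'⟩
      exact ⟨S, hBB'.trans hS, hS'⟩
    · rintro B B' ⟨S, hBS, hSm, hS⟩ ⟨S', hBS', hSm', hS'⟩
      refine ⟨S ∪ S', Set.union_subset_union hBS hBS', hSm.union hSm', fun D hD hDm => ?_⟩
      have h1 := hS (D ∩ S) Set.inter_subset_right (hDm.inter hSm)
      have h2 := hS' (D \ S) (fun x hx => (hD hx.1).resolve_left hx.2) (hDm.diff hSm)
      have := h1.union h2 Set.disjoint_sdiff_inter.symm (hDm.diff hSm)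
      rwa [Set.inter_union_sdiff] at this
    · intro p _
      obtain ⟨S, hSn, hSm, hS⟩ := h.hasVariations_local hf T p
      exact ⟨S, mem_nhdsWithin_of_mem_nhds hSn, S, subset_rfl, hSm, hS⟩
  obtain ⟨S, hKS, _, hS⟩ := key
  exact hS K hKS h.compact.isClosed.measurableSet

end Differentiation

end Variations

/-! ### Critical points and the second variation -/

section SecondVariation

open ContinuousLinearMap MeasureTheory

variable {n : ℕ} {E : Type*} [NormedAddCommGroup E] [InnerProductSpace ℝ E]
  [FiniteDimensional ℝ E]
  {M : Type*} [TopologicalSpace M] [ChartedSpace (EuclideanSpace ℝ (Fin n)) M]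
  [IsManifold (𝓡 n) ∞ M]

/-! ### Smoothness and normality of the mean curvature vector. -/

section Smoothness

variable {f : M → E} (hf : IsSmoothImmersion (n := n) f)
include hf

lemma contMDiff_tanProj {W : M → E} (hW : ContMDiff (𝓡 n) 𝓘(ℝ, E) ∞ W) :
    ContMDiff (𝓡 n) 𝓘(ℝ, E) ∞ (fun q => tanProj (n := n) f q (W q)) := by
  refine contMDiff_of_chart fun φ hφ y hy => ?_
  refine ((contDiffAt_coordProj (contDiffAt_immersion hf hφ hy)
    (injective_fderiv_immersion hf hφ hy)).clm_apply
    (contDiffAt_comp_symm le_rfl hφ hy (hW _))).congr_of_eventuallyEq ?_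
  filter_upwards [φ.open_target.mem_nhds hy] with z hz
  simp [tanProj_eq_chart hf hφ hz]

/-- This is `divergence_eq_tanProj` for the constant field `w`, which has zero divergence. It
exhibits `H` without pointwise frames, and so gives its smoothness. -/
lemma inner_meanCurvature (p : M) (w : E) :
    inner ℝ (meanCurvature (n := n) f p) w =
      divergence (n := n) f (fun q => tanProj (n := n) f q w) p := by
  obtain ⟨φ, hφ, y, hy, rfl⟩ := exists_chart hf p
  have h1 := divergence_eq_tanProj hf hφ hy (W := fun _ => w) (differentiableAt_const w)
  have h2 : divergence (n := n) f (fun _ : M => w) (φ.symm y) = 0 := by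
    have h3 : fderiv ℝ ((fun _ : M => w) ∘ φ.symm) y = 0 := (hasFDerivAt_const w y).fderiv
    rw [divergence_eq_chart hf hφ hy (Z := fun _ => w) (differentiableAt_const w), h3]
    simp
  linarith

lemma contMDiff_meanCurvature : ContMDiff (𝓡 n) 𝓘(ℝ, E) ∞ (meanCurvature (n := n) f) := by
  have h : meanCurvature (n := n) f = fun p => ∑ k,
      divergence (n := n) f (fun q => tanProj (n := n) f q (stdOrthonormalBasis ℝ E k)) p •
        stdOrthonormalBasis ℝ E k := by
    funext p
    rw [← (stdOrthonormalBasis ℝ E).sum_repr (meanCurvature (n := n) f p)]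
    refine Finset.sum_congr rfl fun k _ => ?_
    rw [(stdOrthonormalBasis ℝ E).repr_apply_apply, real_inner_comm, inner_meanCurvature hf]
  rw [h]
  refine contMDiff_of_chart fun φ hφ y hy => ContDiffAt.sum fun k _ => ?_
  exact (contDiffAt_comp_symm le_rfl hφ hy (contMDiff_divergence hf
    (contMDiff_tanProj hf contMDiff_const) _)).smul contDiffAt_const

lemma meanCurvature_mem_orthogonal (p : M) :
    meanCurvature (n := n) f p ∈ (tangentPlane (n := n) f p)ᗮ :=
  Submodule.sum_mem _ fun _ _ => Submodule.starProjection_apply_mem _ _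

end Smoothness

/-! ### Locality and positivity of the induced volume, criticality, and integration of the second
variation. -/

section Measure

variable [MeasurableSpace M] [BorelSpace M]

/-- The density of an immersion is positive in every chart. This is what lets a vanishing integral
exclude a continuous nonnegative integrand that is positive somewhere. -/
lemma isOpenPosMeasure_inducedVolume {f : M → E} (hf : IsSmoothImmersion (n := n) f) :
    (inducedVolume (n := n) f).IsOpenPosMeasure := by
  refine ⟨fun U hU ⟨p, hp⟩ h0 => ?_⟩
  obtain ⟨φ, hφ, y, hy, rfl⟩ := exists_chart hf p
  have h1 : chartVolume f φ U = 0 :=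
    le_antisymm ((chartVolume_le f hφ U).trans h0.le) zero_le
  rw [chartVolume_apply f φ hU.measurableSet] at h1
  have hA : IsOpen (φ.target ∩ φ.symm ⁻¹' U) := φ.symm.isOpen_inter_preimage hU
  have hpos : 0 < ∫⁻ z in φ.target ∩ φ.symm ⁻¹' U,
      ENNReal.ofReal (volumeDensity (f ∘ φ.symm) z) := by
    rw [setLIntegral_pos_iff (measurable_volumeDensity _).ennreal_ofReal]
    have hs : Function.support (fun z => ENNReal.ofReal (volumeDensity (f ∘ φ.symm) z)) ∩
        (φ.target ∩ φ.symm ⁻¹' U) = φ.target ∩ φ.symm ⁻¹' U :=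
      Set.inter_eq_right.mpr fun z hz =>
        (ENNReal.ofReal_pos.mpr (volumeDensity_pos hf hφ hz.1)).ne'
    rw [hs]
    exact hA.measure_pos volume ⟨y, hy, hp⟩
  exact hpos.ne' h1

/-- The induced volume is local. -/
lemma inducedVolume_restrict_congr {u u' : M → E} {O : Set M} (hO : IsOpen O)
    (h : Set.EqOn u u' O) :
    (inducedVolume (n := n) u).restrict O = (inducedVolume (n := n) u').restrict O := by
  have key : ∀ {u u' : M → E}, Set.EqOn u u' O →
      (inducedVolume (n := n) u).restrict O ≤ (inducedVolume (n := n) u').restrict O := by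
    intro u u' h
    have hOm := hO.measurableSet
    -- As in `inducedVolume_restrict_source`, the supremum is bounded chart by chart: on the open
    -- set `O` the two maps have the same differential, hence the same density.
    have hub : inducedVolume (n := n) u ≤ (inducedVolume (n := n) u').restrict O +
        (inducedVolume (n := n) u).restrict Oᶜ := by
      refine iSup₂_le fun φ hφ => Measure.le_iff.mpr fun S hS => ?_
      rw [← measure_inter_add_sdiff S hOm, Measure.add_apply, Measure.restrict_apply hS,
        Measure.restrict_apply hS]
      refine add_le_add (le_trans (le_of_eq ?_) (chartVolume_le u' hφ _)) (chartVolume_le u hφ _)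
      rw [chartVolume_apply u φ (hS.inter hOm), chartVolume_apply u' φ (hS.inter hOm)]
      refine setLIntegral_congr_fun (measurableSet_chart_image φ (hS.inter hOm)) fun y hy => ?_
      have he : u ∘ φ.symm =ᶠ[nhds y] u' ∘ φ.symm := by
        filter_upwards [(φ.symm.continuousAt hy.1).eventually (hO.mem_nhds hy.2.2)] with z hz
          using h hz
      rw [volumeDensity_eq_normDet, volumeDensity_eq_normDet, he.fderiv_eq]
    refine (Measure.restrict_mono subset_rfl hub).trans ?_
    rw [Measure.restrict_add, Measure.restrict_restrict hOm, Measure.restrict_restrict hOm,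
      Set.inter_self, Set.inter_compl_self, Measure.restrict_empty, add_zero]
  exact le_antisymm (key h) (key h.symm)

variable [T2Space M] {T : E} {f : M → E} {X : ℝ → M → E} {V : M → E} {K : Set M} {ε : ℝ}

/-- Away from `K` the weighted area does not change along the variation. -/
lemma IsNormalVariation.weightedArea_eventuallyEq (h : IsNormalVariation (n := n) f X V K ε)
    (hf : IsSmoothImmersion (n := n) f) {B : Set M} (hB : MeasurableSet B) (hKB : K ⊆ B)
    (hint : IntegrableOn (fun x => Real.exp (inner ℝ T (f x))) B (inducedVolume (n := n) f)) :
    (fun s => weightedArea (n := n) T (X s) B) =ᶠ[nhds 0] fun s =>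
      weightedArea (n := n) T (X s) K + weightedArea (n := n) T f (B \ K) := by
  have hKm := h.compact.isClosed.measurableSet
  have hBK : MeasurableSet (B \ K) := hB.diff hKm
  filter_upwards [(h.hasVariations hf T).integrable, isOpen_Ioo.mem_nhds h.zero_mem] with s hs hsε
  have heq : Set.EqOn (X s) f Kᶜ := fun p hp => h.fixed s hsε p hp
  -- `K` is closed in the Hausdorff space `M`, so `X s` and `f` agree on an open set containing `B \
  -- K`, and their volumes agree there.
  have hμ : (inducedVolume (n := n) (X s)).restrict (B \ K) =
      (inducedVolume (n := n) f).restrict (B \ K) := by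
    have h1 := inducedVolume_restrict_congr (n := n) h.compact.isClosed.isOpen_compl heq
    have h2 := congrArg (fun ν : Measure M => ν.restrict (B \ K)) h1
    have h3 : (B \ K) ∩ Kᶜ = B \ K := Set.inter_eq_left.mpr fun x hx => hx.2
    simpa only [Measure.restrict_restrict hBK, h3] using h2
  have hfun : Set.EqOn (fun x => Real.exp (inner ℝ T (f x)))
      (fun x => Real.exp (inner ℝ T (X s x))) (B \ K) := fun x hx => by
    simp only [heq hx.2]
  have hint2 : IntegrableOn (fun x => Real.exp (inner ℝ T (X s x))) (B \ K)
      (inducedVolume (n := n) (X s)) := by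
    rw [IntegrableOn, hμ]
    exact (integrableOn_congr_fun hfun hBK).mp (hint.mono_set Set.sdiff_subset)
  have hsplit := setIntegral_union Set.disjoint_sdiff_right hBK hs hint2
  rw [Set.union_sdiff_cancel hKB, hμ, ← setIntegral_congr_fun hBK hfun] at hsplit
  exact hsplit

/-- Solutions of `H = T^⊥` are critical points. -/
lemma isCriticalPoint_of_meanCurvature_eq (hf : IsSmoothImmersion (n := n) f)
    (hH : ∀ x, meanCurvature (n := n) f x = norProj (n := n) f x T) :
    IsCriticalPoint (n := n) T f := by
  intro X V K ε h
  refine (h.hasVariations hf T).first.congr_deriv ?_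
  have h0 : firstVariationDensity (n := n) T f V = fun _ => 0 := funext fun p => by
    rw [firstVariationDensity_eq hf h.contMDiff_field h.normal, hH, sub_self, inner_zero_left,
      mul_zero]
  rw [h0, integral_zero]

/-- The linear variation `f + s V` with a compactly supported normal field `V`. -/
lemma isNormalVariation_linear (hf : IsSmoothImmersion (n := n) f)
    (hV : ContMDiff (𝓡 n) 𝓘(ℝ, E) ∞ V) (hn : ∀ p, V p ∈ (tangentPlane (n := n) f p)ᗮ)
    (hK : IsCompact K) (h0 : ∀ p ∉ K, V p = 0) :
    IsNormalVariation (n := n) f (fun s p => f p + s • V p) V K 1 where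
  pos := one_pos
  smooth := ((hf.1.comp contMDiff_snd).add
    (contMDiff_fst.smul (hV.comp contMDiff_snd))).contMDiffOn
  initial := by simp
  compact := hK
  fixed := fun s _ p hp => by simp [h0 p hp]
  field := fun p => by
    simpa using ((hasDerivAt_id (0 : ℝ)).smul_const (V p)).const_add (f p)
  normal := hn

/-- Critical points satisfy `H = T^⊥`. -/
lemma meanCurvature_eq_of_isCriticalPoint (hf : IsSmoothImmersion (n := n) f)
    (hc : IsCriticalPoint (n := n) T f) (x : M) :
    meanCurvature (n := n) f x = norProj (n := n) f x T := by
  by_contra hne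
  -- The test field is the defect `T^⊥ - H`, multiplied by a bump function `ρ` at `x`. Its first
  -- variation density is the nonnegative function `exp⟨T, f⟩ ρ |U|²`, which is positive at `x` if
  -- the equation fails there.
  set U : M → E := fun q => norProj (n := n) f q T - meanCurvature (n := n) f q with hU
  have hUs : ContMDiff (𝓡 n) 𝓘(ℝ, E) ∞ U := by
    simp only [hU, norProj_eq_sub hf]
    exact (contMDiff_const.sub (contMDiff_tanProj hf contMDiff_const)).sub
      (contMDiff_meanCurvature hf)
  have hUn : ∀ p, U p ∈ (tangentPlane (n := n) f p)ᗮ := fun p =>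
    Submodule.sub_mem _ (Submodule.starProjection_apply_mem _ _) (meanCurvature_mem_orthogonal hf p)
  obtain ⟨ρ⟩ : Nonempty (SmoothBumpFunction (𝓡 n) x) := inferInstance
  have hρ : ContMDiff (𝓡 n) 𝓘(ℝ, ℝ) ∞ ρ := ρ.contMDiff
  have hv := isNormalVariation_linear hf (V := fun q => ρ q • U q) (hρ.smul hUs)
    (fun p => Submodule.smul_mem _ _ (hUn p)) ρ.hasCompactSupport
    (fun p hp => by rw [image_eq_zero_of_notMem_tsupport hp, zero_smul])
  set κ := firstVariationDensity (n := n) T f (fun q => ρ q • U q) with hκ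
  have hκeq : ∀ p, κ p = Real.exp (inner ℝ T (f p)) * (ρ p * ‖U p‖ ^ 2) := fun p => by
    rw [hκ, firstVariationDensity_eq hf hv.contMDiff_field hv.normal,
      show norProj (n := n) f p T - meanCurvature (n := n) f p = U p from rfl,
      real_inner_smul_right, real_inner_self_eq_norm_sq]
  have hzero : ∫ p in tsupport ρ, κ p ∂(inducedVolume (n := n) f) = 0 :=
    (hv.hasVariations hf T).first.unique (hc _ _ _ _ hv)
  have hsupp : ∀ p ∉ tsupport ρ, κ p = 0 := fun p hp => by
    rw [hκeq, image_eq_zero_of_notMem_tsupport hp, zero_mul, mul_zero]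
  rw [setIntegral_eq_integral_of_forall_compl_eq_zero hsupp] at hzero
  have := isLocallyFiniteMeasure_inducedVolume hf
  have : IsFiniteMeasureOnCompacts (inducedVolume (n := n) f) :=
    isFiniteMeasureOnCompacts_of_isLocallyFiniteMeasure
  have := isOpenPosMeasure_inducedVolume hf
  have hκx : κ x ≠ 0 := by
    rw [hκeq, ρ.eq_one, one_mul]
    have hUx : U x ≠ 0 := fun h => hne (sub_eq_zero.mp h).symm
    have := norm_pos_iff.mpr hUx
    positivity
  have hpos := (hv.continuous_firstVariationDensity (T := T)
    hf).integral_pos_of_hasCompactSupport_nonneg_nonzero (μ := inducedVolume (n := n) f)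
    (HasCompactSupport.intro ρ.hasCompactSupport hsupp)
    (fun p => by
      rw [Pi.zero_apply, ← hκ, hκeq]
      have := ρ.nonneg (x := p)
      positivity) hκx
  exact hpos.ne' hzero

variable [SecondCountableTopology M]

/-- The integral of the second variation density at a solution of `H = T^⊥`. -/
lemma IsNormalVariation.integral_secondVariationDensity
    (h : IsNormalVariation (n := n) f X V K ε) (hf : IsSmoothImmersion (n := n) f)
    (hH : ∀ x, meanCurvature (n := n) f x = norProj (n := n) f x T) :
    Integrable (fun x => -inner ℝ (V x) (stabilityOperator (n := n) T f V x) *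
        Real.exp (inner ℝ T (f x))) (inducedVolume (n := n) f) ∧
      ∫ x in K, secondVariationDensity (n := n) T f V (acceleration X) x
          ∂(inducedVolume (n := n) f) =
        ∫ x, -inner ℝ (V x) (stabilityOperator (n := n) T f V x) *
          Real.exp (inner ℝ T (f x)) ∂(inducedVolume (n := n) f) := by
  have hV := h.contMDiff_field
  -- The field whose divergence separates the second variation density from the stability integrand.
  -- It is tangent and vanishes outside `K`, so it integrates to zero.
  set Z : M → E := fun q => Real.exp (inner ℝ T (f q)) •
    (tanProj (n := n) f q (acceleration X q) + halfGradientNormSq (n := n) f V q) with hZ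
  have hYs : ContMDiff (𝓡 n) 𝓘(ℝ, E) ∞ (halfGradientNormSq (n := n) f V) :=
    contMDiff_of_chart fun φ hφ y hy => contDiffAt_halfGradientNormSq hf hV hφ hy
  have hexp : ContMDiff (𝓡 n) 𝓘(ℝ, ℝ) ∞ (fun q => Real.exp (inner ℝ T (f q))) :=
    contMDiff_of_chart fun φ hφ y hy =>
      (contDiffAt_const.inner ℝ (contDiffAt_immersion hf hφ hy)).exp
  have hZs : ContMDiff (𝓡 n) 𝓘(ℝ, E) ∞ Z :=
    hexp.smul ((contMDiff_tanProj hf h.contMDiff_acceleration).add hYs)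
  have hZ0 : ∀ p ∉ K, Z p = 0 := fun p hp => by
    simp [hZ, halfGradientNormSq, h.acceleration_eq_zero hp, h.field_eq_zero hp]
  have hZc : HasCompactSupport Z := HasCompactSupport.intro h.compact hZ0
  have hZt : ∀ q, tanProj (n := n) f q (Z q) = Z q := fun q => by
    simp only [hZ]
    rw [map_smul, map_add, tanProj_tanProj hf, tanProj_halfGradientNormSq hf hV]
  have hdiv0 : ∀ p ∉ K, divergence (n := n) f Z p = 0 := fun p hp =>
    divergence_eq_zero_of_notMem_tsupport hf fun hp' =>
      hp (closure_minimal (fun q hq => by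
        by_contra hqK
        exact hq (hZ0 q hqK)) h.compact.isClosed hp')
  set S : M → ℝ := fun x => -inner ℝ (V x) (stabilityOperator (n := n) T f V x) *
    Real.exp (inner ℝ T (f x)) with hS
  have hS0 : ∀ p ∉ K, S p = 0 := fun p hp => by simp [hS, h.field_eq_zero hp]
  have hκ : ∀ p, secondVariationDensity (n := n) T f V (acceleration X) p =
      S p + divergence (n := n) f Z p := fun p =>
    secondVariationDensity_eq hf hV h.normal T h.contMDiff_acceleration (hH p)
  have hdivI := integrable_divergence hf hZs hZc
  -- Convergence is inherited: `S` is the difference of two densities already known to be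
  -- integrable.
  have hSK : IntegrableOn S K (inducedVolume (n := n) f) := by
    have h1 := (h.hasVariations hf T).integrable_second.sub hdivI.integrableOn
    refine h1.congr (Filter.Eventually.of_forall fun p => ?_)
    simp only [Pi.sub_apply, hκ, add_sub_cancel_right]
  have hSI : Integrable S (inducedVolume (n := n) f) :=
    (integrableOn_iff_integrable_of_support_subset fun p hp => by
      by_contra hpK
      exact hp (hS0 p hpK)).mp hSK
  refine ⟨hSI, ?_⟩
  simp_rw [hκ]
  rw [integral_add hSK hdivI.integrableOn, setIntegral_eq_integral_of_forall_compl_eq_zero hS0,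
    setIntegral_eq_integral_of_forall_compl_eq_zero hdiv0, integral_divergence_eq_zero hf hZs hZc hZt,
    add_zero]

end Measure

end SecondVariation

end WeightedArea

end

/-! ### The variation formulas assembled. -/

theorem theorem2p3 {n p : ℕ} {M : Type*} [TopologicalSpace M] [T2Space M]
    [SecondCountableTopology M] [ChartedSpace (EuclideanSpace ℝ (Fin n)) M]
    [IsManifold (𝓡 n) ∞ M] [MeasurableSpace M] [BorelSpace M]
    (T : EuclideanSpace ℝ (Fin (n + p))) (f : M → EuclideanSpace ℝ (Fin (n + p)))
    (hf : WeightedArea.IsSmoothImmersion (n := n) f) :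
    -- critical points of `F` are the solutions of `H = T^⊥`
    (WeightedArea.IsCriticalPoint (n := n) T f ↔
      ∀ x : M, WeightedArea.meanCurvature (n := n) f x = WeightedArea.norProj (n := n) f x T) ∧
    -- the second variation at a critical point
    (WeightedArea.IsCriticalPoint (n := n) T f →
      ∀ (X : ℝ → M → EuclideanSpace ℝ (Fin (n + p))) (V : M → EuclideanSpace ℝ (Fin (n + p)))
        (K : Set M) (ε : ℝ), WeightedArea.IsNormalVariation (n := n) f X V K ε →
        -- `F` is finite on `K`, and the integral on the right hand side converges
        MeasureTheory.IntegrableOn (fun x => Real.exp (inner ℝ T (f x))) K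
          (WeightedArea.inducedVolume (n := n) f) ∧
        MeasureTheory.Integrable
          (fun x => -inner ℝ (V x) (WeightedArea.stabilityOperator (n := n) T f V x) *
            Real.exp (inner ℝ T (f x))) (WeightedArea.inducedVolume (n := n) f) ∧
        -- `F` is evaluated on any region `B ⊇ K` of finite weighted area, such as `B = K`,
        -- or all of `M` if `F` is finite
        ∀ B : Set M, MeasurableSet B → K ⊆ B →
          MeasureTheory.IntegrableOn (fun x => Real.exp (inner ℝ T (f x))) B
            (WeightedArea.inducedVolume (n := n) f) →
          (∀ᶠ s in nhds (0 : ℝ),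
            DifferentiableAt ℝ (fun r => WeightedArea.weightedArea (n := n) T (X r) B) s) ∧
          HasDerivAt (deriv fun r => WeightedArea.weightedArea (n := n) T (X r) B)
            (∫ x, -inner ℝ (V x) (WeightedArea.stabilityOperator (n := n) T f V x) *
              Real.exp (inner ℝ T (f x)) ∂(WeightedArea.inducedVolume (n := n) f)) 0) := by
  have hcrit : WeightedArea.IsCriticalPoint (n := n) T f ↔
      ∀ x : M, WeightedArea.meanCurvature (n := n) f x = WeightedArea.norProj (n := n) f x T :=
    ⟨fun h => WeightedArea.meanCurvature_eq_of_isCriticalPoint hf h,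
      WeightedArea.isCriticalPoint_of_meanCurvature_eq hf⟩
  refine ⟨hcrit, fun hc X V K ε h => ?_⟩
  have hv := h.hasVariations hf T
  obtain ⟨hI, hint⟩ := h.integral_secondVariationDensity hf (hcrit.mp hc)
  refine ⟨?_, hI, fun B hB hKB hBint => ?_⟩
  · have := hv.integrable.self_of_nhds
    rwa [h.initial] at this
  -- For `s` near zero, passing from `K` to `B` adds the constant weighted area of `B \ K`, which no
  -- derivative sees.
  · have heq := h.weightedArea_eventuallyEq hf hB hKB hBint
    refine ⟨?_, ?_⟩
    · filter_upwards [hv.differentiable, heq.eventuallyEq_nhds] with s hs he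
      exact (hs.add_const _).congr_of_eventuallyEq he
    · rw [← hint]
      refine hv.second.congr_of_eventuallyEq ?_
      filter_upwards [heq.eventuallyEq_nhds] with s he
      rw [he.deriv_eq, deriv_add_const]
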